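/- **Setting.** Fix $\lambda_m,\lambda_f,P_m,P_f,\ell_W,C_L,C_N,\alpha_L,\beta,\theta_{\rm 3dB},\sigma,\gamma_m>0$, $\alpha_N>2$, $R_c\ge 0$, an integer $m\ge 1$, and real $H_{\rm eff},\theta_{\rm tilt},\mathrm{SLL}_{\rm dB}$. Macro base stations (MBSs) form a homogeneous Poisson point process $\Phi_m$ of density $\lambda_m$ in the plane. Femto base stations (FBSs) have density $\lambda_f$, and those within distance $R_c$ of an MBS sleep; the active FBSs are treated as a homogeneous Poisson point process $\Phi_f'$, independent of $\Phi_m$, of density $\lambda_{f'}=\lambda_f e^{-\lambda_m\pi R_c^2}$. The typical macro user is at the origin. A link from an MBS at distance $r$ is line-of-sight (LOS) with probability $P_L(r)=e^{-\beta r}$ and then has path loss $C_Lr^{-\alpha_L}$; otherwise, with probability $P_N(r)=1-P_L(r)$, it is NLOS with path loss $C_Nr^{-\alpha_N}$. Links from FBSs are always NLOS and have the additional wall attenuation $\ell_W$. An MBS at horizontal distance $r$ has the vertical gain $G(r)=10^{-\frac1{10}\min\left(12\left(\frac{\arctan(H_{\rm eff}/r)-\theta_{\rm tilt}}{\theta_{\rm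 3dB}}\right)^2,\ \mathrm{SLL}_{\rm dB}\right)}$. Let MBSs, macro users and FBSs have horizontal main-lobe gains $M_t,M_r,M^f>0$, side-lobe gains $m_t,m_r,m^f\ge 0$ and beamwidths $\varphi_t,\varphi_r,\varphi^f\in[0,2\pi]$, and put $c_t=\frac{\varphi_t}{2\pi}$, $c_r=\frac{\varphi_r}{2\pi}$, $c^f=\frac{\varphi^f}{2\pi}$. The horizontal gain $D$ of an interfering MBS link takes the values $(d_i)_{i\le 4}=(M_tM_r,M_tm_r,m_tM_r,m_tm_r)$ with probabilities $(p_i)_{i\le 4}=(c_tc_r,\,c_t(1-c_r),\,(1-c_t)c_r,\,(1-c_t)(1-c_r))$; the horizontal gain $D^{fm}$ of an FBS link takes the values $d_i^{fm}$ with probabilities $p_i^{fm}$ obtained in the same way with $M^f,m^f,c^f$ in place of $M_t,m_t,c_t$. The fading power $|h|^2$ of MBS links is $\Gamma(m,1/m)$ distributed, and the fading $g$ of FBS links is $\mathcal{CN}(0,1)$ distributed. Given the positions, the LOS states, gains and fadings of all links are independent. The *equivalent distance* of an MBS at distance $r$ is $r$ if its link is LOS and $R_{eq}(r)=(C_L/C_N)^{1/\alpha_L}r^{\alpha_N/\alpha_L}$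 if it is NLOS. The user is served by the MBS with the smallest equivalent distance $R$ (that is, with the strongest average path gain), and this MBS is treated as a LOS station at distance $R$; the serving link has horizontal gain $D_0=M_tM_r$ and vertical gain $G_0=G(R)$. Let $I_{\Phi_m}$ be the sum over the other MBSs of $P_mLDG(r)|h|^2$, with $L$ the path loss and $r$ the actual distance, let $I^m_{\Phi_f'}$ be the sum over $\Phi_f'$ of $P_f\ell_WC_Nr^{-\alpha_N}D^{fm}|g|^2$, and let $$\mathrm{SINR}_m=\frac{P_mC_LR^{-\alpha_L}D_0G_0|h_0|^2}{I_{\Phi_m}+I^m_{\Phi_f'}+\sigma^2},$$ where $h_0$ is the fading of the serving link. **Theorem.** Almost surely the serving MBS is unique and $I_{\Phi_m},I^m_{\Phi_f'}<\infty$, and the following holds. 1. With $\mu=(C_N/C_L)^{1/\alpha_N}$, $\kappa=\alpha_L/\alpha_N$ and $R_{eq}^{-1}(r)=\mu r^{\kappa}$, the distance $R$ has on $(0,\infty)$ the density $$f_R(r)=2\pi\lambda_m\left(re^{-\beta r}+\mu^2\kappa r^{2\kappa-1}\big(1-e^{-\beta R_{eq}^{-1}(r)}\big)\right)e^{-\frac{2\pi\lambda_m}{\beta^2}\left(1-(1+\beta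 r)e^{-\beta r}\right)}\,e^{-\frac{2\pi\lambda_m}{\beta^2}\left(\frac{\beta^2R_{eq}^{-1}(r)^2}{2}+(\beta R_{eq}^{-1}(r)+1)e^{-\beta R_{eq}^{-1}(r)}-1\right)}.$$ 2. For each $z\ge 0$, $E[e^{-zI_{\Phi_m}}\mid R]=\mathcal L_{I_{\Phi_m}}(z;R)$ almost surely, where, with $C_i=2\pi\lambda_mp_i$ and $F_w(z,x,d)=1-\left(1+\frac{zP_mC_wd\,G(x)}{m\,x^{\alpha_w}}\right)^{-m}$ for $w\in\{L,N\}$, $$\mathcal L_{I_{\Phi_m}}(z;\rho)=\prod_{i=1}^4e^{-C_i\int_\rho^\infty F_L(z,x,d_i)\,xP_L(x)\,dx}\ \prod_{i=1}^4e^{-C_i\int_{R_{eq}^{-1}(\rho)}^\infty F_N(z,x,d_i)\,xP_N(x)\,dx}.$$ 3. For each $z\ge 0$, with $C_i^{f'}=2\pi\lambda_{f'}p_i^{fm}$, $$E\big[e^{-zI^m_{\Phi_f'}}\big]=\mathcal L_{I^m_{\Phi_f'}}(z)=\prod_{i=1}^4\exp\left(-C_i^{f'}\left(zP_f\ell_WC_Nd_i^{fm}\right)^{2/\alpha_N}\frac{\pi}{\alpha_N\sin(2\pi/\alpha_N)}\right).$$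 4. For $\rho>0$ put $s=s(\rho)=\frac{\gamma_m\rho^{\alpha_L}}{P_mC_LD_0G(\rho)}$ and $C_{k,\ell}=(-1)^\ell\frac{(ms)^\ell(ms\sigma^2)^{k-\ell}}{k!}\binom k\ell$. The product $\mathcal L_{I_{\Phi_m}}(z;\rho)\,\mathcal L_{I^m_{\Phi_f'}}(z)$ is infinitely differentiable in $z>0$, and $$\Pr\{\mathrm{SINR}_m>\gamma_m\}=\int_0^\infty e^{-ms\sigma^2}\sum_{k=0}^{m-1}\sum_{\ell=0}^kC_{k,\ell}\left[\frac{d^\ell}{dz^\ell}\left(\mathcal L_{I_{\Phi_m}}(z;\rho)\,\mathcal L_{I^m_{\Phi_f'}}(z)\right)\right]_{z=ms}f_R(\rho)\,d\rho,$$ where the integral converges absolutely. -/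

import Mathlib

open MeasureTheory ProbabilityTheory Set
open scoped NNReal ENNReal

noncomputable section

/-! ### Poisson point processes given by an enumeration of their points -/

/-- The number of points of the configuration `X ω 0, X ω 1, …` that lie in `B`. -/
def pointCount {Ω E : Type*} (X : Ω → ℕ → E) (B : Set E) (ω : Ω) : ℝ≥0∞ :=
  ∑' j, B.indicator (fun _ => (1 : ℝ≥0∞)) (X ω j)

/-- `X` enumerates the points of a Poisson point process with intensity measure `Λ`: the number of
points in a set of finite intensity is Poisson distributed, and the numbers of points in disjoint
sets are independent. (A process whose intensity has infinite total mass has infinitely many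
points, so that it can be enumerated by `ℕ`.) -/
structure IsPoissonPP {Ω E : Type*} [MeasurableSpace Ω] [MeasurableSpace E]
    (μ : Measure Ω) (X : Ω → ℕ → E) (Λ : Measure E) : Prop where
  measurable : Measurable X
  map_pointCount : ∀ B : Set E, MeasurableSet B → Λ B ≠ ∞ →
    μ.map (pointCount X B) =
      (poissonMeasure (Λ B).toNNReal).map (fun n : ℕ => (n : ℝ≥0∞))
  iIndepFun_pointCount : ∀ (n : ℕ) (B : Fin n → Set E), (∀ i, MeasurableSet (B i)) →
    (∀ i, Λ (B i) ≠ ∞) → Pairwise (fun i j => Disjoint (B i) (B j)) →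
    iIndepFun (fun i => pointCount X (B i)) μ

/-- The plane, with its Euclidean norm. -/
abbrev Plane : Type := EuclideanSpace ℝ (Fin 2)

/-- The homogeneous intensity measure of density `c` in the plane. -/
def homogeneousIntensity (c : ℝ) : Measure Plane := ENNReal.ofReal c • volume

/-- The circularly symmetric complex Gaussian distribution `CN(0,1)`. -/
def complexGaussian : Measure ℂ :=
  ((gaussianReal 0 (1 / 2)).prod (gaussianReal 0 (1 / 2))).map (fun p => (⟨p.1, p.2⟩ : ℂ))

/-! ### Horizontal antenna gains -/

/-- The four values of the total horizontal antenna gain of a link whose transmitter and receiver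
have main-lobe gains `Mt`, `Mr` and side-lobe gains `mt`, `mr`. -/
def gainValue (Mt mt Mr mr : ℝ) : Fin 4 → ℝ :=
  ![Mt * Mr, Mt * mr, mt * Mr, mt * mr]

/-- The probabilities of the four gain values when the transmitter and the receiver have horizontal
beamwidths `φt` and `φr`. -/
def gainProb (φt φr : ℝ) : Fin 4 → ℝ :=
  ![(φt / (2 * Real.pi)) * (φr / (2 * Real.pi)),
    (φt / (2 * Real.pi)) * (1 - φr / (2 * Real.pi)),
    (1 - φt / (2 * Real.pi)) * (φr / (2 * Real.pi)),
    (1 - φt / (2 * Real.pi)) * (1 - φr / (2 * Real.pi))]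

/-- The law of a random variable that takes the value `d i` with probability `p i`. -/
def gainLaw (d p : Fin 4 → ℝ) : Measure ℝ :=
  ∑ i, ENNReal.ofReal (p i) • Measure.dirac (d i)

/-! ### Parameters of the two-tier network -/

/-- The deterministic parameters of the network. -/
structure HetNetParams where
  /-- density of the macro base stations (MBSs) -/
  lamM : ℝ
  /-- density of all femto base stations (FBSs), active or asleep -/
  lamF : ℝ
  /-- radius of the sleep region around each MBS -/
  Rc : ℝ
  /-- transmission power of an MBS -/
  Pm : ℝ
  /-- transmission power of an FBS -/
  Pf : ℝ
  /-- wall attenuation -/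
  ellW : ℝ
  /-- LOS reference path loss -/
  CL : ℝ
  /-- NLOS reference path loss -/
  CN : ℝ
  /-- LOS path loss exponent -/
  alphaL : ℝ
  /-- NLOS path loss exponent -/
  alphaN : ℝ
  /-- intensity of the blockage effect -/
  beta : ℝ
  /-- effective height: MBS antenna height minus user antenna height -/
  Heff : ℝ
  /-- tilt angle of the MBS array -/
  thetaTilt : ℝ
  /-- vertical 3dB beamwidth -/
  theta3dB : ℝ
  /-- vertical side-lobe level in dB -/
  SLLdB : ℝ
  /-- main-lobe gain, side-lobe gain and horizontal beamwidth of an MBS -/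
  Mt : ℝ
  mt : ℝ
  phit : ℝ
  /-- main-lobe gain, side-lobe gain and horizontal beamwidth of a macro user -/
  Mr : ℝ
  mr : ℝ
  phir : ℝ
  /-- main-lobe gain, side-lobe gain and horizontal beamwidth of an FBS -/
  Mf : ℝ
  mf : ℝ
  phif : ℝ
  /-- Nakagami fading parameter -/
  m : ℕ
  /-- standard deviation of the noise, whose power is `sigma ^ 2` -/
  sigma : ℝ
  /-- SINR threshold of the typical macro user -/
  gammaM : ℝ
  lamM_pos : 0 < lamM
  lamF_pos : 0 < lamF
  Rc_nonneg : 0 ≤ Rc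
  Pm_pos : 0 < Pm
  Pf_pos : 0 < Pf
  ellW_pos : 0 < ellW
  CL_pos : 0 < CL
  CN_pos : 0 < CN
  alphaL_pos : 0 < alphaL
  two_lt_alphaN : 2 < alphaN
  beta_pos : 0 < beta
  theta3dB_pos : 0 < theta3dB
  Mt_pos : 0 < Mt
  mt_nonneg : 0 ≤ mt
  phit_mem : phit ∈ Icc 0 (2 * Real.pi)
  Mr_pos : 0 < Mr
  mr_nonneg : 0 ≤ mr
  phir_mem : phir ∈ Icc 0 (2 * Real.pi)
  Mf_pos : 0 < Mf
  mf_nonneg : 0 ≤ mf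
  phif_mem : phif ∈ Icc 0 (2 * Real.pi)
  m_pos : 1 ≤ m
  sigma_pos : 0 < sigma
  gammaM_pos : 0 < gammaM

namespace HetNetParams

variable (P : HetNetParams)

/-- `λ_{f'} = λ_f exp(-λ_m π R_c²)`, the density of the active FBSs. -/
def lamF' : ℝ := P.lamF * Real.exp (-P.lamM * Real.pi * P.Rc ^ 2)

/-- Vertical antenna gain (on a linear scale) of an MBS at horizontal distance `r`; in decibels it
is `-min (12 ((atan (H_eff / r) - θ_tilt) / θ_3dB)², SLL_dB)`. -/
def G (r : ℝ) : ℝ :=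
  (10 : ℝ) ^ (-(min (12 * ((Real.arctan (P.Heff / r) - P.thetaTilt) / P.theta3dB) ^ 2)
    P.SLLdB) / 10)

/-- LOS probability of a link of length `r`. -/
def probL (r : ℝ) : ℝ := Real.exp (-P.beta * r)

/-- NLOS probability of a link of length `r`. -/
def probN (r : ℝ) : ℝ := 1 - P.probL r

/-- LOS path loss. -/
def lossL (r : ℝ) : ℝ := P.CL * r ^ (-P.alphaL)

/-- NLOS path loss. -/
def lossN (r : ℝ) : ℝ := P.CN * r ^ (-P.alphaN)

/-- The distance at which a LOS base station has the same path loss as an NLOS base station at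
distance `r`. -/
def Req (r : ℝ) : ℝ := (P.CL / P.CN) ^ (1 / P.alphaL) * r ^ (P.alphaN / P.alphaL)

/-- `μ = (C_N / C_L)^{1/α_N}`. -/
def muR : ℝ := (P.CN / P.CL) ^ (1 / P.alphaN)

/-- `κ = α_L / α_N`. -/
def kappa : ℝ := P.alphaL / P.alphaN

/-- `R_eq⁻¹(r) = μ r^κ`. -/
def ReqInv (r : ℝ) : ℝ := P.muR * r ^ P.kappa

/-- Total horizontal gains of a link from an MBS to a macro user, and their probabilities. -/
def d : Fin 4 → ℝ := gainValue P.Mt P.mt P.Mr P.mr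
def p : Fin 4 → ℝ := gainProb P.phit P.phir

/-- Total horizontal gains of a link from an FBS to a macro user, and their probabilities. -/
def dfm : Fin 4 → ℝ := gainValue P.Mf P.mf P.Mr P.mr
def pfm : Fin 4 → ℝ := gainProb P.phif P.phir

/-- Horizontal gain of the serving link, whose main beams are aligned. -/
def D0 : ℝ := P.Mt * P.Mr

/-- The density `f_R` of the (LOS-equivalent) distance of the serving MBS. -/
def fR (r : ℝ) : ℝ :=
  2 * Real.pi * P.lamM *
    (r * Real.exp (-P.beta * r) +
      P.muR ^ 2 * P.kappa * r ^ (2 * P.kappa - 1) * (1 - Real.exp (-P.beta * P.ReqInv r))) *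
  Real.exp (-(2 * Real.pi * P.lamM / P.beta ^ 2) *
    (1 - (1 + P.beta * r) * Real.exp (-P.beta * r))) *
  Real.exp (-(2 * Real.pi * P.lamM / P.beta ^ 2) *
    (P.beta ^ 2 * P.ReqInv r ^ 2 / 2 +
      (P.beta * P.ReqInv r + 1) * Real.exp (-P.beta * P.ReqInv r) - 1))

/-- `F_L(z, x, D)`. -/
def FL (z x D : ℝ) : ℝ :=
  1 - 1 / (1 + z * P.Pm * P.CL * D * P.G x / (P.m * x ^ P.alphaL)) ^ P.m

/-- `F_N(z, x, D)`. -/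
def FN (z x D : ℝ) : ℝ :=
  1 - 1 / (1 + z * P.Pm * P.CN * D * P.G x / (P.m * x ^ P.alphaN)) ^ P.m

/-- `C_i = 2 π λ_m p_i`. -/
def Ci (i : Fin 4) : ℝ := 2 * Real.pi * P.lamM * P.p i

/-- `C_i^{f'} = 2 π λ_{f'} p_i^{fm}`. -/
def Cif (i : Fin 4) : ℝ := 2 * Real.pi * P.lamF' * P.pfm i

/-- The expression for the Laplace transform, at `z`, of the interference of the MBSs, when the
serving MBS is at equivalent distance `ρ`. -/
def laplaceMacro (ρ z : ℝ) : ℝ :=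
  (∏ i, Real.exp (-P.Ci i * ∫ x in Ioi ρ, P.FL z x (P.d i) * x * P.probL x)) *
  (∏ i, Real.exp (-P.Ci i * ∫ x in Ioi (P.ReqInv ρ), P.FN z x (P.d i) * x * P.probN x))

/-- The expression for the Laplace transform, at `z`, of the interference of the active FBSs. -/
def laplaceFemto (z : ℝ) : ℝ :=
  ∏ i, Real.exp (-P.Cif i * (z * P.Pf * P.ellW * P.CN * P.dfm i) ^ (2 / P.alphaN) *
    (Real.pi / (P.alphaN * Real.sin (2 * Real.pi / P.alphaN))))

/-- The product of the two expressions. -/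
def laplaceTotal (ρ z : ℝ) : ℝ := P.laplaceMacro ρ z * P.laplaceFemto z

/-- `s = γ_m ρ^{α_L} / (P_m C_L D_0 G_0)`, where `G_0` is the vertical gain at distance `ρ`. -/
def s (ρ : ℝ) : ℝ := P.gammaM * ρ ^ P.alphaL / (P.Pm * P.CL * P.D0 * P.G ρ)

/-- `C_{k,ℓ} = (-1)^ℓ (m s)^ℓ (m s σ²)^{k-ℓ} / k! * (k choose ℓ)`. -/
def Ckl (ρ : ℝ) (k l : ℕ) : ℝ :=
  (-1) ^ l * (P.m * P.s ρ) ^ l * (P.m * P.s ρ * P.sigma ^ 2) ^ (k - l) / (k.factorial : ℝ) *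
    (k.choose l : ℝ)

/-- The integrand of the coverage probability formula. -/
def coverageIntegrand (ρ : ℝ) : ℝ :=
  Real.exp (-(P.m * P.s ρ * P.sigma ^ 2)) *
    (∑ k ∈ Finset.range P.m, ∑ l ∈ Finset.range (k + 1),
      P.Ckl ρ k l * iteratedDeriv l (fun z => P.laplaceTotal ρ z) (P.m * P.s ρ)) *
    P.fR ρ

/-- The law of the marks of an MBS: an auxiliary uniform variable that decides between LOS and
NLOS, the total horizontal gain, and the fading power, which is `Γ(m, 1/m)` distributed (shape `m`,
scale `1/m`, that is, rate `m`). -/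
def macroMarkLaw : Measure (ℝ × ℝ × ℝ) :=
  (volume.restrict (Icc (0 : ℝ) 1)).prod ((gainLaw P.d P.p).prod (gammaMeasure P.m P.m))

/-- The law of the marks of an FBS: the total horizontal gain and the complex fading
coefficient. -/
def femtoMarkLaw : Measure (ℝ × ℂ) := (gainLaw P.dfm P.pfm).prod complexGaussian

end HetNetParams

/-! ### The random network seen by the typical macro user, who is at the origin -/

/-- A two-tier network on the probability space `(Ω, μ)`. The active FBSs form a homogeneous
Poisson point process of density `λ_{f'}` which is independent of the MBSs. -/
structure HetNet (P : HetNetParams) {Ω : Type*} [MeasurableSpace Ω] (μ : Measure Ω) where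
  /-- positions of the MBSs -/
  X : Ω → ℕ → Plane
  /-- auxiliary uniform variables: the `j`th MBS is LOS iff `U ω j` is at most the LOS probability
  at its distance -/
  U : Ω → ℕ → ℝ
  /-- total horizontal gains between the MBSs and the user -/
  D : Ω → ℕ → ℝ
  /-- fading powers `|h|²` between the MBSs and the user -/
  hpow : Ω → ℕ → ℝ
  /-- positions of the active FBSs -/
  Y : Ω → ℕ → Plane
  /-- total horizontal gains between the FBSs and the user -/
  Dfm : Ω → ℕ → ℝ
  /-- fading coefficients between the FBSs and the user -/
  g : Ω → ℕ → ℂ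
  measurable_U : Measurable U
  measurable_D : Measurable D
  measurable_hpow : Measurable hpow
  measurable_Dfm : Measurable Dfm
  measurable_g : Measurable g
  isPoissonPP_X : IsPoissonPP μ X (homogeneousIntensity P.lamM)
  isPoissonPP_Y : IsPoissonPP μ Y (homogeneousIntensity P.lamF')
  /-- The two point processes and the two sequences of marks are independent, and each sequence of
  marks is independent and identically distributed with the given law. -/
  joint_law :
    μ.map (fun ω => ((X ω, fun j => (U ω j, D ω j, hpow ω j)),
        (Y ω, fun j => (Dfm ω j, g ω j)))) =
      ((μ.map X).prod (Measure.infinitePi fun _ : ℕ => P.macroMarkLaw)).prod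
        ((μ.map Y).prod (Measure.infinitePi fun _ : ℕ => P.femtoMarkLaw))

namespace HetNet

variable {P : HetNetParams} {Ω : Type*} [MeasurableSpace Ω] {μ : Measure Ω} (N : HetNet P μ)

/-- The link from the `j`th MBS to the user is LOS; given the positions this has probability
`P_L(‖X j‖)`. -/
def IsLOS (ω : Ω) (j : ℕ) : Prop := N.U ω j ≤ P.probL ‖N.X ω j‖

open Classical in
/-- Path loss between the `j`th MBS and the user. -/
def pathLoss (ω : Ω) (j : ℕ) : ℝ :=
  if N.IsLOS ω j then P.lossL ‖N.X ω j‖ else P.lossN ‖N.X ω j‖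

open Classical in
/-- The LOS-equivalent distance of the `j`th MBS. -/
def equivDist (ω : Ω) (j : ℕ) : ℝ :=
  if N.IsLOS ω j then ‖N.X ω j‖ else P.Req ‖N.X ω j‖

/-- The index of the serving MBS: the MBS with the smallest equivalent distance, that is, with the
strongest average path gain. -/
def serving (ω : Ω) : ℕ := sInf {j | ∀ i, N.equivDist ω j ≤ N.equivDist ω i}

/-- The equivalent distance of the serving MBS. -/
def R (ω : Ω) : ℝ := N.equivDist ω (N.serving ω)

/-- The power received from the `j`th MBS if it interferes, and `0` for the serving MBS. -/
def macroTerm (ω : Ω) (j : ℕ) : ℝ :=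
  if j = N.serving ω then 0
  else P.Pm * N.pathLoss ω j * N.D ω j * P.G ‖N.X ω j‖ * N.hpow ω j

/-- The interference of the MBSs. -/
def macroInterference (ω : Ω) : ℝ := ∑' j, N.macroTerm ω j

/-- The power received from the `j`th active FBS; these links are always NLOS. -/
def femtoTerm (ω : Ω) (j : ℕ) : ℝ :=
  P.Pf * P.ellW * P.lossN ‖N.Y ω j‖ * N.Dfm ω j * ‖N.g ω j‖ ^ 2

/-- The interference of the active FBSs. -/
def femtoInterference (ω : Ω) : ℝ := ∑' j, N.femtoTerm ω j

/-- The SINR of the typical macro user. The serving MBS is treated as a LOS station at the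
equivalent distance, so that its vertical gain is the one at the distance `R`; its path loss
`pathLoss ω (serving ω)` equals `C_L R^{-α_L}`. -/
def sinr (ω : Ω) : ℝ :=
  P.Pm * N.pathLoss ω (N.serving ω) * P.D0 * P.G (N.R ω) * N.hpow ω (N.serving ω) /
    (N.macroInterference ω + N.femtoInterference ω + P.sigma ^ 2)

end HetNet

end

/-! A Poisson process enters only through its Laplace functional `E ∏ f(Z_j) = exp(-∫ (1 - f) dM)`,
for measurable `f` with values in `[0, 1]`. Independent Poisson counts on the fibres of a simple
function give it for the positions, monotone limits extend it (`IsPoissonPP.lintegral_expNeg_tsum`),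
and averaging over the i.i.d. marks carries it to the stations together with their LOS variable,
gain and fading (`IsPoissonPP.hasPoissonLaplace_marked`). Most expectations are `[0, ∞]`-valued
integrals, so that the Laplace transforms are available before the interferences are known to be
finite.

The serving station is handled by a Campbell–Mecke formula for the nearest point
(`HasPoissonLaplace.lintegral_tsum_nearest`): the mean of the sum over points `z` of `u z`, times
the product of `w` over the other points, all of them farther than `z`, is `∫ u(z) exp(-∫ (1 -
1{farther than z} w) dM) dM(z)`. It follows from the Laplace functional alone. If `f` vanishes on
`B`, the part of `E ∏ (f + s 1_B u)` of first order in `s` singles out the configurations with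
exactly one point in `B`; cutting space into thin shells of the distance then isolates the nearest
point.

Under the intensity measure the equivalent distance has the density `Λ'`, with `Λ = meanUpTo`, and
the fading factors out with its own law. Since `Λ 0 = 0` and `Λ → ∞`, the function `f_R = Λ' e^{-Λ}`
integrates to 1. Hence the expected number of strictly nearest stations is 1; there is never more
than one, so almost surely there is exactly one (`HetNet.ae_serving_lt`). With `u` a function of
distance and fading and `w = e^{-t power}` the same formula yields the joint transform of serving
distance, serving fading and MBS interference (`HetNet.lintegral_R_fading_macroSum`), because the
exponent splits into `Λ ρ` and the exponent of `laplaceMacro`. The density of `R` and the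
conditional Laplace transform are special cases. The transform of the FBS interference is the
Laplace functional itself, evaluated with the reflection formula for the Gamma function.

For the coverage probability, a finite measure on `[0, ∞]` is determined by its Laplace transform at
the integers. So the triple of serving distance, serving fading and total interference has the law
obtained by drawing `ρ` like `R`, an independent fading, and an independent copy of the interference
`T` from beyond `ρ` (`HetNet.map_R_fading_total`). The event `SINR > γ` says that the fading exceeds
`s (T + σ²)`. The Erlang tail is an exponential times a polynomial, and `E[(-T)^l e^{-zT}]` is the
`l`-th derivative of the moment generating function of `-T`, which is `laplaceTotal`; this
identification also supplies the smoothness. -/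

noncomputable section

/-! ### The exponential `e^{-x}` on `[0, ∞]` -/

section ExpNeg
open Filter Topology

/-- `x ↦ e^{-x}` on `[0, ∞]`. -/
def expNeg (x : ℝ≥0∞) : ℝ≥0∞ := EReal.exp (-(x : EReal))

@[simp] lemma expNeg_zero : expNeg 0 = 1 := by simp [expNeg]

@[simp] lemma expNeg_top : expNeg ∞ = 0 := by simp [expNeg]

lemma expNeg_ofReal {x : ℝ} (hx : 0 ≤ x) :
    expNeg (ENNReal.ofReal x) = ENNReal.ofReal (Real.exp (-x)) := by
  simp only [expNeg, EReal.coe_ennreal_ofReal, max_eq_left hx]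
  rw [← EReal.coe_neg, EReal.exp_coe]

lemma expNeg_add (x y : ℝ≥0∞) : expNeg (x + y) = expNeg x * expNeg y := by
  simp only [expNeg, EReal.exp_neg, EReal.coe_ennreal_add, EReal.exp_add]
  by_cases hx : x = ∞
  · simp [hx]
  by_cases hy : y = ∞
  · simp [hy]
  · rw [ENNReal.mul_inv]
    · left; simp
    · left; simp [hx]

lemma expNeg_antitone : Antitone expNeg := fun x y h => by
  unfold expNeg
  exact EReal.exp_monotone (EReal.neg_le_neg_iff.2 (by exact_mod_cast h))

lemma expNeg_le_one (x : ℝ≥0∞) : expNeg x ≤ 1 := by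
  simpa using expNeg_antitone (zero_le : 0 ≤ x)

lemma continuous_expNeg : Continuous expNeg :=
  ENNReal.continuous_exp.comp (continuous_neg.comp continuous_coe_ennreal_ereal)

lemma measurable_expNeg : Measurable expNeg := continuous_expNeg.measurable

lemma expNeg_ne_top (x : ℝ≥0∞) : expNeg x ≠ ∞ := ne_top_of_le_ne_top ENNReal.one_ne_top (expNeg_le_one x)

lemma expNeg_sum {ι : Type*} (s : Finset ι) (g : ι → ℝ≥0∞) :
    expNeg (∑ i ∈ s, g i) = ∏ i ∈ s, expNeg (g i) := by
  classical
  induction s using Finset.induction_on with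
  | empty => simp
  | insert a s ha ih => rw [Finset.sum_insert ha, Finset.prod_insert ha, expNeg_add, ih]

/-- A measurable choice of `-log f`. -/
def negLog (y : ℝ≥0∞) : ℝ≥0∞ := (-ENNReal.log y).toENNReal

lemma measurable_negLog : Measurable negLog := by
  unfold negLog
  fun_prop

/-- Writes any function with values in `[0, 1]`, zeros included, as `e^{-g}`. The bound `y ≤ 1`
makes `-log y` nonnegative, so that `toENNReal` truncates nothing. -/
lemma expNeg_negLog {y : ℝ≥0∞} (hy : y ≤ 1) : expNeg (negLog y) = y := by
  have h : 0 ≤ -ENNReal.log y := by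
    rw [EReal.le_neg]; simpa using ENNReal.log_monotone hy
  rw [expNeg, negLog, EReal.coe_toENNReal h, neg_neg, ENNReal.exp_log]

lemma expNeg_nsmul (n : ℕ) (x : ℝ≥0∞) : expNeg (n * x) = expNeg x ^ n := by
  induction n with
  | zero => simp
  | succ n ih => push_cast; rw [add_mul, one_mul, expNeg_add, ih, pow_succ]

/-- Sums in `[0, ∞]` always converge, and `expNeg` is continuous up to `∞`, so it maps the limit of
the partial sums to that of the partial products. -/
lemma ENNReal.tprod_expNeg {ι : Type*} (g : ι → ℝ≥0∞) :
    ∏' i, expNeg (g i) = expNeg (∑' i, g i) := by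
  have h1 : HasProd (fun i => expNeg (g i)) (expNeg (∑' i, g i)) := by
    have := (continuous_expNeg.tendsto (∑' i, g i)).comp (ENNReal.summable (f := g)).hasSum
    simpa [HasProd, Function.comp_def, expNeg_sum] using this
  exact h1.tprod_eq

end ExpNeg

/-! ### Infinite products of factors in `[0, 1]` -/

section InfiniteProducts
open Filter Topology

variable {ι : Type*} {f g : ι → ℝ≥0∞}

lemma ENNReal.tprod_le_one (hf : ∀ i, f i ≤ 1) : ∏' i, f i ≤ 1 := by
  rw [ENNReal.tprod_eq_iInf_prod hf]
  exact (iInf_le _ ∅).trans (by simp)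

lemma ENNReal.tprod_le_prod (hf : ∀ i, f i ≤ 1) (s : Finset ι) : ∏' i, f i ≤ ∏ i ∈ s, f i := by
  rw [ENNReal.tprod_eq_iInf_prod hf]
  exact iInf_le _ s

lemma ENNReal.tprod_le_apply (hf : ∀ i, f i ≤ 1) (i : ι) : ∏' i, f i ≤ f i := by
  simpa using ENNReal.tprod_le_prod hf {i}

lemma ENNReal.tprod_eq_zero (hf : ∀ i, f i ≤ 1) {i : ι} (hi : f i = 0) : ∏' i, f i = 0 :=
  le_antisymm (hi ▸ ENNReal.tprod_le_apply hf i) bot_le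

lemma ENNReal.tprod_mono (hg : ∀ i, g i ≤ 1) (h : ∀ i, f i ≤ g i) : ∏' i, f i ≤ ∏' i, g i := by
  rw [ENNReal.tprod_eq_iInf_prod hg, ENNReal.tprod_eq_iInf_prod fun i => (h i).trans (hg i)]
  exact iInf_mono fun s => Finset.prod_le_prod' fun i _ => h i

lemma ENNReal.tendsto_prod_range {f : ℕ → ℝ≥0∞} (hf : ∀ i, f i ≤ 1) :
    Tendsto (fun n => ∏ i ∈ Finset.range n, f i) atTop (𝓝 (∏' i, f i)) :=
  (ENNReal.multipliable_of_le_one hf).hasProd.tendsto_prod_nat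

/-- The factor `f j` may be 0 and cannot be divided out; instead the family is the product of two
convergent families, one of them equal to 1 off `j`. -/
lemma ENNReal.tprod_eq_mul_tprod_ite [DecidableEq ι] (hf : ∀ i, f i ≤ 1) (j : ι) :
    ∏' i, f i = f j * ∏' i, (if i = j then 1 else f i) := by
  have hg : ∀ i, (if i = j then 1 else f i) ≤ 1 := fun i => by split_ifs <;> simp [hf]
  have h1 : HasProd (fun i => (if i = j then f j else 1) * (if i = j then 1 else f i))
      (f j * ∏' i, (if i = j then 1 else f i)) := by
    have ha : HasProd (fun i => if i = j then f j else 1) (f j) := by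
      simpa using hasProd_ite_eq j (f j)
    have hb := (ENNReal.multipliable_of_le_one hg).hasProd
    have hne : f j ≠ ∞ := ne_top_of_le_ne_top ENNReal.one_ne_top (hf j)
    have hne' : (∏' i, (if i = j then 1 else f i)) ≠ ∞ :=
      ne_top_of_le_ne_top ENNReal.one_ne_top (ENNReal.tprod_le_one hg)
    have := ENNReal.Tendsto.mul ha (Or.inr hne') hb (Or.inr hne)
    simp only [HasProd, Finset.prod_mul_distrib]
    exact this
  rw [← h1.tprod_eq]
  congr 1
  ext i
  by_cases h : i = j <;> simp [h]

lemma Measurable.ennreal_tprod {α : Type*} [MeasurableSpace α] {f : ℕ → α → ℝ≥0∞}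
    (hf : ∀ i, Measurable (f i)) (h1 : ∀ i a, f i a ≤ 1) : Measurable fun a => ∏' i, f i a :=
  measurable_of_tendsto_metrizable (f := fun (n : ℕ) a => ∏ i ∈ Finset.range n, f i a)
    (fun _ => Finset.measurable_prod _ fun i _ => hf i)
    (tendsto_pi_nhds.2 fun a => ENNReal.tendsto_prod_range fun i => h1 i a)

end InfiniteProducts

/-! ### The Laplace functional of a Poisson process -/

section PoissonLaplace
open Filter Topology

/-- The probability generating function: the sum is the exponential series at `r q`. -/
lemma lintegral_pow_poissonMeasure (r : ℝ≥0) {q : ℝ≥0∞} (hq : q ≤ 1) :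
    ∫⁻ n : ℕ, q ^ n ∂(poissonMeasure r) = expNeg (r * (1 - q)) := by
  obtain ⟨q, rfl⟩ := ENNReal.lt_iff_exists_coe.1 (lt_of_le_of_lt hq ENNReal.one_lt_top) |>.imp
    fun _ h => h.1
  have hq' : (q : ℝ) ≤ 1 := by exact_mod_cast hq
  rw [lintegral_countable']
  have h1 : ∀ n : ℕ, (q : ℝ≥0∞) ^ n * poissonMeasure r {n} =
      ENNReal.ofReal (Real.exp (-r) * ((r * q : ℝ) ^ n / n.factorial)) := by
    intro n
    rw [poissonMeasure_singleton, ← ENNReal.ofReal_coe_nnreal, ← ENNReal.ofReal_pow (by positivity),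
      ← ENNReal.ofReal_mul (by positivity)]
    congr 1
    rw [mul_pow]; ring
  simp_rw [h1]
  rw [← ENNReal.ofReal_tsum_of_nonneg (fun n => by positivity)
    ((NormedSpace.expSeries_div_summable (𝔸 := ℝ) _).mul_left _), tsum_mul_left,
    ← congrFun (NormedSpace.exp_eq_tsum_div (𝔸 := ℝ)) (r * q : ℝ), ← Real.exp_eq_exp_ℝ, ← Real.exp_add]
  have h2 : (r : ℝ≥0∞) * (1 - q) = ENNReal.ofReal (r * (1 - q)) := by
    rw [ENNReal.ofReal_mul (by positivity), ENNReal.ofReal_sub _ (by positivity)]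
    simp
  rw [h2, expNeg_ofReal (mul_nonneg (by positivity) (by linarith))]
  congr 2
  ring

variable {Ω E : Type*} [MeasurableSpace Ω] [MeasurableSpace E] {μ : Measure Ω}
  {X : Ω → ℕ → E} {Λ : Measure E}

lemma measurable_pointCount (hX : Measurable X) {B : Set E} (hB : MeasurableSet B) :
    Measurable (pointCount X B) := by
  unfold pointCount
  refine Measurable.tsum fun j => ?_
  exact (measurable_const.indicator hB).comp ((measurable_pi_apply j).comp hX)

namespace IsPoissonPP

lemma lintegral_expNeg_mul_pointCount (hX : IsPoissonPP μ X Λ) {B : Set E} (hB : MeasurableSet B)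
    (hΛ : Λ B ≠ ∞) (c : ℝ≥0∞) :
    ∫⁻ ω, expNeg (c * pointCount X B ω) ∂μ = expNeg (Λ B * (1 - expNeg c)) := by
  have hm := measurable_pointCount hX.measurable hB
  have hf : Measurable fun x : ℝ≥0∞ => expNeg (c * x) :=
    measurable_expNeg.comp (measurable_const.mul measurable_id)
  rw [← lintegral_map (f := fun x => expNeg (c * x)) hf hm, hX.map_pointCount B hB hΛ,
    lintegral_map hf (by fun_prop)]
  simp_rw [mul_comm c, expNeg_nsmul]
  rw [lintegral_pow_poissonMeasure _ (expNeg_le_one c), ENNReal.coe_toNNReal hΛ]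

/-- Laplace functional at a simple function with support of finite intensity. -/
lemma lintegral_expNeg_tsum_simpleFunc (hX : IsPoissonPP μ X Λ) (g : SimpleFunc E ℝ≥0∞)
    (hg : ∀ c ≠ 0, Λ (g ⁻¹' {c}) ≠ ∞) :
    ∫⁻ ω, expNeg (∑' j, g (X ω j)) ∂μ = expNeg (∫⁻ x, (1 - expNeg (g x)) ∂Λ) := by
  classical
  -- The value 0 is left out: its fibre may have infinite intensity, and it contributes nothing to
  -- either side.
  set s : Finset ℝ≥0∞ := g.range.erase 0 with hs
  have hval : ∀ x, g x = ∑ c ∈ s, c * (g ⁻¹' {c}).indicator (fun _ => (1 : ℝ≥0∞)) x := by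
    intro x
    by_cases h0 : g x = 0
    · rw [h0, Finset.sum_eq_zero]
      intro c hc
      have : x ∉ g ⁻¹' {c} := by
        simp only [mem_preimage, mem_singleton_iff, h0]
        exact (Finset.ne_of_mem_erase hc).symm
      simp [this]
    · rw [Finset.sum_eq_single (g x)]
      · simp
      · intro c _ hc
        have : x ∉ g ⁻¹' {c} := by simpa using hc.symm
        simp [this]
      · intro h
        exact absurd (Finset.mem_erase.2 ⟨h0, g.mem_range_self x⟩) h
  have hsum : ∀ ω, ∑' j, g (X ω j) = ∑ c ∈ s, c * pointCount X (g ⁻¹' {c}) ω := by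
    intro ω
    simp_rw [pointCount, ← ENNReal.tsum_mul_left]
    rw [← Summable.tsum_finsetSum fun _ _ => ENNReal.summable]
    exact tsum_congr fun j => hval _
  let e := s.equivFin
  have hne : ∀ i : Fin s.card, ((e.symm i : s) : ℝ≥0∞) ≠ 0 := fun i =>
    Finset.ne_of_mem_erase (e.symm i).2
  have hind := hX.iIndepFun_pointCount s.card (fun i => g ⁻¹' {((e.symm i : s) : ℝ≥0∞)})
    (fun i => g.measurableSet_fiber _) (fun i => hg _ (hne i)) (by
      intro i j hij
      refine Disjoint.preimage _ ?_
      simp only [disjoint_singleton, ne_eq]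
      exact fun h => hij (e.symm.injective (Subtype.ext h)))
  have hind2 := hind.comp (fun i x => expNeg (((e.symm i : s) : ℝ≥0∞) * x))
    (fun i => measurable_expNeg.comp (measurable_const.mul measurable_id))
  have hre : ∀ φ : ℝ≥0∞ → ℝ≥0∞, ∏ c ∈ s, φ c = ∏ i : Fin s.card, φ (e.symm i) := by
    intro φ
    rw [← Finset.prod_coe_sort, ← e.symm.prod_comp]
  simp_rw [hsum, expNeg_sum, hre]
  have := lintegral_prod_eq_prod_lintegral_of_indepFun Finset.univ _ hind2 (fun i =>
    (measurable_expNeg.comp (measurable_const.mul measurable_id)).comp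
      (measurable_pointCount hX.measurable (g.measurableSet_fiber _)))
  simp only [Function.comp_def] at this
  rw [this]
  simp_rw [fun i => hX.lintegral_expNeg_mul_pointCount (g.measurableSet_fiber ((e.symm i : s) : ℝ≥0∞))
    (hg _ (hne i)) ((e.symm i : s) : ℝ≥0∞)]
  rw [← hre fun c => expNeg (Λ (g ⁻¹' {c}) * (1 - expNeg c)), ← expNeg_sum]
  congr 1
  have : ∀ x, 1 - expNeg (g x) = ∑ c ∈ s, (g ⁻¹' {c}).indicator (fun _ => 1 - expNeg c) x := by
    intro x
    by_cases h0 : g x = 0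
    · rw [h0, Finset.sum_eq_zero]
      · simp
      intro c hc
      have : x ∉ g ⁻¹' {c} := by
        simp only [mem_preimage, mem_singleton_iff, h0]
        exact (Finset.ne_of_mem_erase hc).symm
      simp [this]
    · rw [Finset.sum_eq_single (g x)]
      · simp
      · intro c _ hc
        have : x ∉ g ⁻¹' {c} := by simpa using hc.symm
        simp [this]
      · intro h
        exact absurd (Finset.mem_erase.2 ⟨h0, g.mem_range_self x⟩) h
  simp_rw [this]
  rw [lintegral_finsetSum _ fun c _ => measurable_const.indicator (g.measurableSet_fiber c)]
  refine Finset.sum_congr rfl fun c _ => ?_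
  rw [lintegral_indicator (g.measurableSet_fiber c), lintegral_const]
  simp [mul_comm]

/-- The Laplace functional of a Poisson point process. -/
theorem lintegral_expNeg_tsum [IsFiniteMeasure μ] [SigmaFinite Λ] (hX : IsPoissonPP μ X Λ)
    {g : E → ℝ≥0∞}
    (hg : Measurable g) :
    ∫⁻ ω, expNeg (∑' j, g (X ω j)) ∂μ = expNeg (∫⁻ x, (1 - expNeg (g x)) ∂Λ) := by
  -- Restricting to the spanning sets gives the nonzero fibres finite intensity, while `gn` still
  -- increases to `g`.
  let gn : ℕ → SimpleFunc E ℝ≥0∞ := fun n => (SimpleFunc.eapprox g n).restrict (spanningSets Λ n)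
  have hSm : ∀ n, MeasurableSet (spanningSets Λ n) := measurableSet_spanningSets Λ
  have hgn : ∀ n x, gn n x = (spanningSets Λ n).indicator (SimpleFunc.eapprox g n) x := fun n x => by
    simp [gn, SimpleFunc.restrict_apply _ (hSm n)]
  have hmono : ∀ x, Monotone fun n => gn n x := by
    intro x n k hnk
    simp only [hgn]
    by_cases hx : x ∈ spanningSets Λ n
    · have hx' := monotone_spanningSets Λ hnk hx
      simp only [hx, hx', indicator_of_mem]
      exact SimpleFunc.monotone_eapprox g hnk x
    · simp [hx]
  have hsup : ∀ x, Tendsto (fun n => gn n x) atTop (𝓝 (g x)) := by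
    intro x
    have h1 : Tendsto (fun n => SimpleFunc.eapprox g n x) atTop (𝓝 (g x)) :=
      SimpleFunc.tendsto_eapprox hg x
    refine h1.congr' ?_
    filter_upwards [eventually_ge_atTop (spanningSetsIndex Λ x)] with n hn
    rw [hgn, indicator_of_mem]
    exact monotone_spanningSets Λ hn (mem_spanningSetsIndex Λ x)
  have hsimple : ∀ n, ∫⁻ ω, expNeg (∑' j, gn n (X ω j)) ∂μ =
      expNeg (∫⁻ x, (1 - expNeg (gn n x)) ∂Λ) := by
    intro n
    refine hX.lintegral_expNeg_tsum_simpleFunc (gn n) fun c hc => ?_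
    refine ne_top_of_le_ne_top (measure_spanningSets_lt_top Λ n).ne (measure_mono fun x hx => ?_)
    by_contra h
    simp only [mem_preimage, hgn, h, not_false_eq_true, indicator_of_notMem, mem_singleton_iff] at hx
    exact hc hx.symm
  have hlim2 : Tendsto (fun n => expNeg (∫⁻ x, (1 - expNeg (gn n x)) ∂Λ)) atTop
      (𝓝 (expNeg (∫⁻ x, (1 - expNeg (g x)) ∂Λ))) := by
    refine (continuous_expNeg.tendsto _).comp ?_
    refine lintegral_tendsto_of_tendsto_of_monotone
      (fun n => (measurable_const.sub (measurable_expNeg.comp (gn n).measurable)).aemeasurable)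
      (ae_of_all _ fun x n k hnk => tsub_le_tsub_left (expNeg_antitone (hmono x hnk)) _)
      (ae_of_all _ fun x => ?_)
    exact ENNReal.Tendsto.sub tendsto_const_nhds ((continuous_expNeg.tendsto _).comp (hsup x))
      (Or.inl ENNReal.one_ne_top)
  have hXj : ∀ j, Measurable fun ω => X ω j := fun j => (measurable_pi_apply j).comp hX.measurable
  have hlim1 : Tendsto (fun n => ∫⁻ ω, expNeg (∑' j, gn n (X ω j)) ∂μ) atTop
      (𝓝 (∫⁻ ω, expNeg (∑' j, g (X ω j)) ∂μ)) := by
    refine tendsto_lintegral_of_dominated_convergence (fun _ => 1)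
      (fun n => measurable_expNeg.comp (Measurable.tsum fun j => (gn n).measurable.comp (hXj j)))
      (fun n => ae_of_all _ fun ω => expNeg_le_one _) (by simp) (ae_of_all _ fun ω => ?_)
    refine (continuous_expNeg.tendsto _).comp ?_
    -- The sum over the points is an integral for the counting measure, so monotone convergence
    -- applies to it as well.
    have := lintegral_tendsto_of_tendsto_of_monotone (μ := Measure.count (α := ℕ))
      (f := fun n j => gn n (X ω j)) (F := fun j => g (X ω j))
      (fun n => (measurable_of_countable _).aemeasurable) (ae_of_all _ fun j => hmono _)
      (ae_of_all _ fun j => hsup _)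
    simpa [lintegral_count] using this
  exact tendsto_nhds_unique hlim1 (by simpa only [hsimple] using hlim2)

end IsPoissonPP
end PoissonLaplace

/-! ### Independent marks -/

section Marked
open Filter Topology

/-- The random sequence `Z` has the Laplace functional of a Poisson point process with intensity
measure `M`. -/
structure HasPoissonLaplace {Ω S : Type*} [MeasurableSpace Ω] [MeasurableSpace S]
    (μ : Measure Ω) (Z : Ω → ℕ → S) (M : Measure S) : Prop where
  measurable : ∀ j, Measurable fun ω => Z ω j
  laplace : ∀ f : S → ℝ≥0∞, Measurable f → (∀ z, f z ≤ 1) →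
    ∫⁻ ω, ∏' j, f (Z ω j) ∂μ = expNeg (∫⁻ z, (1 - f z) ∂M)

lemma lintegral_prod_infinitePi {K : Type*} [MeasurableSpace K] (ν : Measure K)
    [IsProbabilityMeasure ν] (f : ℕ → K → ℝ≥0∞) (hf : ∀ j, Measurable (f j)) (s : Finset ℕ) :
    ∫⁻ k, ∏ j ∈ s, f j (k j) ∂(Measure.infinitePi fun _ : ℕ => ν) = ∏ j ∈ s, ∫⁻ k, f j k ∂ν := by
  have h := iIndepFun_infinitePi (P := fun _ : ℕ => ν) (X := f) hf
  rw [lintegral_prod_eq_prod_lintegral_of_indepFun s _ h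
    fun j => (hf j).comp (measurable_pi_apply j)]
  refine Finset.prod_congr rfl fun j _ => ?_
  exact (measurePreserving_eval_infinitePi (fun _ : ℕ => ν) j).lintegral_comp (hf j)

/-- The marking theorem. -/
theorem IsPoissonPP.hasPoissonLaplace_marked {Ω E K : Type*} [MeasurableSpace Ω]
    [MeasurableSpace E] [MeasurableSpace K] {μ : Measure Ω} [IsProbabilityMeasure μ]
    {X : Ω → ℕ → E} {Λ : Measure E} [SigmaFinite Λ] (hX : IsPoissonPP μ X Λ)
    {m : Ω → ℕ → K} (hm : Measurable m) (ν : Measure K) [IsProbabilityMeasure ν]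
    (hlaw : μ.map (fun ω => (X ω, m ω)) = (μ.map X).prod (Measure.infinitePi fun _ : ℕ => ν)) :
    HasPoissonLaplace μ (fun ω j => (X ω j, m ω j)) (Λ.prod ν) := by
  have hXj : ∀ j, Measurable fun ω => X ω j := fun j => (measurable_pi_apply j).comp hX.measurable
  have hmj : ∀ j, Measurable fun ω => m ω j := fun j => (measurable_pi_apply j).comp hm
  refine ⟨fun j => (hXj j).prodMk (hmj j), fun f hf hf1 => ?_⟩
  have : IsProbabilityMeasure (μ.map X) := Measure.isProbabilityMeasure_map hX.measurable.aemeasurable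
  set F : E → ℝ≥0∞ := fun x => ∫⁻ k, f (x, k) ∂ν with hF
  have hFm : Measurable F := hf.lintegral_prod_right'
  have hF1 : ∀ x, F x ≤ 1 := fun x => by
    calc F x ≤ ∫⁻ _, 1 ∂ν := lintegral_mono fun k => hf1 _
      _ = 1 := by simp
  -- Given the positions, independence of the marks turns a finite product of `f` into the product
  -- of the mark averages `F`; bounded convergence then passes to infinite products.
  have hfin : ∀ n, ∫⁻ ω, ∏ j ∈ Finset.range n, f (X ω j, m ω j) ∂μ =
      ∫⁻ ω, ∏ j ∈ Finset.range n, F (X ω j) ∂μ := by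
    intro n
    have hmeas : Measurable fun p : (ℕ → E) × (ℕ → K) => ∏ j ∈ Finset.range n, f (p.1 j, p.2 j) :=
      Finset.measurable_prod _ fun j _ => hf.comp
        (((measurable_pi_apply j).comp measurable_fst).prodMk
          ((measurable_pi_apply j).comp measurable_snd))
    rw [← lintegral_map (f := fun p : (ℕ → E) × (ℕ → K) => ∏ j ∈ Finset.range n, f (p.1 j, p.2 j))
      (g := fun ω => (X ω, m ω)) hmeas (hX.measurable.prodMk hm), hlaw, lintegral_prod _
      hmeas.aemeasurable]
    have : ∀ x : ℕ → E, ∫⁻ k : ℕ → K, ∏ j ∈ Finset.range n, f (x j, k j)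
        ∂(Measure.infinitePi fun _ : ℕ => ν) = ∏ j ∈ Finset.range n, F (x j) := fun x =>
      lintegral_prod_infinitePi ν (fun j k => f (x j, k))
        (fun j => hf.comp (measurable_const.prodMk measurable_id)) _
    simp only [this]
    exact lintegral_map (f := fun x : ℕ → E => ∏ j ∈ Finset.range n, F (x j))
      (Finset.measurable_prod _ fun j _ => hFm.comp (measurable_pi_apply j)) hX.measurable
  have hprod1 : ∀ (s : Finset ℕ) (φ : ℕ → ℝ≥0∞), (∀ j, φ j ≤ 1) → ∏ j ∈ s, φ j ≤ 1 :=
    fun s φ h => Finset.prod_le_one' fun j _ => h j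
  have hl1 : Tendsto (fun n => ∫⁻ ω, ∏ j ∈ Finset.range n, f (X ω j, m ω j) ∂μ) atTop
      (𝓝 (∫⁻ ω, ∏' j, f (X ω j, m ω j) ∂μ)) :=
    tendsto_lintegral_of_dominated_convergence (fun _ => 1)
      (fun n => Finset.measurable_prod _ fun j _ => hf.comp ((hXj j).prodMk (hmj j)))
      (fun n => ae_of_all _ fun ω => hprod1 _ _ fun j => hf1 _) (by simp)
      (ae_of_all _ fun ω => ENNReal.tendsto_prod_range fun j => hf1 _)
  have hl2 : Tendsto (fun n => ∫⁻ ω, ∏ j ∈ Finset.range n, F (X ω j) ∂μ) atTop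
      (𝓝 (∫⁻ ω, ∏' j, F (X ω j) ∂μ)) :=
    tendsto_lintegral_of_dominated_convergence (fun _ => 1)
      (fun n => Finset.measurable_prod _ fun j _ => hFm.comp (hXj j))
      (fun n => ae_of_all _ fun ω => hprod1 _ _ fun j => hF1 _) (by simp)
      (ae_of_all _ fun ω => ENNReal.tendsto_prod_range fun j => hF1 _)
  have heq : ∫⁻ ω, ∏' j, f (X ω j, m ω j) ∂μ = ∫⁻ ω, ∏' j, F (X ω j) ∂μ :=
    tendsto_nhds_unique hl1 (by simpa only [hfin] using hl2)
  rw [heq]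
  -- `F = e^{-g}` with `g = negLog F`, so the Laplace functional of the positions alone evaluates
  -- the mean of `∏ F`.
  have := hX.lintegral_expNeg_tsum (g := fun x => negLog (F x)) (measurable_negLog.comp hFm)
  simp_rw [← ENNReal.tprod_expNeg, expNeg_negLog (hF1 _)] at this
  rw [this, lintegral_prod (fun z => 1 - f z) (measurable_const.sub hf).aemeasurable]
  congr 1
  refine lintegral_congr fun x => ?_
  rw [lintegral_sub (f := fun _ => 1) (g := fun k => f (x, k)) (by fun_prop)
    (ne_top_of_le_ne_top ENNReal.one_ne_top (hF1 x)) (ae_of_all _ fun k => hf1 _)]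
  simp [hF]

end Marked

/-! ### Almost sure statements from the Laplace functional -/

section Consequences
open Filter Topology

namespace HasPoissonLaplace

variable {Ω S : Type*} [MeasurableSpace Ω] [MeasurableSpace S] {μ : Measure Ω}
  {Z : Ω → ℕ → S} {M : Measure S}

lemma measurable_tprod (hZ : HasPoissonLaplace μ Z M) {f : S → ℝ≥0∞} (hf : Measurable f)
    (hf1 : ∀ z, f z ≤ 1) : Measurable fun ω => ∏' j, f (Z ω j) :=
  Measurable.ennreal_tprod (fun j => hf.comp (hZ.measurable j)) fun _ _ => hf1 _

variable [IsProbabilityMeasure μ]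

/-- The product of the indicators of `p` over all points is at most 1 and has mean `e^{-M(¬p)} = 1`,
so it equals 1 almost surely. -/
lemma ae_forall (hZ : HasPoissonLaplace μ Z M) {p : S → Prop} (hp : MeasurableSet {z | p z})
    (h : ∀ᵐ z ∂M, p z) : ∀ᵐ ω ∂μ, ∀ j, p (Z ω j) := by
  have hf : Measurable ({z | p z}.indicator fun _ => (1 : ℝ≥0∞)) := measurable_const.indicator hp
  have hf1 : ∀ z, {z | p z}.indicator (fun _ => (1 : ℝ≥0∞)) z ≤ 1 := fun z =>
    indicator_le_self' (by simp) z
  have h1 := hZ.laplace _ hf hf1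
  have h0 : ∫⁻ z, (1 - {z | p z}.indicator (fun _ => (1 : ℝ≥0∞)) z) ∂M = 0 := by
    rw [lintegral_eq_zero_iff (by fun_prop)]
    filter_upwards [h] with z hz
    have : z ∈ {z | p z} := hz
    simp [this]
  rw [h0, expNeg_zero] at h1
  have h2 : (fun ω => ∏' j, {z | p z}.indicator (fun _ => (1 : ℝ≥0∞)) (Z ω j)) =ᵐ[μ] fun _ => 1 := by
    refine ae_eq_of_ae_le_of_lintegral_le (ae_of_all _ fun ω => ENNReal.tprod_le_one fun j => hf1 _)
      (by simp [h1]) (by fun_prop) (by simp [h1])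
  filter_upwards [h2] with ω hω j
  by_contra hj
  have : Z ω j ∉ {z | p z} := hj
  rw [ENNReal.tprod_eq_zero (fun j => hf1 _) (i := j) (by simp [this])] at hω
  exact zero_ne_one hω

/-- Campbell's criterion for the finiteness of shot noise. -/
lemma ae_tsum_ne_top (hZ : HasPoissonLaplace μ Z M) {t : S → ℝ≥0∞} (ht : Measurable t)
    (hfin : ∀ᵐ z ∂M, t z ≠ ∞) (h : ∫⁻ z, (1 - expNeg (t z)) ∂M ≠ ∞) :
    ∀ᵐ ω ∂μ, ∑' j, t (Z ω j) ≠ ∞ := by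
  -- For `c > 0` the mean of `e^{-c Σ}` is at most the probability that `Σ` is finite. As `c → 0`
  -- this mean tends to 1; since `c ≤ 1`, the case `c = 1` dominates the exponents.
  let c : ℕ → ℝ≥0∞ := fun n => ((n : ℝ≥0∞) + 1)⁻¹
  have hc0 : ∀ n, c n ≠ 0 := fun n => by simp [c]
  have hc1 : ∀ n, c n ≤ 1 := fun n => by simp [c]
  have hclim : Tendsto c atTop (𝓝 0) := by
    have := (tendsto_add_atTop_iff_nat (f := fun n : ℕ => ((n : ℝ≥0∞))⁻¹) 1).2
      ENNReal.tendsto_inv_nat_nhds_zero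
    simpa [c] using this
  have hmn : ∀ n, Measurable fun z => expNeg (c n * t z) := fun n =>
    measurable_expNeg.comp (measurable_const.mul ht)
  have hlap : ∀ n, ∫⁻ ω, ∏' j, expNeg (c n * t (Z ω j)) ∂μ =
      expNeg (∫⁻ z, (1 - expNeg (c n * t z)) ∂M) := fun n =>
    hZ.laplace (fun z => expNeg (c n * t z)) (hmn n) fun z => expNeg_le_one _
  have hlim : Tendsto (fun n => expNeg (∫⁻ z, (1 - expNeg (c n * t z)) ∂M)) atTop (𝓝 1) := by
    have h0 : Tendsto (fun n => ∫⁻ z, (1 - expNeg (c n * t z)) ∂M) atTop (𝓝 (∫⁻ _, 0 ∂M)) := by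
      refine tendsto_lintegral_of_dominated_convergence (fun z => 1 - expNeg (t z))
        (fun n => measurable_const.sub (hmn n)) (fun n => ae_of_all _ fun z => ?_) h ?_
      · exact tsub_le_tsub_left (expNeg_antitone (mul_le_of_le_one_left' (hc1 n))) _
      · filter_upwards [hfin] with z hz
        have h1 : Tendsto (fun n => c n * t z) atTop (𝓝 0) := by
          simpa using ENNReal.Tendsto.mul_const hclim (Or.inr hz)
        have h2 := (continuous_expNeg.tendsto 0).comp h1
        simpa using ENNReal.Tendsto.sub (tendsto_const_nhds (x := (1 : ℝ≥0∞))) h2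
          (Or.inl ENNReal.one_ne_top)
    simpa [Function.comp_def] using (continuous_expNeg.tendsto _).comp h0
  set A : Set Ω := {ω | ∑' j, t (Z ω j) = ∞} with hA
  have hAm : MeasurableSet A :=
    measurableSet_eq_fun (Measurable.tsum fun j => ht.comp (hZ.measurable j)) measurable_const
  have hle : ∀ n, expNeg (∫⁻ z, (1 - expNeg (c n * t z)) ∂M) ≤ μ Aᶜ := by
    intro n
    rw [← hlap n, ← lintegral_indicator_one hAm.compl]
    refine lintegral_mono fun ω => ?_
    by_cases hω : ω ∈ A
    · have : ∏' j, expNeg (c n * t (Z ω j)) = 0 := by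
        rw [ENNReal.tprod_expNeg, ENNReal.tsum_mul_left, show ∑' j, t (Z ω j) = ∞ from hω,
          ENNReal.mul_top (hc0 n), expNeg_top]
      simp [this]
    · simpa [hω] using ENNReal.tprod_le_one fun j => expNeg_le_one _
  have h1 : μ Aᶜ = 1 := le_antisymm prob_le_one (le_of_tendsto' hlim hle)
  have := (prob_compl_eq_one_iff hAm).1 h1
  rw [ae_iff]
  simpa [hA] using this

/-- Campbell's criterion for the indicator of `B`: a finite sum of zeros and ones has finitely many
ones. -/
lemma ae_finite_setOf_mem (hZ : HasPoissonLaplace μ Z M) {B : Set S} (hB : MeasurableSet B)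
    (hM : M B ≠ ∞) : ∀ᵐ ω ∂μ, {j | Z ω j ∈ B}.Finite := by
  have hm : Measurable (B.indicator fun _ => (1 : ℝ≥0∞)) := measurable_const.indicator hB
  have := hZ.ae_tsum_ne_top hm (ae_of_all _ fun z => by
    by_cases hz : z ∈ B <;> simp [hz]) (by
    refine ne_top_of_le_ne_top hM ?_
    rw [← lintegral_indicator_one hB]
    refine lintegral_mono fun z => ?_
    by_cases hz : z ∈ B <;> simp [hz])
  filter_upwards [this] with ω hω
  have h2 := ENNReal.finite_const_le_of_tsum_ne_top hω one_ne_zero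
  refine h2.subset fun j hj => ?_
  have : Z ω j ∈ B := hj
  simp [this]

end HasPoissonLaplace
end Consequences

/-! ### A Campbell–Mecke formula by first-order perturbation -/

section Nearest
open Filter Topology

/-- Both bounds are `1 + y ≤ e^y`, at `y = x` and `y = -x`. They replace the derivative of the
exponential at 0 by inequalities that can be divided by `s`. -/
lemma one_sub_expNeg_bounds {x : ℝ≥0∞} (hx : x ≠ ∞) :
    x * expNeg x ≤ 1 - expNeg x ∧ 1 - expNeg x ≤ x := by
  lift x to ℝ≥0 using hx
  have h : (x : ℝ≥0∞) = ENNReal.ofReal x := by simp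
  rw [h, expNeg_ofReal x.coe_nonneg, ← ENNReal.ofReal_one, ← ENNReal.ofReal_sub _ (Real.exp_pos _).le,
    ← ENNReal.ofReal_mul x.coe_nonneg]
  refine ⟨ENNReal.ofReal_le_ofReal ?_, ENNReal.ofReal_le_ofReal ?_⟩
  · have h1 := Real.add_one_le_exp (x : ℝ)
    have h2 : Real.exp x * Real.exp (-x) = 1 := by rw [← Real.exp_add]; simp
    nlinarith [Real.exp_pos (-(x : ℝ))]
  · linarith [Real.add_one_le_exp (-(x : ℝ))]

/-- If `g` and `h` take values in `[0, 1]` and have disjoint supports, then the part of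
`∏ (g + s h)` that is of first order in `s` is `∑ⱼ h j ∏_{i ≠ j} g i`. -/
lemma tprod_add_mul_bounds {ι : Type*} [DecidableEq ι] {g h : ι → ℝ≥0∞} (hg : ∀ i, g i ≤ 1)
    (hh : ∀ i, h i ≤ 1) {B : Set ι} (hgB : ∀ i ∈ B, g i = 0) (hhB : ∀ i ∉ B, h i = 0)
    {s : ℝ≥0∞} (hs : s ≤ 1) :
    ∏' i, g i + s * ∑' j, h j * ∏' i, (if i = j then 1 else g i) ≤ ∏' i, (g i + s * h i) ∧
    ∏' i, (g i + s * h i) ≤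
      ∏' i, g i + s * ∑' j, h j * ∏' i, (if i = j then 1 else g i) + s * s := by
  have hfB : ∀ i ∈ B, g i + s * h i = s * h i := fun i hi => by simp [hgB i hi]
  have hfB' : ∀ i ∉ B, g i + s * h i = g i := fun i hi => by simp [hhB i hi]
  have hf1 : ∀ i, g i + s * h i ≤ 1 := fun i => by
    by_cases hi : i ∈ B
    · rw [hfB i hi]; exact mul_le_one' hs (hh i)
    · rw [hfB' i hi]; exact hg i
  have hgi1 : ∀ j i, (if i = j then 1 else g i) ≤ 1 := fun j i => by
    split_ifs <;> simp [hg]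
  -- Cases by the number of indices in `B`. With none or exactly one, the lower bound is an
  -- equality. With two or more, the zeroth- and first-order terms vanish, while the product
  -- contains `s` at least twice; this is what `s * s` pays for.
  by_cases hB : ∃ j, j ∈ B
  · obtain ⟨j, hj⟩ := hB
    rw [ENNReal.tprod_eq_zero hg (hgB j hj), zero_add,
      ENNReal.tprod_eq_mul_tprod_ite hf1 j, hfB j hj]
    by_cases hk : ∃ k ∈ B, k ≠ j
    · obtain ⟨k, hk, hkj⟩ := hk
      have hT : ∑' l, h l * ∏' i, (if i = l then 1 else g i) = 0 := by
        rw [ENNReal.tsum_eq_zero]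
        intro l
        by_cases hl : l = j
        · rw [ENNReal.tprod_eq_zero (hgi1 l) (i := k), mul_zero]
          simp [hl, hkj, hgB k hk]
        · rw [ENNReal.tprod_eq_zero (hgi1 l) (i := j), mul_zero]
          simp [Ne.symm hl, hgB j hj]
      rw [hT, mul_zero]
      refine ⟨zero_le, ?_⟩
      rw [zero_add]
      refine mul_le_mul' (mul_le_of_le_one_right' (hh j)) ?_
      refine (ENNReal.tprod_le_apply (fun i => ?_) k).trans ?_
      · split_ifs <;> simp [hf1]
      · rw [if_neg hkj, hfB k hk]; exact mul_le_of_le_one_right' (hh k)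
    · push Not at hk
      have hT : ∑' l, h l * ∏' i, (if i = l then 1 else g i) =
          h j * ∏' i, (if i = j then 1 else g i) := by
        refine tsum_eq_single j fun l hl => ?_
        rw [hhB l fun h => hl (hk l h), zero_mul]
      have hP : ∏' i, (if i = j then 1 else g i + s * h i) = ∏' i, (if i = j then 1 else g i) := by
        refine tprod_congr fun i => ?_
        by_cases hi : i = j
        · simp [hi]
        · simp only [hi, if_false]
          exact hfB' i fun h => hi (hk i h)
      rw [hT, hP, mul_assoc]
      exact ⟨le_rfl, le_self_add⟩
  · push Not at hB
    have h1 : ∏' i, (g i + s * h i) = ∏' i, g i := tprod_congr fun i => hfB' i (hB i)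
    have h2 : ∑' j, h j * ∏' i, (if i = j then 1 else g i) = 0 := by
      rw [ENNReal.tsum_eq_zero]
      intro l
      rw [hhB l (hB l), zero_mul]
    rw [h1, h2]
    simp

namespace HasPoissonLaplace

variable {Ω S : Type*} [MeasurableSpace Ω] [MeasurableSpace S] {μ : Measure Ω}
  [IsProbabilityMeasure μ] {Z : Ω → ℕ → S} {M : Measure S}

/-- Campbell–Mecke formula for a product functional which vanishes when there are at least two
points in `B`. -/
lemma lintegral_tsum_mul_tprod (hZ : HasPoissonLaplace μ Z M) {B : Set S} (hB : MeasurableSet B)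
    (hMB : M B ≠ ∞) {u f : S → ℝ≥0∞} (hu : Measurable u) (hu1 : ∀ z, u z ≤ 1)
    (hf : Measurable f) (hf1 : ∀ z, f z ≤ 1) (hfB : ∀ z ∈ B, f z = 0) :
    ∫⁻ ω, ∑' j, B.indicator u (Z ω j) * ∏' i, (if i = j then 1 else f (Z ω i)) ∂μ =
      (∫⁻ z in B, u z ∂M) * expNeg (∫⁻ z, (1 - f z) ∂M) := by
  set T : Ω → ℝ≥0∞ := fun ω => ∑' j, B.indicator u (Z ω j) * ∏' i, (if i = j then 1 else f (Z ω i))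
    with hT
  set A := ∫⁻ z in B, u z ∂M with hA
  set c := ∫⁻ z, (1 - f z) ∂M with hc
  have hAtop : A ≠ ∞ := by
    refine ne_top_of_le_ne_top hMB ?_
    calc A ≤ ∫⁻ z in B, 1 ∂M := lintegral_mono hu1
      _ = M B := by simp
  have hui : Measurable (B.indicator u) := hu.indicator hB
  have hui1 : ∀ z, B.indicator u z ≤ 1 := fun z => (indicator_le_self _ _ z).trans (hu1 z)
  have hTm : Measurable T := by
    refine Measurable.tsum fun j => (hui.comp (hZ.measurable j)).mul ?_
    refine Measurable.ennreal_tprod (fun i => ?_) fun i a => ?_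
    · by_cases h : i = j
      · simp [h]
      · simpa [h, Function.comp_def] using hf.comp (hZ.measurable i)
    · split_ifs <;> simp [hf1]
  have hfs1 : ∀ s : ℝ≥0∞, s ≤ 1 → ∀ z, f z + s * B.indicator u z ≤ 1 := fun s hs z => by
    by_cases hz : z ∈ B
    · rw [hfB z hz, zero_add]; exact mul_le_one' hs (hui1 z)
    · simp [hz, hf1]
  -- On `B` the perturbation replaces `f = 0` by `s u`, which lowers the exponent by exactly `s A`.
  have hlapc : ∀ s : ℝ≥0∞, s ≤ 1 →
      ∫⁻ z, (1 - (f z + s * B.indicator u z)) ∂M + s * A = c := by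
    intro s hs
    rw [hA, ← lintegral_indicator hB, ← lintegral_const_mul _ hui,
      ← lintegral_add_right _ (hui.const_mul s)]
    refine lintegral_congr fun z => ?_
    by_cases hz : z ∈ B
    · rw [hfB z hz, zero_add, tsub_zero, tsub_add_cancel_of_le (mul_le_one' hs (hui1 z))]
    · simp [hz]
  have hbd : ∀ s : ℝ≥0∞, s ≤ 1 → ∀ ω,
      ∏' i, f (Z ω i) + s * T ω ≤ ∏' i, (f (Z ω i) + s * B.indicator u (Z ω i)) ∧
      ∏' i, (f (Z ω i) + s * B.indicator u (Z ω i)) ≤ ∏' i, f (Z ω i) + s * T ω + s * s :=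
    fun s hs ω => tprod_add_mul_bounds (fun i => hf1 _) (fun i => hui1 _)
      (B := {i | Z ω i ∈ B}) (fun i hi => hfB _ hi) (fun i hi => indicator_of_notMem (s := B) hi _) hs
  have hmf : Measurable fun ω => ∏' i, f (Z ω i) := hZ.measurable_tprod hf hf1
  -- Integrate the pointwise bounds, cancel the finite zeroth-order term `e^{-c}`, and divide by
  -- `s`; the second-order error `s * s` becomes the summand `s`.
  have key : ∀ s : ℝ≥0∞, s ≤ 1 → s ≠ 0 → expNeg c * A ≤ ∫⁻ ω, T ω ∂μ + s ∧
      ∫⁻ ω, T ω ∂μ ≤ expNeg (c - s * A) * A := by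
    intro s hs hs0
    have hs_ne_top : s ≠ ∞ := ne_top_of_le_ne_top ENNReal.one_ne_top hs
    have hsA : s * A ≠ ∞ := ENNReal.mul_ne_top hs_ne_top hAtop
    set cs := ∫⁻ z, (1 - (f z + s * B.indicator u z)) ∂M with hcs
    have hcs' : c - s * A = cs := by rw [← hlapc s hs]; exact ENNReal.add_sub_cancel_right hsA
    have hEs := hZ.laplace (fun z => f z + s * B.indicator u z) (hf.add (hui.const_mul s)) (hfs1 s hs)
    have hE0 := hZ.laplace f hf hf1
    rw [← hcs] at hEs
    have hc0 : expNeg c = expNeg cs * expNeg (s * A) := by rw [← expNeg_add, hlapc s hs]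
    have hlow := lintegral_mono (μ := μ) fun ω => (hbd s hs ω).1
    have hup := lintegral_mono (μ := μ) fun ω => (hbd s hs ω).2
    rw [hEs, lintegral_add_left hmf, hE0, lintegral_const_mul _ hTm, ← hc] at hlow
    rw [hEs, lintegral_add_right _ measurable_const, lintegral_add_left hmf, hE0,
      lintegral_const_mul _ hTm, ← hc] at hup
    simp only [lintegral_const, measure_univ, mul_one] at hup
    have hsplit : expNeg cs = expNeg c + expNeg cs * (1 - expNeg (s * A)) := by
      rw [hc0, ← mul_add, add_tsub_cancel_of_le (expNeg_le_one _), mul_one]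
    obtain ⟨b1, b2⟩ := one_sub_expNeg_bounds hsA
    constructor
    · have h1 : expNeg cs * (1 - expNeg (s * A)) ≤ s * ∫⁻ ω, T ω ∂μ + s * s := by
        rw [hsplit, add_assoc] at hup
        exact (ENNReal.add_le_add_iff_left (expNeg_ne_top c)).1 hup
      have h2 : s * (expNeg c * A) ≤ s * (∫⁻ ω, T ω ∂μ + s) := by
        calc s * (expNeg c * A) = expNeg cs * (s * A * expNeg (s * A)) := by rw [hc0]; ring
          _ ≤ expNeg cs * (1 - expNeg (s * A)) := by gcongr
          _ ≤ _ := by rw [mul_add]; exact h1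
      exact (ENNReal.mul_le_mul_iff_right hs0 hs_ne_top).1 h2
    · rw [hcs']
      have h1 : s * ∫⁻ ω, T ω ∂μ ≤ expNeg cs * (1 - expNeg (s * A)) := by
        rw [hsplit] at hlow
        exact (ENNReal.add_le_add_iff_left (expNeg_ne_top c)).1 hlow
      have h2 : s * ∫⁻ ω, T ω ∂μ ≤ s * (expNeg cs * A) := by
        calc _ ≤ expNeg cs * (1 - expNeg (s * A)) := h1
          _ ≤ expNeg cs * (s * A) := by gcongr
          _ = _ := by ring
      exact (ENNReal.mul_le_mul_iff_right hs0 hs_ne_top).1 h2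
  let s : ℕ → ℝ≥0∞ := fun n => ((n : ℝ≥0∞) + 1)⁻¹
  have hs0 : ∀ n, s n ≠ 0 := fun n => by simp [s]
  have hs1 : ∀ n, s n ≤ 1 := fun n => by simp [s]
  have hslim : Tendsto s atTop (𝓝 0) := by
    have := (tendsto_add_atTop_iff_nat (f := fun n : ℕ => ((n : ℝ≥0∞))⁻¹) 1).2
      ENNReal.tendsto_inv_nat_nhds_zero
    simpa [s] using this
  rw [mul_comm]
  refine le_antisymm ?_ ?_
  · have hlim : Tendsto (fun n => expNeg (c - s n * A) * A) atTop (𝓝 (expNeg c * A)) := by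
      refine ENNReal.Tendsto.mul_const ((continuous_expNeg.tendsto _).comp ?_) (Or.inr hAtop)
      have h1 : Tendsto (fun n => s n * A) atTop (𝓝 0) := by
        simpa using ENNReal.Tendsto.mul_const hslim (Or.inr hAtop)
      simpa using ENNReal.Tendsto.sub (tendsto_const_nhds (x := c)) h1 (Or.inr ENNReal.zero_ne_top)
    exact ge_of_tendsto' hlim fun n => (key (s n) (hs1 n) (hs0 n)).2
  · have hlim : Tendsto (fun n => ∫⁻ ω, T ω ∂μ + s n) atTop (𝓝 (∫⁻ ω, T ω ∂μ)) := by
      simpa using tendsto_const_nhds.add hslim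
    exact ge_of_tendsto' hlim fun n => (key (s n) (hs1 n) (hs0 n)).1

end HasPoissonLaplace
end Nearest

/-! ### Summation over the nearest point -/

section NearestPoint
open Filter Topology

/-- The least dyadic number of level `n` that is at least `x`. -/
def dyadicCeil (n : ℕ) (x : ℝ) : ℝ := ⌈x * 2 ^ n⌉ / 2 ^ n

lemma le_dyadicCeil (n : ℕ) (x : ℝ) : x ≤ dyadicCeil n x := by
  rw [dyadicCeil, le_div_iff₀ (by positivity)]
  exact Int.le_ceil _

lemma dyadicCeil_lt (n : ℕ) (x : ℝ) : dyadicCeil n x < x + (1 / 2) ^ n := by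
  rw [dyadicCeil, div_lt_iff₀ (by positivity), add_mul, ← mul_pow]
  simpa using Int.ceil_lt_add_one (x * 2 ^ n)

/-- Twice the ceiling of `x 2^n` is an integer not below `x 2^(n+1)`. Monotonicity in `n` makes
monotone convergence available below. -/
lemma dyadicCeil_antitone (x : ℝ) : Antitone fun n => dyadicCeil n x := by
  refine antitone_nat_of_succ_le fun n => ?_
  rw [dyadicCeil, dyadicCeil, div_le_div_iff₀ (by positivity) (by positivity), pow_succ,
    mul_comm (2 ^ n : ℝ) 2, ← mul_assoc, ← mul_assoc]
  gcongr
  have : (⌈x * 2 * 2 ^ n⌉ : ℤ) ≤ ⌈x * 2 ^ n⌉ * 2 := by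
    rw [Int.ceil_le]
    push_cast
    nlinarith [Int.le_ceil (x * 2 ^ n)]
  exact_mod_cast this

lemma tendsto_dyadicCeil (x : ℝ) : Tendsto (fun n => dyadicCeil n x) atTop (𝓝 x) := by
  refine tendsto_of_tendsto_of_tendsto_of_le_of_le tendsto_const_nhds ?_ (fun n => le_dyadicCeil n x)
    (fun n => (dyadicCeil_lt n x).le)
  simpa using tendsto_const_nhds.add (tendsto_pow_atTop_nhds_zero_of_lt_one
    (by norm_num : (0 : ℝ) ≤ 1 / 2) (by norm_num))

lemma measurable_dyadicCeil (n : ℕ) : Measurable (dyadicCeil n) := by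
  unfold dyadicCeil
  fun_prop

/-- `w` on the points that are farther than `r`, and `0` on the others. -/
def beyond {S : Type*} (e : S → ℝ) (w : S → ℝ≥0∞) (r : ℝ) : S → ℝ≥0∞ :=
  {z | r < e z}.indicator w

section Beyond

variable {S : Type*} {e : S → ℝ} {w : S → ℝ≥0∞}

lemma beyond_le_one (hw1 : ∀ z, w z ≤ 1) (r : ℝ) (z : S) : beyond e w r z ≤ 1 :=
  (indicator_le_self _ _ z).trans (hw1 z)

lemma beyond_of_lt {r : ℝ} {z : S} (h : r < e z) : beyond e w r z = w z :=
  indicator_of_mem (s := {z | r < e z}) h _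

lemma beyond_of_le {r : ℝ} {z : S} (h : e z ≤ r) : beyond e w r z = 0 :=
  indicator_of_notMem (s := {z | r < e z}) (not_lt.2 h) _

lemma beyond_antitone (e : S → ℝ) (w : S → ℝ≥0∞) (z : S) : Antitone fun r => beyond e w r z := by
  intro r r' h
  by_cases h' : r' < e z
  · simp [beyond_of_lt h', beyond_of_lt (h.trans_lt h')]
  · simp [beyond_of_le (not_lt.1 h')]

lemma measurable_beyond [MeasurableSpace S] (he : Measurable e) (hw : Measurable w) (r : ℝ) :
    Measurable (beyond e w r) :=
  hw.indicator (measurableSet_lt measurable_const he)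

lemma measurable_beyond_uncurry [MeasurableSpace S] (he : Measurable e) (hw : Measurable w) :
    Measurable fun p : ℝ × S => beyond e w p.1 p.2 := by
  have : (fun p : ℝ × S => beyond e w p.1 p.2) =
      {p : ℝ × S | p.1 < e p.2}.indicator fun p => w p.2 := by
    ext p
    by_cases h : p.1 < e p.2
    · rw [beyond_of_lt h, indicator_of_mem (s := {p : ℝ × S | p.1 < e p.2}) h]
    · rw [beyond_of_le (not_lt.1 h), indicator_of_notMem (s := {p : ℝ × S | p.1 < e p.2}) h]
  rw [this]
  exact (hw.comp measurable_snd).indicator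
    (measurableSet_lt measurable_fst (he.comp measurable_snd))

/-- Only the finitely many points up to `dyadicCeil 0 r` feel a change of the threshold. Each of
these factors is eventually constant, since the cutoff is strict and the thresholds approach `r`
from above; hence so is the product. -/
lemma tendsto_tprod_beyond {ι : Type*} {x : ι → S} (p : ι → Prop) [DecidablePred p]
    (hfin : ∀ r, {i | e (x i) ≤ r}.Finite) (r : ℝ) :
    Tendsto (fun n => ∏' i, if p i then 1 else beyond e w (dyadicCeil n r) (x i)) atTop
      (𝓝 (∏' i, if p i then 1 else beyond e w r (x i))) := by
  have h0 : ∀ i ∈ {i | e (x i) ≤ dyadicCeil 0 r},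
      ∀ᶠ n in atTop, beyond e w (dyadicCeil n r) (x i) = beyond e w r (x i) := by
    intro i _
    by_cases hi : r < e (x i)
    · filter_upwards [(tendsto_dyadicCeil r).eventually_lt_const hi] with n hn
      rw [beyond_of_lt hn, beyond_of_lt hi]
    · refine Eventually.of_forall fun n => ?_
      rw [beyond_of_le (not_lt.1 hi), beyond_of_le ((not_lt.1 hi).trans (le_dyadicCeil n r))]
  refine tendsto_const_nhds.congr' ?_
  filter_upwards [((hfin (dyadicCeil 0 r)).eventually_all).2 h0] with n hn
  refine tprod_congr fun i => ?_
  by_cases hi : e (x i) ≤ dyadicCeil 0 r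
  · rw [hn i hi]
  · push Not at hi
    have h1 := dyadicCeil_antitone r (Nat.zero_le n)
    rw [beyond_of_lt (lt_of_le_of_lt h1 hi), beyond_of_lt (lt_of_le_of_lt (le_dyadicCeil 0 r) hi)]

end Beyond

namespace HasPoissonLaplace

variable {Ω S : Type*} [MeasurableSpace Ω] [MeasurableSpace S] {μ : Measure Ω}
  [IsProbabilityMeasure μ] {Z : Ω → ℕ → S} {M : Measure S} {e : S → ℝ}

lemma ae_forall_finite (hZ : HasPoissonLaplace μ Z M) (he : Measurable e)
    (hM : ∀ r, M {z | e z ≤ r} ≠ ∞) : ∀ᵐ ω ∂μ, ∀ r, {j | e (Z ω j) ≤ r}.Finite := by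
  have h1 : ∀ n : ℕ, ∀ᵐ ω ∂μ, {j | Z ω j ∈ {z | e z ≤ n}}.Finite := fun n =>
    hZ.ae_finite_setOf_mem (measurableSet_le he measurable_const) (hM n)
  filter_upwards [ae_all_iff.2 h1] with ω hω r
  obtain ⟨n, hn⟩ := exists_nat_ge r
  exact (hω n).subset fun j hj => le_trans hj hn

/-- The sum over the points `z` of `u z`, weighted with the product of `w` over the other points,
where all other points have to be farther (in the sense of `e`) than `z`. -/
theorem lintegral_tsum_nearest (hZ : HasPoissonLaplace μ Z M) (he : Measurable e)
    (hM : ∀ r, M {z | e z ≤ r} ≠ ∞) {u w : S → ℝ≥0∞} (hu : Measurable u) (hu1 : ∀ z, u z ≤ 1)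
    (hw : Measurable w) (hw1 : ∀ z, w z ≤ 1) :
    ∫⁻ ω, ∑' j, u (Z ω j) * ∏' i, (if i = j then 1 else beyond e w (e (Z ω j)) (Z ω i)) ∂μ =
      ∫⁻ z, u z * expNeg (∫⁻ z', (1 - beyond e w (e z) z') ∂M) ∂M := by
  set K : ℝ → ℝ≥0∞ := fun r => expNeg (∫⁻ z', (1 - beyond e w r z') ∂M) with hK
  have hKanti : Antitone K := fun r r' h => expNeg_antitone
    (lintegral_mono fun z => tsub_le_tsub_left (beyond_antitone e w z h) _)
  have hKE : ∀ r, K r = ∫⁻ ω, ∏' i, beyond e w r (Z ω i) ∂μ := fun r =>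
    (hZ.laplace _ (measurable_beyond he hw r) (beyond_le_one hw1 r)).symm
  -- This limit along thresholds from above is read off from the mean of the product over the points
  -- (`hKE`), not from the integral against `M`.
  have hKlim : ∀ r, Tendsto (fun n => K (dyadicCeil n r)) atTop (𝓝 (K r)) := by
    intro r
    simp only [hKE]
    refine tendsto_lintegral_of_dominated_convergence (fun _ => 1)
      (fun n => hZ.measurable_tprod (measurable_beyond he hw _) (beyond_le_one hw1 _))
      (fun n => ae_of_all _ fun ω => ENNReal.tprod_le_one fun i => beyond_le_one hw1 _ _) (by simp) ?_
    filter_upwards [hZ.ae_forall_finite he hM] with ω hω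
    simpa using tendsto_tprod_beyond (w := w) (fun _ => False) hω r
  have hdisc : ∀ n : ℕ, ∫⁻ ω, ∑' j, u (Z ω j) *
      ∏' i, (if i = j then 1 else beyond e w (dyadicCeil n (e (Z ω j))) (Z ω i)) ∂μ =
      ∫⁻ z, u z * K (dyadicCeil n (e z)) ∂M := by
    intro n
    -- On the shell `B k` the discretised distance is the constant `k / 2^n`. The function cut off
    -- at that threshold vanishes on `B k`, as the perturbation formula requires.
    let B : ℤ → Set S := fun k => {z | ⌈e z * 2 ^ n⌉ = k}
    have hBm : ∀ k, MeasurableSet (B k) := fun k =>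
      measurableSet_eq_fun (by fun_prop) measurable_const
    have hBle : ∀ k, ∀ z ∈ B k, e z ≤ k / 2 ^ n := by
      intro k z hz
      have := le_dyadicCeil n (e z)
      rwa [dyadicCeil, show ⌈e z * 2 ^ n⌉ = k from hz] at this
    have hBfin : ∀ k, M (B k) ≠ ∞ := fun k =>
      ne_top_of_le_ne_top (hM (k / 2 ^ n)) (measure_mono (hBle k))
    have hk := fun k : ℤ => hZ.lintegral_tsum_mul_tprod (hBm k) (hBfin k) hu hu1
      (measurable_beyond he hw (k / 2 ^ n)) (beyond_le_one hw1 _)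
      fun z hz => beyond_of_le (hBle k z hz)
    have hterm : ∀ k : ℤ, Measurable fun ω => ∑' j, (B k).indicator u (Z ω j) *
        ∏' i, (if i = j then 1 else beyond e w (k / 2 ^ n) (Z ω i)) := by
      intro k
      refine Measurable.tsum fun j => ((hu.indicator (hBm k)).comp (hZ.measurable j)).mul ?_
      refine Measurable.ennreal_tprod (fun i => ?_) fun i a => ?_
      · by_cases h : i = j
        · simp [h]
        · simpa [h, Function.comp_def] using (measurable_beyond he hw _).comp (hZ.measurable i)
      · split_ifs
        · exact le_rfl
        · exact beyond_le_one hw1 _ _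
    have hL : ∀ ω, ∑' j, u (Z ω j) *
        ∏' i, (if i = j then 1 else beyond e w (dyadicCeil n (e (Z ω j))) (Z ω i)) =
        ∑' k : ℤ, ∑' j, (B k).indicator u (Z ω j) *
          ∏' i, (if i = j then 1 else beyond e w (k / 2 ^ n) (Z ω i)) := by
      intro ω
      rw [ENNReal.tsum_comm]
      refine tsum_congr fun j => ?_
      rw [tsum_eq_single ⌈e (Z ω j) * 2 ^ n⌉]
      · rw [indicator_of_mem (show Z ω j ∈ B _ from rfl)]
        rfl
      · intro k hk
        rw [indicator_of_notMem (show Z ω j ∉ B k from fun h => hk (Eq.symm h)), zero_mul]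
    have hR : ∀ z, u z * K (dyadicCeil n (e z)) =
        ∑' k : ℤ, (B k).indicator u z * K (k / 2 ^ n) := by
      intro z
      rw [tsum_eq_single ⌈e z * 2 ^ n⌉]
      · rw [indicator_of_mem (show z ∈ B _ from rfl)]
        rfl
      · intro k hk
        rw [indicator_of_notMem (show z ∉ B k from fun h => hk (Eq.symm h)), zero_mul]
    simp_rw [hL, hR]
    rw [lintegral_tsum fun k => (hterm k).aemeasurable,
      lintegral_tsum fun k => ((hu.indicator (hBm k)).mul_const _).aemeasurable]
    refine tsum_congr fun k => ?_
    rw [hk k, lintegral_mul_const _ (hu.indicator (hBm k)), lintegral_indicator (hBm k)]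
  have hmeasn : ∀ n j, Measurable fun ω => u (Z ω j) *
      ∏' i, (if i = j then 1 else beyond e w (dyadicCeil n (e (Z ω j))) (Z ω i)) := by
    intro n j
    refine (hu.comp (hZ.measurable j)).mul (Measurable.ennreal_tprod (fun i => ?_) fun i a => ?_)
    · by_cases h : i = j
      · simp [h]
      · simpa [h, Function.comp_def] using (measurable_beyond_uncurry he hw).comp
          (((measurable_dyadicCeil n).comp (he.comp (hZ.measurable j))).prodMk (hZ.measurable i))
    · split_ifs
      · exact le_rfl
      · exact beyond_le_one hw1 _ _
  -- Finer levels lower the threshold and hence raise the product; no bound on the sum over `j` is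
  -- needed for the limit.
  have hmono : ∀ ω j, Monotone fun n => u (Z ω j) *
      ∏' i, (if i = j then 1 else beyond e w (dyadicCeil n (e (Z ω j))) (Z ω i)) := by
    intro ω j n k hnk
    refine mul_le_mul_right (ENNReal.tprod_mono (fun i => ?_) fun i => ?_) _
    · split_ifs
      · exact le_rfl
      · exact beyond_le_one hw1 _ _
    · split_ifs
      · exact le_rfl
      · exact beyond_antitone e w _ (dyadicCeil_antitone _ hnk)
  have hl1 : Tendsto (fun n => ∫⁻ ω, ∑' j, u (Z ω j) *
      ∏' i, (if i = j then 1 else beyond e w (dyadicCeil n (e (Z ω j))) (Z ω i)) ∂μ) atTop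
      (𝓝 (∫⁻ ω, ∑' j, u (Z ω j) *
        ∏' i, (if i = j then 1 else beyond e w (e (Z ω j)) (Z ω i)) ∂μ)) := by
    refine lintegral_tendsto_of_tendsto_of_monotone
      (fun n => (Measurable.tsum fun j => hmeasn n j).aemeasurable)
      (ae_of_all _ fun ω n k hnk => ENNReal.tsum_le_tsum fun j => hmono ω j hnk) ?_
    filter_upwards [hZ.ae_forall_finite he hM] with ω hω
    have := lintegral_tendsto_of_tendsto_of_monotone (μ := Measure.count (α := ℕ))
      (f := fun n j => u (Z ω j) *
        ∏' i, (if i = j then 1 else beyond e w (dyadicCeil n (e (Z ω j))) (Z ω i)))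
      (F := fun j => u (Z ω j) * ∏' i, (if i = j then 1 else beyond e w (e (Z ω j)) (Z ω i)))
      (fun n => (measurable_of_countable _).aemeasurable) (ae_of_all _ fun j => hmono ω j)
      (ae_of_all _ fun j => ENNReal.Tendsto.const_mul
        (tendsto_tprod_beyond (fun i => i = j) hω _)
        (Or.inr (ne_top_of_le_ne_top ENNReal.one_ne_top (hu1 _))))
    simpa [lintegral_count] using this
  have hl2 : Tendsto (fun n => ∫⁻ z, u z * K (dyadicCeil n (e z)) ∂M) atTop
      (𝓝 (∫⁻ z, u z * K (e z) ∂M)) := by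
    refine lintegral_tendsto_of_tendsto_of_monotone
      (fun n => (hu.mul (hKanti.measurable.comp ((measurable_dyadicCeil n).comp he))).aemeasurable)
      (ae_of_all _ fun z n k hnk => mul_le_mul_right (hKanti (dyadicCeil_antitone _ hnk)) _)
      (ae_of_all _ fun z => ENNReal.Tendsto.const_mul (hKlim _)
        (Or.inr (ne_top_of_le_ne_top ENNReal.one_ne_top (hu1 _))))
  exact tendsto_nhds_unique hl1 (by simpa only [hdisc] using hl2)

end HasPoissonLaplace
end NearestPoint

/-! ### Polar coordinates, Gamma and Gaussian integrals -/

section Integrals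
open Filter Topology

/-- Polar coordinates for a radial function. -/
lemma lintegral_norm_plane {F : ℝ → ℝ≥0∞} (hF : Measurable F) :
    ∫⁻ x : Plane, F ‖x‖ = ∫⁻ r in Ioi (0 : ℝ), ENNReal.ofReal (2 * Real.pi * r) * F r := by
  have hfin : Module.finrank ℝ Plane = 2 := by simp [Plane]
  have hmp := (volume : Measure Plane).measurePreserving_homeomorphUnitSphereProd
  rw [hfin] at hmp
  have h1 : ∫⁻ x : Plane, F ‖x‖ =
      ∫⁻ x : ({(0 : Plane)}ᶜ : Set Plane), F ‖x.1‖ ∂(Measure.comap Subtype.val volume) := by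
    rw [lintegral_subtype_comap (measurableSet_singleton _).compl (fun x => F ‖x‖),
      restrict_compl_singleton]
  have h2 : ∫⁻ x : ({(0 : Plane)}ᶜ : Set Plane), F ‖x.1‖ ∂(Measure.comap Subtype.val volume) =
      ∫⁻ p, F p.2.1 ∂((volume : Measure Plane).toSphere.prod (Measure.volumeIoiPow (2 - 1))) := by
    rw [← hmp.lintegral_comp (f := fun p => F p.2.1) (by fun_prop)]
    simp
  have hsph : (volume : Measure Plane).toSphere univ = ENNReal.ofReal (2 * Real.pi) := by
    rw [Measure.toSphere_apply_univ, hfin, EuclideanSpace.volume_ball]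
    have h2 : Real.Gamma (1 + 1) = 1 := by rw [one_add_one_eq_two, Real.Gamma_two]
    simp [Real.sq_sqrt Real.pi_pos.le, ENNReal.ofReal_mul, h2]
  rw [h1, h2, lintegral_prod _ (by fun_prop)]
  simp only [lintegral_const]
  rw [hsph, Measure.volumeIoiPow, lintegral_withDensity_eq_lintegral_mul _ (by fun_prop) (by fun_prop),
    mul_comm, ← lintegral_const_mul _ (by fun_prop),
    ← lintegral_subtype_comap measurableSet_Ioi (fun r => ENNReal.ofReal (2 * Real.pi * r) * F r)]
  refine lintegral_congr fun r => ?_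
  have hr : (0 : ℝ) < r := r.2
  simp only [Pi.mul_apply]
  rw [ENNReal.ofReal_mul (p := 2 * Real.pi) (by positivity), mul_assoc]
  norm_num

lemma image_const_mul_rpow_Ioi {c κ : ℝ} (hc : 0 < c) (hκ : 0 < κ) :
    (fun t : ℝ => c * t ^ κ) '' Ioi 0 = Ioi 0 := by
  ext r
  constructor
  · rintro ⟨t, ht, rfl⟩
    have : (0 : ℝ) < t := ht
    exact mem_Ioi.2 (by positivity)
  · intro hr
    have hr' : (0 : ℝ) < r := hr
    refine ⟨(r / c) ^ (1 / κ), mem_Ioi.2 (by positivity), ?_⟩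
    simp only
    rw [← Real.rpow_mul (by positivity), one_div_mul_cancel hκ.ne', Real.rpow_one]
    field_simp

/-- Substitution `r = c t ^ κ`. -/
lemma lintegral_comp_const_mul_rpow {c κ : ℝ} (hc : 0 < c) (hκ : 0 < κ) (F : ℝ → ℝ≥0∞) :
    ∫⁻ r in Ioi (0 : ℝ), F r =
      ∫⁻ t in Ioi (0 : ℝ), ENNReal.ofReal (c * (κ * t ^ (κ - 1))) * F (c * t ^ κ) := by
  have hinj : InjOn (fun t : ℝ => c * t ^ κ) (Ioi 0) := by
    intro s hs t ht h
    have h1 : s ^ κ = t ^ κ := mul_left_cancel₀ hc.ne' h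
    exact Real.rpow_left_injOn hκ.ne' (mem_Ioi.1 hs).le (mem_Ioi.1 ht).le h1
  have := lintegral_image_eq_lintegral_abs_deriv_mul (s := Ioi (0 : ℝ)) measurableSet_Ioi
    (f := fun t : ℝ => c * t ^ κ) (f' := fun t => c * (κ * t ^ (κ - 1)))
    (fun t ht => ((Real.hasDerivAt_rpow_const (Or.inl (ne_of_gt ht))).const_mul c).hasDerivWithinAt)
    hinj F
  rw [image_const_mul_rpow_Ioi hc hκ] at this
  rw [this]
  refine setLIntegral_congr_fun measurableSet_Ioi fun t ht => ?_
  have ht' : (0 : ℝ) < t := ht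
  rw [abs_of_pos (by positivity)]

lemma lintegral_rpow_mul_exp_neg_mul_Ioi {a r : ℝ} (ha : 0 < a) (hr : 0 < r) :
    ∫⁻ t in Ioi (0 : ℝ), ENNReal.ofReal (t ^ (a - 1) * Real.exp (-(r * t))) =
      ENNReal.ofReal ((1 / r) ^ a * Real.Gamma a) := by
  have h := Real.integral_rpow_mul_exp_neg_mul_Ioi ha hr
  have hpos : 0 < (1 / r) ^ a * Real.Gamma a := by
    have := Real.Gamma_pos_of_pos ha
    positivity
  rw [← h, ofReal_integral_eq_lintegral_ofReal]
  -- A Bochner integral that is not defined would be 0, so the positive value proves integrability.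
  · by_contra hi
    rw [integral_undef hi] at h
    exact hpos.ne h
  · filter_upwards [ae_restrict_mem measurableSet_Ioi] with t ht
    have ht' : (0 : ℝ) < t := ht
    simp only [Pi.zero_apply]
    positivity

lemma lintegral_gammaMeasure {a r : ℝ} (F : ℝ → ℝ≥0∞) :
    ∫⁻ h, F h ∂(gammaMeasure a r) =
      ∫⁻ h in Ioi (0 : ℝ), ENNReal.ofReal (r ^ a / Real.Gamma a * h ^ (a - 1) * Real.exp (-(r * h))) *
        F h := by
  rw [gammaMeasure, lintegral_withDensity_eq_lintegral_mul_non_measurable _ (by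
      unfold gammaPDF; exact (measurable_gammaPDFReal a r).ennreal_ofReal)
      (ae_of_all _ fun x => by simp [gammaPDF])]
  rw [← setLIntegral_congr Ioi_ae_eq_Ici.symm, ← lintegral_indicator measurableSet_Ici]
  refine lintegral_congr fun h => ?_
  by_cases hh : 0 ≤ h
  · rw [indicator_of_mem (mem_Ici.2 hh)]
    simp [gammaPDF_of_nonneg hh]
  · rw [indicator_of_notMem (by simpa using hh)]
    simp [gammaPDF_of_neg (not_le.1 hh)]

/-- The Laplace transform of the Gamma distribution. -/
lemma lintegral_expNeg_gammaMeasure {a r : ℝ} (ha : 0 < a) (hr : 0 < r) {z : ℝ} (hz : 0 ≤ z) :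
    ∫⁻ h, expNeg (ENNReal.ofReal (z * h)) ∂(gammaMeasure a r) =
      ENNReal.ofReal (1 / (1 + z / r) ^ a) := by
  have hG := Real.Gamma_pos_of_pos ha
  rw [lintegral_gammaMeasure]
  have : ∀ h ∈ Ioi (0 : ℝ), ENNReal.ofReal (r ^ a / Real.Gamma a * h ^ (a - 1) *
      Real.exp (-(r * h))) * expNeg (ENNReal.ofReal (z * h)) =
      ENNReal.ofReal (r ^ a / Real.Gamma a) *
        ENNReal.ofReal (h ^ (a - 1) * Real.exp (-((r + z) * h))) := by
    intro h hh
    have hh' : (0 : ℝ) < h := hh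
    rw [expNeg_ofReal (by positivity), ← ENNReal.ofReal_mul (by positivity),
      ← ENNReal.ofReal_mul (by positivity), show -((r + z) * h) = -(r * h) + -(z * h) by ring,
      Real.exp_add]
    congr 1
    ring
  rw [setLIntegral_congr_fun measurableSet_Ioi this, lintegral_const_mul _ (by fun_prop),
    lintegral_rpow_mul_exp_neg_mul_Ioi ha (by positivity), ← ENNReal.ofReal_mul (by positivity)]
  congr 1
  rw [show 1 + z / r = (r + z) / r by field_simp, Real.div_rpow (by positivity) hr.le,
    Real.div_rpow (by positivity) (by positivity), Real.one_rpow]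
  have h1 : 0 < r ^ a := by positivity
  have h2 : 0 < (r + z) ^ a := by positivity
  field_simp

/-- The tail of the Erlang distribution. -/
lemma gammaMeasure_Ioi {m : ℕ} (hm : 1 ≤ m) {r x : ℝ} (hr : 0 < r) (hx : 0 ≤ x) :
    gammaMeasure m r (Ioi x) = ENNReal.ofReal
      (Real.exp (-(r * x)) * ∑ k ∈ Finset.range m, (r * x) ^ k / k.factorial) := by
  obtain ⟨n, rfl⟩ := Nat.exists_eq_add_of_le' hm
  -- Minus the claimed tail is a primitive of the density: differentiation telescopes and leaves the
  -- top term. With `m = n + 1` the normalising factor `Γ(m)` is `n!`.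
  have hderiv : ∀ n : ℕ, ∀ t : ℝ, HasDerivAt
      (fun t => -(Real.exp (-(r * t)) * ∑ k ∈ Finset.range (n + 1), (r * t) ^ k / k.factorial))
      (r ^ (n + 1) / n.factorial * t ^ n * Real.exp (-(r * t))) t := by
    intro n t
    have he : HasDerivAt (fun t => Real.exp (-(r * t))) (Real.exp (-(r * t)) * -(r * 1)) t :=
      (((hasDerivAt_id t).const_mul r).neg).exp
    induction n with
    | zero =>
      simp only [zero_add, Finset.range_one, Finset.sum_singleton, pow_zero, Nat.factorial_zero,
        Nat.cast_one, div_one, mul_one]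
      refine he.fun_neg.congr_deriv ?_
      ring
    | succ n ih =>
      have h2 : HasDerivAt (fun t => Real.exp (-(r * t)) * ((r * t) ^ (n + 1) / (n + 1).factorial))
          (Real.exp (-(r * t)) * -(r * 1) * ((r * t) ^ (n + 1) / (n + 1).factorial) +
            Real.exp (-(r * t)) *
              (((n + 1 : ℕ) : ℝ) * (r * t) ^ n * (r * 1) / (n + 1).factorial)) t := by
        have h3 := (((hasDerivAt_id t).const_mul r).fun_pow (n + 1)).div_const ((n + 1).factorial : ℝ)
        simpa using he.fun_mul h3
      have h4 := ih.fun_sub h2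
      refine (h4.congr_deriv ?_).congr_of_eventuallyEq ?_
      · rw [Nat.factorial_succ]
        push_cast
        have : (n.factorial : ℝ) ≠ 0 := by positivity
        field_simp
        ring
      · refine Eventually.of_forall fun t => ?_
        simp only
        rw [Finset.sum_range_succ _ (n + 1)]
        ring
  have hlim : Tendsto (fun t => -(Real.exp (-(r * t)) *
      ∑ k ∈ Finset.range (n + 1), (r * t) ^ k / k.factorial)) atTop (𝓝 0) := by
    have h1 : Tendsto (fun t : ℝ => r * t) atTop atTop := tendsto_id.const_mul_atTop hr
    have h2 : Tendsto (fun y : ℝ => -(Real.exp (-y) *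
        ∑ k ∈ Finset.range (n + 1), y ^ k / k.factorial)) atTop (𝓝 0) := by
      simp_rw [Finset.mul_sum]
      rw [← neg_zero, ← Finset.sum_const_zero (s := Finset.range (n + 1))]
      refine (tendsto_finsetSum _ fun k _ => ?_).neg
      have := (Real.tendsto_pow_mul_exp_neg_atTop_nhds_zero k).div_const (k.factorial : ℝ)
      rw [zero_div] at this
      refine this.congr fun y => ?_
      ring
    exact h2.comp h1
  have hnn : ∀ t ∈ Ioi x, 0 ≤ r ^ (n + 1) / n.factorial * t ^ n * Real.exp (-(r * t)) := by
    intro t ht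
    have : (0 : ℝ) < t := lt_of_le_of_lt hx ht
    positivity
  have hint := integral_Ioi_of_hasDerivAt_of_nonneg' (fun t _ => hderiv n t) hnn hlim
  have hI := integrableOn_Ioi_deriv_of_nonneg' (fun t _ => hderiv n t) hnn hlim
  rw [← lintegral_indicator_one measurableSet_Ioi, lintegral_gammaMeasure]
  rw [zero_sub, neg_neg] at hint
  rw [← hint, ofReal_integral_eq_lintegral_ofReal hI
    ((ae_restrict_iff' measurableSet_Ioi).2 (ae_of_all _ hnn)),
    ← lintegral_indicator measurableSet_Ioi, ← lintegral_indicator measurableSet_Ioi]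
  refine lintegral_congr fun t => ?_
  by_cases ht : t ∈ Ioi x
  · have ht0 : t ∈ Ioi (0 : ℝ) := lt_of_le_of_lt hx ht
    have : (0 : ℝ) < t := ht0
    rw [indicator_of_mem ht, indicator_of_mem ht0, indicator_of_mem ht]
    push_cast
    rw [Real.Gamma_nat_eq_factorial, add_sub_cancel_right, Real.rpow_natCast]
    simp only [Pi.one_apply, mul_one]
    congr 4
    exact_mod_cast Real.rpow_natCast r (n + 1)
  · rw [indicator_of_notMem ht]
    by_cases ht0 : t ∈ Ioi (0 : ℝ)
    · rw [indicator_of_mem ht0, indicator_of_notMem ht, mul_zero]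
    · rw [indicator_of_notMem ht0]

instance : IsProbabilityMeasure complexGaussian := by
  unfold complexGaussian
  exact Measure.isProbabilityMeasure_map
    (Complex.measurableEquivRealProd.symm.measurable.aemeasurable)

/-- With variance `1/2` the density is `π^{-1/2} e^{-x²}`, so the integrand is again Gaussian, with
parameter `1 + a`. -/
lemma lintegral_expNeg_sq_gaussianReal {a : ℝ} (ha : 0 ≤ a) :
    ∫⁻ x, expNeg (ENNReal.ofReal (a * x ^ 2)) ∂(gaussianReal 0 (1 / 2)) =
      ENNReal.ofReal (1 / √(1 + a)) := by
  rw [gaussianReal_of_var_ne_zero 0 (by norm_num : (1 / 2 : ℝ≥0) ≠ 0),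
    lintegral_withDensity_eq_lintegral_mul _ (measurable_gaussianPDF _ _)
      (g := fun x => expNeg (ENNReal.ofReal (a * x ^ 2))) (measurable_expNeg.comp (by fun_prop))]
  have h1 : ∀ x : ℝ, (gaussianPDF 0 (1 / 2) * fun x => expNeg (ENNReal.ofReal (a * x ^ 2))) x =
      ENNReal.ofReal ((√Real.pi)⁻¹ * Real.exp (-(1 + a) * x ^ 2)) := by
    intro x
    simp only [Pi.mul_apply, gaussianPDF, gaussianPDFReal]
    rw [expNeg_ofReal (by positivity), ← ENNReal.ofReal_mul (by positivity), mul_assoc,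
      ← Real.exp_add]
    congr 2
    · congr 2; push_cast; ring
    · congr 1; push_cast; ring
  simp_rw [h1]
  rw [← ofReal_integral_eq_lintegral_ofReal, integral_const_mul, integral_gaussian]
  · congr 1
    rw [Real.sqrt_div Real.pi_pos.le]
    have : √Real.pi ≠ 0 := (Real.sqrt_pos.2 Real.pi_pos).ne'
    field_simp
  · exact (integrable_exp_neg_mul_sq (by positivity)).const_mul _
  · exact ae_of_all _ fun x => by positivity

/-- The real and imaginary parts each contribute a factor `1 / √(1 + a)`; this is the transform of
an exponential variable of mean 1. -/
lemma lintegral_expNeg_complexGaussian {a : ℝ} (ha : 0 ≤ a) :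
    ∫⁻ g, expNeg (ENNReal.ofReal (a * ‖g‖ ^ 2)) ∂complexGaussian = ENNReal.ofReal (1 / (1 + a)) := by
  have hm : Measurable fun p : ℝ × ℝ => (⟨p.1, p.2⟩ : ℂ) :=
    Complex.measurableEquivRealProd.symm.measurable
  have hf : Measurable fun g : ℂ => expNeg (ENNReal.ofReal (a * ‖g‖ ^ 2)) :=
    measurable_expNeg.comp (by fun_prop)
  rw [complexGaussian, lintegral_map hf hm, lintegral_prod (fun p : ℝ × ℝ => expNeg (ENNReal.ofReal (a * ‖(⟨p.1, p.2⟩ : ℂ)‖ ^ 2)))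
      (hf.comp hm).aemeasurable]
  have h1 : ∀ x y : ℝ, expNeg (ENNReal.ofReal (a * ‖(⟨x, y⟩ : ℂ)‖ ^ 2)) =
      expNeg (ENNReal.ofReal (a * x ^ 2)) * expNeg (ENNReal.ofReal (a * y ^ 2)) := by
    intro x y
    rw [← expNeg_add, ← ENNReal.ofReal_add (by positivity) (by positivity), Complex.sq_norm,
      Complex.normSq_mk]
    congr 2
    ring
  have hm2 : Measurable fun y : ℝ => expNeg (ENNReal.ofReal (a * y ^ 2)) :=
    measurable_expNeg.comp (by fun_prop)
  simp_rw [h1]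
  simp_rw [lintegral_const_mul _ hm2, lintegral_mul_const _ hm2, lintegral_expNeg_sq_gaussianReal ha]
  rw [← ENNReal.ofReal_mul (by positivity)]
  congr 1
  rw [div_mul_div_comm, Real.mul_self_sqrt (by positivity), one_mul]

/-- `∫ r b / (r ^ α + b) dr` over `(0, ∞)`. -/
lemma lintegral_mul_one_sub_inv {α b : ℝ} (hα : 2 < α) (hb : 0 ≤ b) :
    ∫⁻ r in Ioi (0 : ℝ), ENNReal.ofReal (r * (1 - 1 / (1 + b * r ^ (-α)))) =
      ENNReal.ofReal (b ^ (2 / α) * (Real.pi / (α * Real.sin (2 * Real.pi / α)))) := by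
  have hα0 : 0 < α := by linarith
  have hδ0 : 0 < 2 / α := by positivity
  have hδ1 : 2 / α < 1 := by rw [div_lt_one hα0]; exact hα
  rcases hb.eq_or_lt with rfl | hb
  · simp [Real.zero_rpow hδ0.ne']
  -- With `r = x^{1/α}` the integral becomes `(b/α) ∫ x^{2/α - 1} / (x + b) dx`. Writing `1 / (x +
  -- b)` as `∫ e^{-t (x + b)} dt` and applying Tonelli leaves `Γ(2/α) Γ(1 - 2/α)`, where `α > 2`
  -- keeps the second argument positive; the reflection formula evaluates it.
  rw [lintegral_comp_const_mul_rpow one_pos (by positivity : 0 < 1 / α)]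
  have h1 : ∀ x ∈ Ioi (0 : ℝ), ENNReal.ofReal (1 * (1 / α * x ^ (1 / α - 1))) *
      ENNReal.ofReal (1 * x ^ (1 / α) * (1 - 1 / (1 + b * (1 * x ^ (1 / α)) ^ (-α)))) =
      ENNReal.ofReal (b / α) * ∫⁻ t in Ioi (0 : ℝ),
        ENNReal.ofReal (x ^ (2 / α - 1) * Real.exp (-(t * x)) * Real.exp (-(b * t))) := by
    intro x hx
    have hx' : (0 : ℝ) < x := hx
    have h2 : ∫⁻ t in Ioi (0 : ℝ), ENNReal.ofReal (x ^ (2 / α - 1) * Real.exp (-(t * x)) *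
        Real.exp (-(b * t))) = ENNReal.ofReal (x ^ (2 / α - 1)) * ENNReal.ofReal (1 / (x + b)) := by
      have h3 := lintegral_rpow_mul_exp_neg_mul_Ioi one_pos (by positivity : 0 < x + b)
      rw [Real.Gamma_one, mul_one, Real.rpow_one] at h3
      rw [← h3, ← lintegral_const_mul _ (by fun_prop)]
      refine lintegral_congr fun t => ?_
      rw [← ENNReal.ofReal_mul (by positivity)]
      congr 1
      rw [sub_self, Real.rpow_zero, one_mul, mul_assoc, ← Real.exp_add]
      congr 2
      ring
    rw [h2, ← ENNReal.ofReal_mul (by positivity), ← ENNReal.ofReal_mul (by positivity),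
      ← ENNReal.ofReal_mul (by positivity)]
    congr 1
    rw [one_mul, one_mul, ← Real.rpow_mul hx'.le, show 1 / α * -α = -1 by field_simp,
      Real.rpow_neg_one, show 2 / α - 1 = (1 / α - 1) + 1 / α by ring, Real.rpow_add hx']
    field_simp
    ring
  rw [setLIntegral_congr_fun measurableSet_Ioi h1, lintegral_const_mul _ (by
    refine Measurable.lintegral_prod_right' (f := fun p : ℝ × ℝ => ENNReal.ofReal
      (p.1 ^ (2 / α - 1) * Real.exp (-(p.2 * p.1)) * Real.exp (-(b * p.2)))) ?_
    fun_prop), lintegral_lintegral_swap (by fun_prop)]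
  have h4 : ∀ t ∈ Ioi (0 : ℝ), ∫⁻ x in Ioi (0 : ℝ), ENNReal.ofReal (x ^ (2 / α - 1) *
      Real.exp (-(t * x)) * Real.exp (-(b * t))) =
      ENNReal.ofReal (Real.Gamma (2 / α)) *
        ENNReal.ofReal (t ^ ((1 - 2 / α) - 1) * Real.exp (-(b * t))) := by
    intro t ht
    have ht' : (0 : ℝ) < t := ht
    have hG := Real.Gamma_pos_of_pos hδ0
    simp_rw [fun x : ℝ => ENNReal.ofReal_mul' (p := x ^ (2 / α - 1) * Real.exp (-(t * x)))
      (Real.exp_pos (-(b * t))).le]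
    rw [lintegral_mul_const _ (by fun_prop), lintegral_rpow_mul_exp_neg_mul_Ioi hδ0 ht',
      ← ENNReal.ofReal_mul (by positivity), ← ENNReal.ofReal_mul (by positivity)]
    congr 1
    rw [show 1 - 2 / α - 1 = -(2 / α) by ring, Real.rpow_neg ht'.le, one_div,
      Real.inv_rpow ht'.le]
    ring
  rw [setLIntegral_congr_fun measurableSet_Ioi h4, lintegral_const_mul _ (by fun_prop),
    lintegral_rpow_mul_exp_neg_mul_Ioi (by linarith) hb]
  have hG := Real.Gamma_pos_of_pos hδ0
  have hG' := Real.Gamma_pos_of_pos (by linarith : 0 < 1 - 2 / α)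
  rw [← ENNReal.ofReal_mul (by positivity), ← ENNReal.ofReal_mul (by positivity)]
  congr 1
  have hrefl := Real.Gamma_mul_Gamma_one_sub (2 / α)
  have hb1 : b * (1 / b) ^ (1 - 2 / α) = b ^ (2 / α) := by
    rw [one_div, Real.inv_rpow hb.le, Real.rpow_sub hb, Real.rpow_one]
    field_simp
  calc b / α * (Real.Gamma (2 / α) * ((1 / b) ^ (1 - 2 / α) * Real.Gamma (1 - 2 / α)))
      = (b * (1 / b) ^ (1 - 2 / α)) * ((Real.Gamma (2 / α) * Real.Gamma (1 - 2 / α)) / α) := by ring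
    _ = _ := by
      rw [hb1, hrefl, show Real.pi * (2 / α) = 2 * Real.pi / α by ring, div_div, mul_comm α]

end Integrals

/-! ### Gain laws and the choice between LOS and NLOS -/

section Gains

lemma gainProb_nonneg {φt φr : ℝ} (ht : φt ∈ Icc 0 (2 * Real.pi)) (hr : φr ∈ Icc 0 (2 * Real.pi))
    (i : Fin 4) : 0 ≤ gainProb φt φr i := by
  have hpi := Real.pi_pos
  have h1 : 0 ≤ φt / (2 * Real.pi) := div_nonneg ht.1 (by positivity)
  have h2 : 0 ≤ φr / (2 * Real.pi) := div_nonneg hr.1 (by positivity)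
  have h3 : 0 ≤ 1 - φt / (2 * Real.pi) := by
    rw [sub_nonneg, div_le_one (by positivity)]; exact ht.2
  have h4 : 0 ≤ 1 - φr / (2 * Real.pi) := by
    rw [sub_nonneg, div_le_one (by positivity)]; exact hr.2
  fin_cases i <;> simp only [gainProb] <;> simp <;> positivity

lemma sum_gainProb (φt φr : ℝ) : ∑ i, gainProb φt φr i = 1 := by
  simp only [gainProb, Fin.sum_univ_four]
  simp
  ring

lemma gainValue_nonneg {Mt mt Mr mr : ℝ} (h1 : 0 ≤ Mt) (h2 : 0 ≤ mt) (h3 : 0 ≤ Mr) (h4 : 0 ≤ mr)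
    (i : Fin 4) : 0 ≤ gainValue Mt mt Mr mr i := by
  fin_cases i <;> simp only [gainValue] <;> simp <;> positivity

lemma lintegral_gainLaw (d p : Fin 4 → ℝ) (F : ℝ → ℝ≥0∞) :
    ∫⁻ x, F x ∂(gainLaw d p) = ∑ i, ENNReal.ofReal (p i) * F (d i) := by
  simp [gainLaw, lintegral_finsetSum_measure, lintegral_smul_measure, lintegral_dirac]

lemma sum_ofReal_gainProb {φt φr : ℝ} (ht : φt ∈ Icc 0 (2 * Real.pi))
    (hr : φr ∈ Icc 0 (2 * Real.pi)) : ∑ i, ENNReal.ofReal (gainProb φt φr i) = 1 := by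
  rw [← ENNReal.ofReal_sum_of_nonneg fun i _ => gainProb_nonneg ht hr i, sum_gainProb,
    ENNReal.ofReal_one]

lemma isProbabilityMeasure_gainLaw {φt φr : ℝ} (ht : φt ∈ Icc 0 (2 * Real.pi))
    (hr : φr ∈ Icc 0 (2 * Real.pi)) (d : Fin 4 → ℝ) :
    IsProbabilityMeasure (gainLaw d (gainProb φt φr)) where
  measure_univ := by
    rw [← lintegral_one, lintegral_gainLaw]
    simpa using sum_ofReal_gainProb ht hr

/-- A Bernoulli choice made with a uniform variable. -/
lemma lintegral_ite_le_uniform {q : ℝ} (h0 : 0 ≤ q) (h1 : q ≤ 1) (a b : ℝ≥0∞) :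
    ∫⁻ u in Icc (0 : ℝ) 1, (if u ≤ q then a else b) =
      ENNReal.ofReal q * a + ENNReal.ofReal (1 - q) * b := by
  have h : Icc (0 : ℝ) 1 = Icc 0 q ∪ Ioc q 1 := (Icc_union_Ioc_eq_Icc h0 h1).symm
  have hd : Disjoint (Icc 0 q) (Ioc q 1) := by
    rw [Set.disjoint_left]
    intro x hx hx'
    exact absurd hx.2 (not_le.2 hx'.1)
  rw [h, lintegral_union measurableSet_Ioc hd,
    setLIntegral_congr_fun measurableSet_Icc (g := fun _ => a) fun u hu => if_pos hu.2,
    setLIntegral_congr_fun measurableSet_Ioc (g := fun _ => b) fun u hu => if_neg (not_le.2 hu.1)]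
  simp [mul_comm]

instance (c : ℝ) : SigmaFinite (homogeneousIntensity c) := by
  exact inferInstanceAs (SigmaFinite (c.toNNReal • (volume : Measure Plane)))

end Gains

/-! ### Elementary bounds and measurability for the network parameters -/

namespace HetNetParams
open Filter Topology

variable (P : HetNetParams)

lemma pi_lamM_pos : 0 < 2 * Real.pi * P.lamM := by
  have := P.lamM_pos; have := Real.pi_pos; positivity

lemma p_nonneg (i : Fin 4) : 0 ≤ P.p i := gainProb_nonneg P.phit_mem P.phir_mem i
lemma pfm_nonneg (i : Fin 4) : 0 ≤ P.pfm i := gainProb_nonneg P.phif_mem P.phir_mem i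
lemma d_nonneg (i : Fin 4) : 0 ≤ P.d i :=
  gainValue_nonneg P.Mt_pos.le P.mt_nonneg P.Mr_pos.le P.mr_nonneg i
lemma dfm_nonneg (i : Fin 4) : 0 ≤ P.dfm i :=
  gainValue_nonneg P.Mf_pos.le P.mf_nonneg P.Mr_pos.le P.mr_nonneg i

instance : IsProbabilityMeasure (gainLaw P.d P.p) :=
  isProbabilityMeasure_gainLaw P.phit_mem P.phir_mem _

instance : IsProbabilityMeasure (gainLaw P.dfm P.pfm) :=
  isProbabilityMeasure_gainLaw P.phif_mem P.phir_mem _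

lemma m_cast_pos : (0 : ℝ) < P.m := by exact_mod_cast P.m_pos

instance : IsProbabilityMeasure (gammaMeasure P.m P.m) :=
  isProbabilityMeasure_gammaMeasure P.m_cast_pos P.m_cast_pos

instance : IsProbabilityMeasure (volume.restrict (Icc (0 : ℝ) 1)) :=
  ⟨by simp⟩

instance : IsProbabilityMeasure P.macroMarkLaw := by
  unfold macroMarkLaw; infer_instance

instance : IsProbabilityMeasure P.femtoMarkLaw := by
  unfold femtoMarkLaw; infer_instance

lemma probL_pos (r : ℝ) : 0 < P.probL r := Real.exp_pos _

lemma probL_le_one {r : ℝ} (hr : 0 ≤ r) : P.probL r ≤ 1 := by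
  unfold probL
  rw [Real.exp_le_one_iff]
  nlinarith [P.beta_pos]

lemma probN_nonneg {r : ℝ} (hr : 0 ≤ r) : 0 ≤ P.probN r := sub_nonneg.2 (P.probL_le_one hr)

lemma probN_le_one (r : ℝ) : P.probN r ≤ 1 := sub_le_self _ (P.probL_pos r).le

@[fun_prop] lemma measurable_probL : Measurable P.probL := by unfold probL; fun_prop
@[fun_prop] lemma measurable_probN : Measurable P.probN := by unfold probN; fun_prop
@[fun_prop] lemma measurable_lossL : Measurable P.lossL := by unfold lossL; fun_prop
@[fun_prop] lemma measurable_lossN : Measurable P.lossN := by unfold lossN; fun_prop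
@[fun_prop] lemma measurable_Req : Measurable P.Req := by unfold Req; fun_prop
@[fun_prop] lemma measurable_ReqInv : Measurable P.ReqInv := by unfold ReqInv; fun_prop
@[fun_prop] lemma measurable_G : Measurable P.G := by unfold G; fun_prop

lemma G_pos (r : ℝ) : 0 < P.G r := by unfold G; positivity

/-- An upper bound of the vertical gain. -/
def Gmax : ℝ := (10 : ℝ) ^ (-(min 0 P.SLLdB) / 10)

/-- The square in the exponent is at least 0. The side-lobe level may be negative, so the bound
keeps `min 0 SLLdB`. -/
lemma G_le_Gmax (r : ℝ) : P.G r ≤ P.Gmax := by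
  unfold G Gmax
  refine Real.rpow_le_rpow_of_exponent_le (by norm_num) ?_
  have : min 0 P.SLLdB ≤ min (12 * ((Real.arctan (P.Heff / r) - P.thetaTilt) / P.theta3dB) ^ 2)
      P.SLLdB := min_le_min_right _ (by positivity)
  linarith

lemma lossL_nonneg {r : ℝ} (hr : 0 ≤ r) : 0 ≤ P.lossL r := by
  have := P.CL_pos; unfold lossL; positivity

lemma lossN_nonneg {r : ℝ} (hr : 0 ≤ r) : 0 ≤ P.lossN r := by
  have := P.CN_pos; unfold lossN; positivity

/-! ### Marked base stations -/

/-- The intensity measure of the marked MBSs. -/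
def macroIntensity : Measure (Plane × (ℝ × ℝ × ℝ)) :=
  (homogeneousIntensity P.lamM).prod P.macroMarkLaw

/-- The equivalent distance of a marked MBS. -/
def eqDist (z : Plane × (ℝ × ℝ × ℝ)) : ℝ :=
  if z.2.1 ≤ P.probL ‖z.1‖ then ‖z.1‖ else P.Req ‖z.1‖

/-- The path loss of a marked MBS. -/
def loss (z : Plane × (ℝ × ℝ × ℝ)) : ℝ :=
  if z.2.1 ≤ P.probL ‖z.1‖ then P.lossL ‖z.1‖ else P.lossN ‖z.1‖

/-- The interfering power of a marked MBS. -/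
def power (z : Plane × (ℝ × ℝ × ℝ)) : ℝ :=
  P.Pm * P.loss z * z.2.2.1 * P.G ‖z.1‖ * z.2.2.2

/-- The factor `e^{-t power}`. -/
def damp (t : ℝ) (z : Plane × (ℝ × ℝ × ℝ)) : ℝ≥0∞ := expNeg (ENNReal.ofReal (t * P.power z))

lemma measurableSet_los : MeasurableSet {z : Plane × (ℝ × ℝ × ℝ) | z.2.1 ≤ P.probL ‖z.1‖} :=
  measurableSet_le (by fun_prop) (by fun_prop)

@[fun_prop] lemma measurable_eqDist : Measurable P.eqDist :=
  Measurable.ite P.measurableSet_los (by fun_prop) (by fun_prop)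

@[fun_prop] lemma measurable_loss : Measurable P.loss :=
  Measurable.ite P.measurableSet_los (by fun_prop) (by fun_prop)

@[fun_prop] lemma measurable_power : Measurable P.power := by unfold power; fun_prop

lemma measurable_damp (t : ℝ) : Measurable (P.damp t) := measurable_expNeg.comp (by fun_prop)

lemma damp_le_one (t : ℝ) (z : Plane × (ℝ × ℝ × ℝ)) : P.damp t z ≤ 1 := expNeg_le_one _

/-- Integration with respect to the intensity measure of the marked MBSs. -/
lemma lintegral_macroIntensity {ψL ψN : ℝ → ℝ → ℝ → ℝ≥0∞}
    (hL : Measurable fun p : ℝ × ℝ × ℝ => ψL p.1 p.2.1 p.2.2)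
    (hN : Measurable fun p : ℝ × ℝ × ℝ => ψN p.1 p.2.1 p.2.2) :
    ∫⁻ z, (if z.2.1 ≤ P.probL ‖z.1‖ then ψL ‖z.1‖ z.2.2.1 z.2.2.2
        else ψN ‖z.1‖ z.2.2.1 z.2.2.2) ∂P.macroIntensity =
      ∫⁻ r in Ioi (0 : ℝ), ENNReal.ofReal (2 * Real.pi * P.lamM * r) *
        ∑ i, ENNReal.ofReal (P.p i) *
          (ENNReal.ofReal (P.probL r) * ∫⁻ h, ψL r (P.d i) h ∂(gammaMeasure P.m P.m) +
            ENNReal.ofReal (P.probN r) * ∫⁻ h, ψN r (P.d i) h ∂(gammaMeasure P.m P.m)) := by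
  have hm : Measurable fun q : ℝ × (ℝ × ℝ × ℝ) =>
      if q.2.1 ≤ P.probL q.1 then ψL q.1 q.2.2.1 q.2.2.2 else ψN q.1 q.2.2.1 q.2.2.2 :=
    Measurable.ite (measurableSet_le (by fun_prop) (by fun_prop))
      (hL.comp (by fun_prop : Measurable fun q : ℝ × (ℝ × ℝ × ℝ) => (q.1, q.2.2.1, q.2.2.2)))
      (hN.comp (by fun_prop : Measurable fun q : ℝ × (ℝ × ℝ × ℝ) => (q.1, q.2.2.1, q.2.2.2)))
  have hm' : Measurable fun z : Plane × (ℝ × ℝ × ℝ) =>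
      if z.2.1 ≤ P.probL ‖z.1‖ then ψL ‖z.1‖ z.2.2.1 z.2.2.2 else ψN ‖z.1‖ z.2.2.1 z.2.2.2 :=
    hm.comp (by fun_prop : Measurable fun z : Plane × (ℝ × ℝ × ℝ) => (‖z.1‖, z.2))
  rw [macroIntensity, lintegral_prod _ hm'.aemeasurable, homogeneousIntensity,
    lintegral_smul_measure,
    lintegral_norm_plane (F := fun r => ∫⁻ k, (if k.1 ≤ P.probL r then ψL r k.2.1 k.2.2
      else ψN r k.2.1 k.2.2) ∂P.macroMarkLaw) hm.lintegral_prod_right', smul_eq_mul,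
    ← lintegral_const_mul' _ _ ENNReal.ofReal_ne_top]
  refine setLIntegral_congr_fun measurableSet_Ioi fun r hr => ?_
  have hr' : (0 : ℝ) < r := hr
  have hpi := Real.pi_pos
  have hlam := P.lamM_pos
  rw [← mul_assoc, ← ENNReal.ofReal_mul hlam.le, show P.lamM * (2 * Real.pi * r) =
    2 * Real.pi * P.lamM * r by ring]
  congr 1
  have hmr : Measurable fun k : ℝ × ℝ × ℝ => if k.1 ≤ P.probL r then ψL r k.2.1 k.2.2
      else ψN r k.2.1 k.2.2 := hm.comp (by fun_prop : Measurable fun k : ℝ × ℝ × ℝ => (r, k))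
  rw [macroMarkLaw, lintegral_prod _ hmr.aemeasurable]
  have hsum : ∀ ψ : ℝ → ℝ → ℝ → ℝ≥0∞, Measurable (fun p : ℝ × ℝ × ℝ => ψ p.1 p.2.1 p.2.2) →
      ∫⁻ q, ψ r q.1 q.2 ∂((gainLaw P.d P.p).prod (gammaMeasure P.m P.m)) =
      ∑ i, ENNReal.ofReal (P.p i) * ∫⁻ h, ψ r (P.d i) h ∂(gammaMeasure P.m P.m) := by
    intro ψ hψ
    rw [lintegral_prod (fun q : ℝ × ℝ => ψ r q.1 q.2)
      (hψ.comp (by fun_prop : Measurable fun q : ℝ × ℝ => (r, q.1, q.2))).aemeasurable,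
      lintegral_gainLaw]
  have hite : ∀ u : ℝ, ∫⁻ q : ℝ × ℝ, (if u ≤ P.probL r then ψL r q.1 q.2 else ψN r q.1 q.2)
      ∂((gainLaw P.d P.p).prod (gammaMeasure P.m P.m)) =
      if u ≤ P.probL r then
        ∑ i, ENNReal.ofReal (P.p i) * ∫⁻ h, ψL r (P.d i) h ∂(gammaMeasure P.m P.m)
      else ∑ i, ENNReal.ofReal (P.p i) * ∫⁻ h, ψN r (P.d i) h ∂(gammaMeasure P.m P.m) := by
    intro u
    split_ifs
    · exact hsum ψL hL
    · exact hsum ψN hN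
  simp only [hite]
  rw [lintegral_ite_le_uniform (P.probL_pos r).le (P.probL_le_one hr'.le), Finset.mul_sum,
    Finset.mul_sum, ← Finset.sum_add_distrib]
  refine Finset.sum_congr rfl fun i _ => ?_
  rw [probN]
  ring

/-! ### The law of the equivalent distances -/

lemma muR_pos : 0 < P.muR := by
  have := P.CL_pos; have := P.CN_pos; unfold muR; positivity

lemma alphaN_pos : 0 < P.alphaN := by linarith [P.two_lt_alphaN]

lemma kappa_pos : 0 < P.kappa := div_pos P.alphaL_pos P.alphaN_pos

lemma ReqInv_pos {r : ℝ} (hr : 0 < r) : 0 < P.ReqInv r := by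
  have := P.muR_pos; unfold ReqInv; positivity

lemma Req_ReqInv {r : ℝ} (hr : 0 < r) : P.Req (P.ReqInv r) = r := by
  have h1 := P.CL_pos; have h2 := P.CN_pos; have h3 := P.alphaL_pos; have h4 := P.alphaN_pos
  unfold Req ReqInv muR kappa
  rw [Real.mul_rpow (by positivity) (by positivity), ← Real.rpow_mul (by positivity),
    ← Real.rpow_mul (by positivity), show 1 / P.alphaN * (P.alphaN / P.alphaL) = 1 / P.alphaL by
      field_simp, show P.alphaL / P.alphaN * (P.alphaN / P.alphaL) = 1 by field_simp,
    Real.rpow_one, ← mul_assoc, ← Real.mul_rpow (by positivity) (by positivity),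
    show P.CL / P.CN * (P.CN / P.CL) = 1 by field_simp, Real.one_rpow, one_mul]

lemma Req_lt_Req {r r' : ℝ} (hr : 0 ≤ r) (h : r < r') : P.Req r < P.Req r' := by
  have h1 := P.CL_pos; have h2 := P.CN_pos; have h3 := P.alphaL_pos; have h4 := P.alphaN_pos
  unfold Req
  have := Real.rpow_lt_rpow hr h (by positivity : 0 < P.alphaN / P.alphaL)
  gcongr

/-- `Req` is strictly increasing with right inverse `ReqInv`. This is where the lower limit of the
NLOS integrals in `laplaceMacro` comes from. -/
lemma lt_Req_iff {ρ r : ℝ} (hρ : 0 < ρ) (hr : 0 ≤ r) : ρ < P.Req r ↔ P.ReqInv ρ < r := by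
  constructor
  · intro h
    by_contra hn
    rcases (not_lt.1 hn).eq_or_lt with h' | h'
    · rw [h', P.Req_ReqInv hρ] at h
      exact lt_irrefl _ h
    · have := P.Req_lt_Req hr h'
      rw [P.Req_ReqInv hρ] at this
      exact lt_asymm h this
  · intro h
    have := P.Req_lt_Req (P.ReqInv_pos hρ).le h
    rwa [P.Req_ReqInv hρ] at this

/-- The density of the equivalent distances of the MBSs. -/
def distDensity (r : ℝ) : ℝ :=
  2 * Real.pi * P.lamM * (r * Real.exp (-P.beta * r) +
    P.muR ^ 2 * P.kappa * r ^ (2 * P.kappa - 1) * (1 - Real.exp (-P.beta * P.ReqInv r)))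

/-- The mean number of MBSs up to a given equivalent distance. -/
def meanUpTo (r : ℝ) : ℝ :=
  2 * Real.pi * P.lamM / P.beta ^ 2 * (1 - (1 + P.beta * r) * Real.exp (-P.beta * r)) +
  2 * Real.pi * P.lamM / P.beta ^ 2 * (P.beta ^ 2 * P.ReqInv r ^ 2 / 2 +
      (P.beta * P.ReqInv r + 1) * Real.exp (-P.beta * P.ReqInv r) - 1)

lemma fR_eq (r : ℝ) : P.fR r = P.distDensity r * Real.exp (-P.meanUpTo r) := by
  rw [fR, distDensity, meanUpTo, mul_assoc, ← Real.exp_add]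
  congr 2
  ring

@[fun_prop] lemma measurable_fR : Measurable P.fR := by
  unfold fR; fun_prop

lemma distDensity_nonneg {r : ℝ} (hr : 0 < r) : 0 ≤ P.distDensity r := by
  have h1 := P.pi_lamM_pos
  have h2 := P.kappa_pos
  have h3 : 0 ≤ 1 - Real.exp (-P.beta * P.ReqInv r) := P.probN_nonneg (P.ReqInv_pos hr).le
  unfold distDensity
  positivity

lemma fR_nonneg {r : ℝ} (hr : 0 < r) : 0 ≤ P.fR r := by
  rw [fR_eq]; exact mul_nonneg (P.distDensity_nonneg hr) (Real.exp_pos _).le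

lemma hasDerivAt_ReqInv {r : ℝ} (hr : 0 < r) :
    HasDerivAt P.ReqInv (P.muR * (P.kappa * r ^ (P.kappa - 1))) r :=
  (Real.hasDerivAt_rpow_const (Or.inl hr.ne')).const_mul _

/-- Identifies the closed form in the exponent of `fR` as a primitive of `distDensity`, so that `fR
= Λ' e^{-Λ}`. -/
lemma hasDerivAt_meanUpTo {r : ℝ} (hr : 0 < r) : HasDerivAt P.meanUpTo (P.distDensity r) r := by
  have hb := P.beta_pos
  have hu := P.hasDerivAt_ReqInv hr
  have he : HasDerivAt (fun r => Real.exp (-P.beta * r)) (Real.exp (-P.beta * r) * (-P.beta * 1)) r :=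
    ((hasDerivAt_id r).const_mul _).exp
  have heu := (hu.const_mul (-P.beta)).exp
  have h1 := (((((hasDerivAt_id r).const_mul P.beta).const_add 1).fun_mul he).const_sub 1).const_mul
    (2 * Real.pi * P.lamM / P.beta ^ 2)
  have h2 := (((((hu.fun_pow 2).const_mul (P.beta ^ 2)).div_const 2).fun_add
    (((hu.const_mul P.beta).add_const 1).fun_mul heu)).sub_const 1).const_mul
    (2 * Real.pi * P.lamM / P.beta ^ 2)
  refine (h1.fun_add h2).congr_deriv ?_
  have hr2 : r ^ (2 * P.kappa - 1) = r ^ P.kappa * r ^ (P.kappa - 1) := by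
    rw [← Real.rpow_add hr]; congr 1; ring
  rw [distDensity, hr2]
  simp only [ReqInv, id]
  field_simp
  ring

lemma continuous_meanUpTo : Continuous P.meanUpTo := by
  have h : Continuous P.ReqInv := by
    unfold ReqInv
    exact continuous_const.mul (Real.continuous_rpow_const P.kappa_pos.le)
  unfold meanUpTo
  fun_prop

lemma meanUpTo_zero : P.meanUpTo 0 = 0 := by
  simp [meanUpTo, ReqInv, Real.zero_rpow P.kappa_pos.ne']

lemma lintegral_Ioc_distDensity {ρ : ℝ} (hρ : 0 ≤ ρ) :
    ∫⁻ r in Ioc 0 ρ, ENNReal.ofReal (P.distDensity r) = ENNReal.ofReal (P.meanUpTo ρ) := by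
  have hI : IntegrableOn P.distDensity (Ioc 0 ρ) :=
    intervalIntegral.integrableOn_deriv_of_nonneg P.continuous_meanUpTo.continuousOn
      (fun x hx => P.hasDerivAt_meanUpTo hx.1) fun x hx => P.distDensity_nonneg hx.1
  have h := intervalIntegral.integral_eq_sub_of_hasDerivAt_of_le hρ
    P.continuous_meanUpTo.continuousOn (fun x hx => P.hasDerivAt_meanUpTo hx.1)
    ((intervalIntegrable_iff_integrableOn_Ioc_of_le hρ).2 hI)
  rw [P.meanUpTo_zero, sub_zero, intervalIntegral.integral_of_le hρ] at h
  rw [← h, ofReal_integral_eq_lintegral_ofReal hI]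
  exact (ae_restrict_iff' measurableSet_Ioc).2 (ae_of_all _ fun x hx => P.distDensity_nonneg hx.1)

lemma meanUpTo_nonneg {ρ : ℝ} (hρ : 0 ≤ ρ) : 0 ≤ P.meanUpTo ρ := by
  have h : MonotoneOn P.meanUpTo (Ici 0) := by
    refine monotoneOn_of_deriv_nonneg (convex_Ici 0) P.continuous_meanUpTo.continuousOn ?_ ?_
    · intro x hx
      rw [interior_Ici] at hx
      exact (P.hasDerivAt_meanUpTo hx).differentiableAt.differentiableWithinAt
    · intro x hx
      rw [interior_Ici] at hx
      rw [(P.hasDerivAt_meanUpTo hx).deriv]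
      exact P.distDensity_nonneg hx
  simpa [P.meanUpTo_zero] using h (mem_Ici.2 le_rfl) (mem_Ici.2 hρ) hρ

/-- The NLOS part contains a positive multiple of `ReqInv r ^ 2`, and `(1 + β r) e^{-β r} ≤ 1` keeps
the LOS part nonnegative. -/
lemma tendsto_meanUpTo : Tendsto P.meanUpTo atTop atTop := by
  have hb := P.beta_pos
  have hlam := P.pi_lamM_pos
  have hu : Tendsto P.ReqInv atTop atTop :=
    (tendsto_rpow_atTop P.kappa_pos).const_mul_atTop P.muR_pos
  have hc : 0 < 2 * Real.pi * P.lamM / P.beta ^ 2 := by positivity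
  have h1 : Tendsto (fun r => 2 * Real.pi * P.lamM / P.beta ^ 2 *
      (P.beta ^ 2 / 2 * P.ReqInv r ^ 2 + -1)) atTop atTop :=
    (tendsto_atTop_add_const_right _ _
      (((tendsto_pow_atTop two_ne_zero).comp hu).const_mul_atTop (by positivity))).const_mul_atTop hc
  refine tendsto_atTop_mono' _ ?_ h1
  filter_upwards [eventually_gt_atTop 0] with r hr
  have hu0 := P.ReqInv_pos hr
  unfold meanUpTo
  rw [← mul_add]
  refine mul_le_mul_of_nonneg_left ?_ hc.le
  have h2 : (1 + P.beta * r) * Real.exp (-P.beta * r) ≤ 1 := by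
    have h3 := Real.add_one_le_exp (P.beta * r)
    calc (1 + P.beta * r) * Real.exp (-P.beta * r)
        ≤ Real.exp (P.beta * r) * Real.exp (-P.beta * r) := by gcongr; linarith
      _ = 1 := by rw [← Real.exp_add]; simp
  have h4 : 0 ≤ (P.beta * P.ReqInv r + 1) * Real.exp (-P.beta * P.ReqInv r) := by positivity
  linarith

/-- `fR` is the derivative of `-e^{-Λ}`, which climbs from `-1` at 0 to 0 at infinity. That no mass
is lost is what later guarantees a nearest station. -/
lemma lintegral_fR : ∫⁻ r in Ioi (0 : ℝ), ENNReal.ofReal (P.fR r) = 1 := by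
  have hd : ∀ r ∈ Ioi (0 : ℝ), HasDerivAt (fun r => -Real.exp (-P.meanUpTo r)) (P.fR r) r := by
    intro r hr
    refine ((P.hasDerivAt_meanUpTo hr).fun_neg.exp).fun_neg.congr_deriv ?_
    rw [fR_eq]; ring
  have hc : ContinuousWithinAt (fun r => -Real.exp (-P.meanUpTo r)) (Ici 0) 0 := by
    have := P.continuous_meanUpTo
    exact Continuous.continuousWithinAt (by fun_prop)
  have hlim : Tendsto (fun r => -Real.exp (-P.meanUpTo r)) atTop (𝓝 0) := by
    rw [← neg_zero]
    exact (Real.tendsto_exp_atBot.comp (tendsto_neg_atTop_atBot.comp P.tendsto_meanUpTo)).neg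
  have hI := integrableOn_Ioi_deriv_of_nonneg hc hd (fun r hr => P.fR_nonneg hr) hlim
  have h := integral_Ioi_of_hasDerivAt_of_nonneg hc hd (fun r hr => P.fR_nonneg hr) hlim
  rw [← ofReal_integral_eq_lintegral_ofReal hI
    ((ae_restrict_iff' measurableSet_Ioi).2 (ae_of_all _ fun r hr => P.fR_nonneg hr)), h]
  simp [P.meanUpTo_zero]

/-- The law of the equivalent distances and fadings under the intensity measure. -/
lemma lintegral_eqDist_fading {g φ : ℝ → ℝ≥0∞} (hg : Measurable g) (hφ : Measurable φ) :
    ∫⁻ z, g (P.eqDist z) * φ z.2.2.2 ∂P.macroIntensity =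
      (∫⁻ h, φ h ∂(gammaMeasure P.m P.m)) *
        ∫⁻ r in Ioi (0 : ℝ), ENNReal.ofReal (P.distDensity r) * g r := by
  have hite : ∀ z : Plane × (ℝ × ℝ × ℝ), g (P.eqDist z) * φ z.2.2.2 =
      if z.2.1 ≤ P.probL ‖z.1‖ then g ‖z.1‖ * φ z.2.2.2 else g (P.Req ‖z.1‖) * φ z.2.2.2 := by
    intro z
    unfold eqDist
    split_ifs <;> rfl
  simp_rw [hite]
  rw [P.lintegral_macroIntensity (ψL := fun r _ h => g r * φ h) (ψN := fun r _ h => g (P.Req r) * φ h)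
    (by fun_prop) (by fun_prop)]
  simp only [lintegral_const_mul _ hφ]
  set Φ := ∫⁻ h, φ h ∂(gammaMeasure P.m P.m) with hΦ
  have hsum : ∀ x : ℝ≥0∞, ∑ i, ENNReal.ofReal (P.p i) * x = x := fun x => by
    rw [← Finset.sum_mul]
    simp only [p]
    rw [sum_ofReal_gainProb P.phit_mem P.phir_mem, one_mul]
  simp only [hsum]
  have hsplit : ∀ r : ℝ, ENNReal.ofReal (2 * Real.pi * P.lamM * r) *
      (ENNReal.ofReal (P.probL r) * (g r * Φ) + ENNReal.ofReal (P.probN r) * (g (P.Req r) * Φ)) =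
      Φ * (ENNReal.ofReal (2 * Real.pi * P.lamM * r) * ENNReal.ofReal (P.probL r) * g r +
        ENNReal.ofReal (2 * Real.pi * P.lamM * r) * ENNReal.ofReal (P.probN r) * g (P.Req r)) := by
    intro r; ring
  simp_rw [hsplit]
  -- The NLOS part is rewritten with `r = μ t^κ`, that is, in terms of the equivalent distance `t =
  -- Req r`; its Jacobian produces the second summand of `distDensity`.
  rw [lintegral_const_mul _ (by fun_prop), lintegral_add_left (by fun_prop),
    lintegral_comp_const_mul_rpow P.muR_pos P.kappa_pos (fun r => ENNReal.ofReal
      (2 * Real.pi * P.lamM * r) * ENNReal.ofReal (P.probN r) * g (P.Req r)),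
    ← lintegral_add_left (by fun_prop)]
  congr 1
  refine setLIntegral_congr_fun measurableSet_Ioi fun r hr => ?_
  have hr' : (0 : ℝ) < r := hr
  have hlam := P.pi_lamM_pos
  have hμ := P.muR_pos
  have hκ := P.kappa_pos
  have hReq : P.Req (P.muR * r ^ P.kappa) = r := P.Req_ReqInv hr'
  have hN := P.probN_nonneg (P.ReqInv_pos hr').le
  have hL := P.probL_pos r
  rw [hReq, ← mul_assoc, ← add_mul]
  congr 1
  rw [← ENNReal.ofReal_mul (by positivity), ← ENNReal.ofReal_mul (by positivity),
    ← ENNReal.ofReal_mul (by positivity), ← ENNReal.ofReal_add (by positivity)]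
  · congr 1
    have hr2 : r ^ (2 * P.kappa - 1) = r ^ P.kappa * r ^ (P.kappa - 1) := by
      rw [← Real.rpow_add hr']; congr 1; ring
    rw [distDensity, hr2]
    simp only [probL, probN, ReqInv]
    ring
  · have : 0 ≤ P.probN (P.muR * r ^ P.kappa) := hN
    positivity

end HetNetParams

namespace HetNetParams
open Filter Topology

variable (P : HetNetParams)

/-! ### The Laplace functional of the interference -/

lemma one_sub_inv_pow_nonneg {y : ℝ} (hy : 0 ≤ y) (m : ℕ) : 0 ≤ 1 - 1 / (1 + y) ^ m := by
  rw [sub_nonneg, div_le_one (by positivity)]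
  exact one_le_pow₀ (by linarith)

lemma one_sub_inv_pow_le_one {y : ℝ} (hy : 0 ≤ y) (m : ℕ) : 1 - 1 / (1 + y) ^ m ≤ 1 :=
  sub_le_self _ (by positivity)

/-- Bernoulli's inequality for `(1 + y)⁻¹ = 1 - y / (1 + y)`. -/
lemma one_sub_inv_pow_le {y : ℝ} (hy : 0 ≤ y) (m : ℕ) : 1 - 1 / (1 + y) ^ m ≤ m * y := by
  have h1 : (1 + y)⁻¹ = 1 + -(y / (1 + y)) := by field_simp; ring
  have h2 : y / (1 + y) ≤ y := div_le_self hy (by linarith)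
  have h3 : -2 ≤ -(y / (1 + y)) := by
    have : y / (1 + y) ≤ 1 := by rw [div_le_one (by positivity)]; linarith
    linarith
  have h4 := one_add_mul_le_pow h3 m
  rw [← h1, inv_pow] at h4
  rw [one_div]
  have h5 : (m : ℝ) * (y / (1 + y)) ≤ m * y := by gcongr
  linarith

lemma lintegral_one_sub_expNeg_gamma {a : ℝ} (ha : 0 ≤ a) :
    ∫⁻ h, (1 - expNeg (ENNReal.ofReal (a * h))) ∂(gammaMeasure P.m P.m) =
      ENNReal.ofReal (1 - 1 / (1 + a / P.m) ^ P.m) := by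
  have hm : Measurable fun h : ℝ => expNeg (ENNReal.ofReal (a * h)) :=
    measurable_expNeg.comp (by fun_prop)
  rw [lintegral_sub hm (ne_top_of_le_ne_top ENNReal.one_ne_top ?_)
    (ae_of_all _ fun h => expNeg_le_one _),
    lintegral_expNeg_gammaMeasure P.m_cast_pos P.m_cast_pos ha, ENNReal.ofReal_sub _ (by
      have := P.m_cast_pos; positivity), Real.rpow_natCast]
  · simp
  · calc _ ≤ ∫⁻ _, 1 ∂(gammaMeasure P.m P.m) := lintegral_mono fun h => expNeg_le_one _
      _ = 1 := by simp

/-- The argument of the fading transform in `FL`. -/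
lemma FL_eq {r : ℝ} (hr : 0 < r) (t D : ℝ) :
    P.FL t r D = 1 - 1 / (1 + (t * (P.Pm * P.lossL r * D * P.G r)) / P.m) ^ P.m := by
  rw [FL, lossL, Real.rpow_neg hr.le]
  congr 4
  have := P.m_cast_pos
  have : 0 < r ^ P.alphaL := by positivity
  field_simp

lemma FN_eq {r : ℝ} (hr : 0 < r) (t D : ℝ) :
    P.FN t r D = 1 - 1 / (1 + (t * (P.Pm * P.lossN r * D * P.G r)) / P.m) ^ P.m := by
  rw [FN, lossN, Real.rpow_neg hr.le]
  congr 4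
  have := P.m_cast_pos
  have : 0 < r ^ P.alphaN := by positivity
  field_simp

lemma argL_nonneg {r t D : ℝ} (hr : 0 < r) (ht : 0 ≤ t) (hD : 0 ≤ D) :
    0 ≤ t * (P.Pm * P.lossL r * D * P.G r) := by
  have := P.Pm_pos; have := P.lossL_nonneg hr.le; have := P.G_pos r
  positivity

lemma argN_nonneg {r t D : ℝ} (hr : 0 < r) (ht : 0 ≤ t) (hD : 0 ≤ D) :
    0 ≤ t * (P.Pm * P.lossN r * D * P.G r) := by
  have := P.Pm_pos; have := P.lossN_nonneg hr.le; have := P.G_pos r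
  positivity

lemma FL_nonneg {r t D : ℝ} (hr : 0 < r) (ht : 0 ≤ t) (hD : 0 ≤ D) : 0 ≤ P.FL t r D := by
  rw [P.FL_eq hr]
  exact one_sub_inv_pow_nonneg (div_nonneg (P.argL_nonneg hr ht hD) P.m_cast_pos.le) _

lemma FN_nonneg {r t D : ℝ} (hr : 0 < r) (ht : 0 ≤ t) (hD : 0 ≤ D) : 0 ≤ P.FN t r D := by
  rw [P.FN_eq hr]
  exact one_sub_inv_pow_nonneg (div_nonneg (P.argN_nonneg hr ht hD) P.m_cast_pos.le) _

lemma FL_le_one {r t D : ℝ} (hr : 0 < r) (ht : 0 ≤ t) (hD : 0 ≤ D) : P.FL t r D ≤ 1 := by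
  rw [P.FL_eq hr]
  exact one_sub_inv_pow_le_one (div_nonneg (P.argL_nonneg hr ht hD) P.m_cast_pos.le) _

lemma FN_le {r t D : ℝ} (hr : 0 < r) (ht : 0 ≤ t) (hD : 0 ≤ D) :
    P.FN t r D ≤ t * P.Pm * P.CN * D * P.Gmax * r ^ (-P.alphaN) := by
  have hm := P.m_cast_pos
  have h1 := P.Pm_pos; have h2 := P.CN_pos
  rw [P.FN_eq hr]
  refine (one_sub_inv_pow_le (div_nonneg (P.argN_nonneg hr ht hD) hm.le) _).trans ?_
  rw [mul_div_cancel₀ _ hm.ne', lossN]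
  have := P.G_le_Gmax r
  calc t * (P.Pm * (P.CN * r ^ (-P.alphaN)) * D * P.G r)
      ≤ t * (P.Pm * (P.CN * r ^ (-P.alphaN)) * D * P.Gmax) := by gcongr
    _ = _ := by ring

lemma measurable_FL (t D : ℝ) : Measurable fun r => P.FL t r D := by unfold FL; fun_prop
lemma measurable_FN (t D : ℝ) : Measurable fun r => P.FN t r D := by unfold FN; fun_prop

/-- `F_L` is at most 1 and the LOS probability decays exponentially, so no lower bound on `α_L`
beyond positivity is needed. -/
lemma integrableOn_FL {ρ t D : ℝ} (hρ : 0 ≤ ρ) (ht : 0 ≤ t) (hD : 0 ≤ D) :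
    IntegrableOn (fun x => P.FL t x D * x * P.probL x) (Ioi ρ) := by
  have h := integrableOn_rpow_mul_exp_neg_mul_rpow (by norm_num : (-1 : ℝ) < 1)
    (one_pos : (0 : ℝ) < 1) P.beta_pos
  refine Integrable.mono' (h.mono_set (Ioi_subset_Ioi hρ)) ?_ ?_
  · exact (((P.measurable_FL t D).mul measurable_id).mul P.measurable_probL).aestronglyMeasurable
  · refine (ae_restrict_iff' measurableSet_Ioi).2 (ae_of_all _ fun x hx => ?_)
    have hx' : 0 < x := lt_of_le_of_lt hρ hx
    have h1 := P.FL_nonneg hx' ht hD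
    have h2 := P.FL_le_one hx' ht hD
    have h3 := P.probL_pos x
    rw [Real.norm_of_nonneg (by positivity), Real.rpow_one, mul_assoc]
    exact mul_le_of_le_one_left (by positivity) h2

/-- The NLOS probability does not decay, so the path loss must: the integrand is bounded by a
multiple of `x^{1 - α_N}`, integrable away from 0 because `α_N > 2`. -/
lemma integrableOn_FN {ρ t D : ℝ} (hρ : 0 < ρ) (ht : 0 ≤ t) (hD : 0 ≤ D) :
    IntegrableOn (fun x => P.FN t x D * x * P.probN x) (Ioi ρ) := by
  have h := (integrableOn_Ioi_rpow_of_lt (a := 1 - P.alphaN) (by linarith [P.two_lt_alphaN]) hρ).const_mul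
    (t * P.Pm * P.CN * D * P.Gmax)
  refine Integrable.mono' h ?_ ?_
  · exact (((P.measurable_FN t D).mul measurable_id).mul P.measurable_probN).aestronglyMeasurable
  · refine (ae_restrict_iff' measurableSet_Ioi).2 (ae_of_all _ fun x hx => ?_)
    have hx' : 0 < x := hρ.trans hx
    have h1 := P.FN_nonneg hx' ht hD
    have h2 := P.FN_le hx' ht hD
    have h3 := P.probN_nonneg hx'.le
    have h4 := P.probN_le_one x
    rw [Real.norm_of_nonneg (by positivity), show 1 - P.alphaN = -P.alphaN + 1 by ring,
      Real.rpow_add hx', Real.rpow_one, ← mul_assoc]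
    calc P.FN t x D * x * P.probN x ≤ P.FN t x D * x := mul_le_of_le_one_right (by positivity) h4
      _ ≤ _ := by gcongr

lemma lintegral_Ioi_cutoff {lam p s : ℝ} (hlam : 0 ≤ lam) (hp : 0 ≤ p) (hs : 0 ≤ s) {F q : ℝ → ℝ}
    (hF : ∀ r, 0 < r → 0 ≤ F r) (hq : ∀ r, 0 < r → 0 ≤ q r)
    (hI : IntegrableOn (fun x => F x * x * q x) (Ioi s)) :
    ∫⁻ r in Ioi (0 : ℝ), ENNReal.ofReal (lam * r) * (ENNReal.ofReal p * (ENNReal.ofReal (q r) *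
      (if s < r then ENNReal.ofReal (F r) else 0))) =
      ENNReal.ofReal (lam * p * ∫ x in Ioi s, F x * x * q x) := by
  rw [← integral_const_mul, ofReal_integral_eq_lintegral_ofReal (hI.const_mul _)]
  · rw [← lintegral_indicator measurableSet_Ioi, ← lintegral_indicator measurableSet_Ioi]
    refine lintegral_congr fun r => ?_
    by_cases hr : s < r
    · have hr0 : 0 < r := lt_of_le_of_lt hs hr
      have h1 := hF r hr0
      have h2 := hq r hr0
      rw [indicator_of_mem (mem_Ioi.2 hr0), indicator_of_mem (mem_Ioi.2 hr), if_pos hr,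
        ← ENNReal.ofReal_mul h2, ← ENNReal.ofReal_mul hp, ← ENNReal.ofReal_mul (by positivity)]
      congr 1
      ring
    · rw [indicator_of_notMem (s := Ioi s) hr]
      simp [indicator, hr]
  · refine (ae_restrict_iff' measurableSet_Ioi).2 (ae_of_all _ fun r hr => ?_)
    have hr0 : 0 < r := lt_of_le_of_lt hs hr
    have h1 := hF r hr0
    have h2 := hq r hr0
    simp only [Pi.zero_apply]
    positivity

/-- The exponent of `laplaceMacro`. -/
def macroExponent (ρ t : ℝ) : ℝ :=
  ∑ i, (P.Ci i * (∫ x in Ioi ρ, P.FL t x (P.d i) * x * P.probL x) +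
    P.Ci i * ∫ x in Ioi (P.ReqInv ρ), P.FN t x (P.d i) * x * P.probN x)

lemma Ci_nonneg (i : Fin 4) : 0 ≤ P.Ci i := by
  have := P.pi_lamM_pos; have := P.p_nonneg i; unfold Ci; positivity

lemma macroExponent_nonneg {ρ t : ℝ} (hρ : 0 < ρ) (ht : 0 ≤ t) : 0 ≤ P.macroExponent ρ t := by
  refine Finset.sum_nonneg fun i _ => add_nonneg (mul_nonneg (P.Ci_nonneg i) ?_)
    (mul_nonneg (P.Ci_nonneg i) ?_)
  · refine setIntegral_nonneg measurableSet_Ioi fun x hx => ?_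
    have hx' : 0 < x := hρ.trans hx
    exact mul_nonneg (mul_nonneg (P.FL_nonneg hx' ht (P.d_nonneg i)) hx'.le) (P.probL_pos x).le
  · refine setIntegral_nonneg measurableSet_Ioi fun x hx => ?_
    have hx' : 0 < x := (P.ReqInv_pos hρ).trans hx
    exact mul_nonneg (mul_nonneg (P.FN_nonneg hx' ht (P.d_nonneg i)) hx'.le) (P.probN_nonneg hx'.le)

lemma laplaceMacro_eq (ρ t : ℝ) : P.laplaceMacro ρ t = Real.exp (-P.macroExponent ρ t) := by
  rw [laplaceMacro, ← Real.exp_sum, ← Real.exp_sum, ← Real.exp_add, macroExponent,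
    Finset.sum_add_distrib, neg_add]
  simp only [neg_mul, Finset.sum_neg_distrib]

/-- Stations within equivalent distance `ρ` count with weight 1, which gives their mean number. The
others count with `1 - e^{-t power}`, whose average over the Gamma fading is `F_L` or `F_N`. -/
lemma lintegral_one_sub_beyond_damp {ρ t : ℝ} (hρ : 0 < ρ) (ht : 0 ≤ t) :
    ∫⁻ z, (1 - beyond P.eqDist (P.damp t) ρ z) ∂P.macroIntensity =
      ENNReal.ofReal (P.meanUpTo ρ + P.macroExponent ρ t) := by
  let ψL : ℝ → ℝ → ℝ → ℝ≥0∞ := fun r D h =>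
    if ρ < r then 1 - expNeg (ENNReal.ofReal (t * (P.Pm * P.lossL r * D * P.G r) * h)) else 0
  let ψN : ℝ → ℝ → ℝ → ℝ≥0∞ := fun r D h =>
    if ρ < P.Req r then 1 - expNeg (ENNReal.ofReal (t * (P.Pm * P.lossN r * D * P.G r) * h)) else 0
  have hL : Measurable fun p : ℝ × ℝ × ℝ => ψL p.1 p.2.1 p.2.2 :=
    Measurable.ite (measurableSet_lt measurable_const (by fun_prop))
      (measurable_const.sub (measurable_expNeg.comp (by fun_prop))) measurable_const
  have hN : Measurable fun p : ℝ × ℝ × ℝ => ψN p.1 p.2.1 p.2.2 :=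
    Measurable.ite (measurableSet_lt measurable_const (by fun_prop))
      (measurable_const.sub (measurable_expNeg.comp (by fun_prop))) measurable_const
  have hsplit : ∀ z, 1 - beyond P.eqDist (P.damp t) ρ z =
      (Iic ρ).indicator (fun _ => (1 : ℝ≥0∞)) (P.eqDist z) * 1 +
      if z.2.1 ≤ P.probL ‖z.1‖ then ψL ‖z.1‖ z.2.2.1 z.2.2.2 else ψN ‖z.1‖ z.2.2.1 z.2.2.2 := by
    intro z
    by_cases hz : z.2.1 ≤ P.probL ‖z.1‖
    · have he : P.eqDist z = ‖z.1‖ := if_pos hz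
      have hl : P.loss z = P.lossL ‖z.1‖ := if_pos hz
      rw [if_pos hz]
      by_cases hr : ρ < ‖z.1‖
      · rw [beyond_of_lt (by rwa [he]), indicator_of_notMem (by simpa [he] using hr)]
        simp only [ψL, if_pos hr, damp, power, hl, zero_mul, zero_add]
        congr 3
        ring
      · rw [beyond_of_le (by rw [he]; exact not_lt.1 hr),
          indicator_of_mem (by simpa [he] using hr)]
        simp [ψL, if_neg hr]
    · have he : P.eqDist z = P.Req ‖z.1‖ := if_neg hz
      have hl : P.loss z = P.lossN ‖z.1‖ := if_neg hz
      rw [if_neg hz]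
      by_cases hr : ρ < P.Req ‖z.1‖
      · rw [beyond_of_lt (by rwa [he]), indicator_of_notMem (by simpa [he] using hr)]
        simp only [ψN, if_pos hr, damp, power, hl, zero_mul, zero_add]
        congr 3
        ring
      · rw [beyond_of_le (by rw [he]; exact not_lt.1 hr),
          indicator_of_mem (by simpa [he] using hr)]
        simp [ψN, if_neg hr]
  simp_rw [hsplit]
  have hind : Measurable ((Iic ρ).indicator fun _ => (1 : ℝ≥0∞)) :=
    measurable_const.indicator measurableSet_Iic
  have hind' : Measurable fun z => (Iic ρ).indicator (fun _ => (1 : ℝ≥0∞)) (P.eqDist z) * 1 :=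
    (hind.comp P.measurable_eqDist).mul_const _
  rw [lintegral_add_left hind',
    P.lintegral_eqDist_fading hind (φ := fun _ => 1) measurable_const,
    P.lintegral_macroIntensity hL hN,
    ENNReal.ofReal_add (P.meanUpTo_nonneg hρ.le) (P.macroExponent_nonneg hρ ht)]
  congr 1
  · rw [← P.lintegral_Ioc_distDensity hρ.le]
    simp only [lintegral_const, measure_univ, mul_one, one_mul]
    rw [← lintegral_indicator measurableSet_Ioi, ← lintegral_indicator measurableSet_Ioc]
    refine lintegral_congr fun r => ?_
    by_cases h1 : 0 < r <;> by_cases h2 : r ≤ ρ <;> simp [indicator, h1, h2]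
  · have hLi : ∀ r ∈ Ioi (0 : ℝ), ∀ i, ∫⁻ h, ψL r (P.d i) h ∂(gammaMeasure P.m P.m) =
        if ρ < r then ENNReal.ofReal (P.FL t r (P.d i)) else 0 := by
      intro r hr i
      by_cases h : ρ < r
      · simp only [ψL, if_pos h]
        rw [P.lintegral_one_sub_expNeg_gamma (P.argL_nonneg hr ht (P.d_nonneg i)), P.FL_eq hr]
      · simp [ψL, if_neg h]
    have hNi : ∀ r ∈ Ioi (0 : ℝ), ∀ i, ∫⁻ h, ψN r (P.d i) h ∂(gammaMeasure P.m P.m) =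
        if P.ReqInv ρ < r then ENNReal.ofReal (P.FN t r (P.d i)) else 0 := by
      intro r hr i
      have hiff := P.lt_Req_iff hρ (le_of_lt (mem_Ioi.1 hr))
      by_cases h : P.ReqInv ρ < r
      · simp only [ψN, if_pos (hiff.2 h), if_pos h]
        rw [P.lintegral_one_sub_expNeg_gamma (P.argN_nonneg hr ht (P.d_nonneg i)), P.FN_eq hr]
      · have h' : ¬ ρ < P.Req r := fun h' => h (hiff.1 h')
        simp [ψN, if_neg h, if_neg h']
    have hcongr : ∀ r ∈ Ioi (0 : ℝ), ENNReal.ofReal (2 * Real.pi * P.lamM * r) *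
        ∑ i, ENNReal.ofReal (P.p i) *
          (ENNReal.ofReal (P.probL r) * ∫⁻ h, ψL r (P.d i) h ∂(gammaMeasure P.m P.m) +
            ENNReal.ofReal (P.probN r) * ∫⁻ h, ψN r (P.d i) h ∂(gammaMeasure P.m P.m)) =
        ∑ i, (ENNReal.ofReal (2 * Real.pi * P.lamM * r) * (ENNReal.ofReal (P.p i) *
          (ENNReal.ofReal (P.probL r) * if ρ < r then ENNReal.ofReal (P.FL t r (P.d i)) else 0)) +
          ENNReal.ofReal (2 * Real.pi * P.lamM * r) * (ENNReal.ofReal (P.p i) *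
          (ENNReal.ofReal (P.probN r) *
            if P.ReqInv ρ < r then ENNReal.ofReal (P.FN t r (P.d i)) else 0))) := by
      intro r hr
      rw [Finset.mul_sum]
      refine Finset.sum_congr rfl fun i _ => ?_
      rw [hLi r hr, hNi r hr]
      ring
    have hmL : ∀ i, Measurable fun r => ENNReal.ofReal (2 * Real.pi * P.lamM * r) *
        (ENNReal.ofReal (P.p i) *
          (ENNReal.ofReal (P.probL r) * if ρ < r then ENNReal.ofReal (P.FL t r (P.d i)) else 0)) := by
      intro i
      refine Measurable.mul (by fun_prop) (Measurable.const_mul (Measurable.mul (by fun_prop) ?_) _)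
      exact Measurable.ite (measurableSet_lt measurable_const measurable_id)
        (P.measurable_FL t _).ennreal_ofReal measurable_const
    have hmN : ∀ i, Measurable fun r => ENNReal.ofReal (2 * Real.pi * P.lamM * r) *
        (ENNReal.ofReal (P.p i) * (ENNReal.ofReal (P.probN r) *
            if P.ReqInv ρ < r then ENNReal.ofReal (P.FN t r (P.d i)) else 0)) := by
      intro i
      refine Measurable.mul (by fun_prop) (Measurable.const_mul (Measurable.mul (by fun_prop) ?_) _)
      exact Measurable.ite (measurableSet_lt measurable_const measurable_id)
        (P.measurable_FN t _).ennreal_ofReal measurable_const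
    rw [setLIntegral_congr_fun measurableSet_Ioi hcongr,
      lintegral_finsetSum _ (by intro i _; exact (hmL i).add (hmN i)), macroExponent,
      ENNReal.ofReal_sum_of_nonneg]
    · refine Finset.sum_congr rfl fun i _ => ?_
      rw [lintegral_add_left (hmL i),
        lintegral_Ioi_cutoff P.pi_lamM_pos.le (P.p_nonneg i) hρ.le
          (fun r hr => P.FL_nonneg hr ht (P.d_nonneg i)) (fun r _ => (P.probL_pos r).le)
          (P.integrableOn_FL hρ.le ht (P.d_nonneg i)),
        lintegral_Ioi_cutoff P.pi_lamM_pos.le (P.p_nonneg i) (P.ReqInv_pos hρ).le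
          (fun r hr => P.FN_nonneg hr ht (P.d_nonneg i)) (fun r hr => P.probN_nonneg hr.le)
          (P.integrableOn_FN (P.ReqInv_pos hρ) ht (P.d_nonneg i)), ← ENNReal.ofReal_add]
      · rfl
      · refine mul_nonneg (P.Ci_nonneg i) (setIntegral_nonneg measurableSet_Ioi fun x hx => ?_)
        have hx' : 0 < x := hρ.trans hx
        exact mul_nonneg (mul_nonneg (P.FL_nonneg hx' ht (P.d_nonneg i)) hx'.le) (P.probL_pos x).le
      · refine mul_nonneg (P.Ci_nonneg i) (setIntegral_nonneg measurableSet_Ioi fun x hx => ?_)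
        have hx' : 0 < x := (P.ReqInv_pos hρ).trans hx
        exact mul_nonneg (mul_nonneg (P.FN_nonneg hx' ht (P.d_nonneg i)) hx'.le)
          (P.probN_nonneg hx'.le)
    · intro i _
      refine add_nonneg (mul_nonneg (P.Ci_nonneg i) ?_) (mul_nonneg (P.Ci_nonneg i) ?_)
      · refine setIntegral_nonneg measurableSet_Ioi fun x hx => ?_
        have hx' : 0 < x := hρ.trans hx
        exact mul_nonneg (mul_nonneg (P.FL_nonneg hx' ht (P.d_nonneg i)) hx'.le) (P.probL_pos x).le
      · refine setIntegral_nonneg measurableSet_Ioi fun x hx => ?_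
        have hx' : 0 < x := (P.ReqInv_pos hρ).trans hx
        exact mul_nonneg (mul_nonneg (P.FN_nonneg hx' ht (P.d_nonneg i)) hx'.le)
          (P.probN_nonneg hx'.le)

lemma expNeg_beyond_damp {ρ t : ℝ} (hρ : 0 < ρ) (ht : 0 ≤ t) :
    expNeg (∫⁻ z, (1 - beyond P.eqDist (P.damp t) ρ z) ∂P.macroIntensity) =
      ENNReal.ofReal (Real.exp (-P.meanUpTo ρ) * P.laplaceMacro ρ t) := by
  rw [P.lintegral_one_sub_beyond_damp hρ ht, expNeg_ofReal
    (add_nonneg (P.meanUpTo_nonneg hρ.le) (P.macroExponent_nonneg hρ ht)), laplaceMacro_eq,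
    ← Real.exp_add, neg_add]

/-- At the positive radius `max r 1` the integrand of the previous formula equals 1 on this set. -/
lemma macroIntensity_eqDist_le_ne_top (r : ℝ) : P.macroIntensity {z | P.eqDist z ≤ r} ≠ ∞ := by
  have hm : 0 < max r 1 := lt_max_of_lt_right one_pos
  have h := P.lintegral_one_sub_beyond_damp hm le_rfl
  refine ne_top_of_le_ne_top (h ▸ ENNReal.ofReal_ne_top) ?_
  rw [← lintegral_indicator_one (measurableSet_le P.measurable_eqDist measurable_const)]
  refine lintegral_mono fun z => ?_
  by_cases hz : P.eqDist z ≤ r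
  · rw [beyond_of_le (hz.trans (le_max_left _ _))]
    simp [hz]
  · simp [hz]

/-- Comparison with the function cut off at radius 1. The singular path loss near the origin does no
harm, because the integrand never exceeds 1. -/
lemma lintegral_one_sub_damp_ne_top {t : ℝ} (ht : 0 ≤ t) :
    ∫⁻ z, (1 - P.damp t z) ∂P.macroIntensity ≠ ∞ := by
  refine ne_top_of_le_ne_top (P.lintegral_one_sub_beyond_damp one_pos ht ▸ ENNReal.ofReal_ne_top)
    (lintegral_mono fun z => tsub_le_tsub_left ?_ _)
  exact indicator_le_self _ _ z

/-- Gains and fadings are arbitrary real marks; only their laws make them nonnegative. The indicator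
of `min D h < 0` has integral 0. -/
lemma ae_power_nonneg : ∀ᵐ z ∂P.macroIntensity, 0 ≤ P.power z := by
  have h := P.lintegral_macroIntensity
    (ψL := fun _ D h => if 0 ≤ min D h then 0 else 1)
    (ψN := fun _ D h => if 0 ≤ min D h then 0 else 1)
    (Measurable.ite (measurableSet_le measurable_const (by fun_prop)) measurable_const
      measurable_const)
    (Measurable.ite (measurableSet_le measurable_const (by fun_prop)) measurable_const
      measurable_const)
  have hg : ∀ i, ∫⁻ h, (if 0 ≤ min (P.d i) h then 0 else 1) ∂(gammaMeasure P.m P.m) =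
      (0 : ℝ≥0∞) := by
    intro i
    rw [lintegral_gammaMeasure, setLIntegral_congr_fun measurableSet_Ioi (g := fun _ => 0)]
    · simp
    · intro r hr
      have : (0 : ℝ) ≤ r := le_of_lt hr
      simp [this, P.d_nonneg i]
  simp only [hg, mul_zero, add_zero, Finset.sum_const_zero, lintegral_zero, ite_self] at h
  rw [lintegral_eq_zero_iff (Measurable.ite (measurableSet_le measurable_const (by fun_prop)) measurable_const
    measurable_const)] at h
  filter_upwards [h] with z hz
  have hz' : 0 ≤ z.2.2.1 ∧ 0 ≤ z.2.2.2 := by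
    by_contra hn
    rw [← le_min_iff] at hn
    simp only [if_neg hn, Pi.zero_apply, one_ne_zero] at hz
  have h1 : 0 ≤ P.loss z := by
    unfold loss
    split_ifs
    · exact P.lossL_nonneg (norm_nonneg _)
    · exact P.lossN_nonneg (norm_nonneg _)
  have h2 := P.Pm_pos
  have h3 := P.G_pos ‖z.1‖
  have h4 := hz'.1
  have h5 := hz'.2
  unfold power
  positivity

/-! ### The femto base stations -/

/-- The intensity measure of the marked active FBSs. -/
def femtoIntensity : Measure (Plane × (ℝ × ℂ)) :=
  (homogeneousIntensity P.lamF').prod P.femtoMarkLaw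

/-- The interfering power of a marked FBS. -/
def femtoPower (y : Plane × (ℝ × ℂ)) : ℝ :=
  P.Pf * P.ellW * P.lossN ‖y.1‖ * y.2.1 * ‖y.2.2‖ ^ 2

@[fun_prop] lemma measurable_femtoPower : Measurable P.femtoPower := by
  unfold femtoPower; fun_prop

lemma lamF'_pos : 0 < P.lamF' := mul_pos P.lamF_pos (Real.exp_pos _)

lemma lintegral_femtoIntensity {ψ : ℝ → ℝ → ℂ → ℝ≥0∞}
    (hψ : Measurable fun p : ℝ × ℝ × ℂ => ψ p.1 p.2.1 p.2.2) :
    ∫⁻ y, ψ ‖y.1‖ y.2.1 y.2.2 ∂P.femtoIntensity =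
      ∫⁻ r in Ioi (0 : ℝ), ENNReal.ofReal (2 * Real.pi * P.lamF' * r) *
        ∑ i, ENNReal.ofReal (P.pfm i) * ∫⁻ g, ψ r (P.dfm i) g ∂complexGaussian := by
  have hm' : Measurable fun y : Plane × (ℝ × ℂ) => ψ ‖y.1‖ y.2.1 y.2.2 :=
    hψ.comp (by fun_prop : Measurable fun y : Plane × (ℝ × ℂ) => (‖y.1‖, y.2))
  rw [femtoIntensity, lintegral_prod _ hm'.aemeasurable, homogeneousIntensity,
    lintegral_smul_measure,
    lintegral_norm_plane (F := fun r => ∫⁻ k, ψ r k.1 k.2 ∂P.femtoMarkLaw) hψ.lintegral_prod_right',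
    smul_eq_mul, ← lintegral_const_mul' _ _ ENNReal.ofReal_ne_top]
  refine setLIntegral_congr_fun measurableSet_Ioi fun r hr => ?_
  rw [← mul_assoc, ← ENNReal.ofReal_mul P.lamF'_pos.le, show P.lamF' * (2 * Real.pi * r) =
    2 * Real.pi * P.lamF' * r by ring]
  congr 1
  rw [femtoMarkLaw, lintegral_prod (fun k : ℝ × ℂ => ψ r k.1 k.2)
    (hψ.comp (by fun_prop : Measurable fun k : ℝ × ℂ => (r, k))).aemeasurable, lintegral_gainLaw]

lemma ae_femtoPower_nonneg : ∀ᵐ y ∂P.femtoIntensity, 0 ≤ P.femtoPower y := by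
  have hm : MeasurableSet {p : ℝ × ℝ × ℂ | 0 ≤ p.2.1} :=
    measurableSet_le measurable_const (by fun_prop)
  have h := P.lintegral_femtoIntensity
    (ψ := fun _ D _ => if 0 ≤ D then 0 else 1)
    (Measurable.ite hm measurable_const measurable_const)
  simp only [P.dfm_nonneg, if_true, lintegral_zero, mul_zero, Finset.sum_const_zero] at h
  rw [lintegral_eq_zero_iff (Measurable.ite (measurableSet_le measurable_const (by fun_prop))
    measurable_const measurable_const)] at h
  filter_upwards [h] with y hy
  have hy' : 0 ≤ y.2.1 := by
    by_contra hn
    simp [hn] at hy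
  have h1 := P.lossN_nonneg (norm_nonneg y.1)
  have h2 := P.Pf_pos
  have h3 := P.ellW_pos
  unfold femtoPower
  positivity

/-- The exponent of `laplaceFemto`. -/
def femtoExponent (t : ℝ) : ℝ :=
  ∑ i, P.Cif i * (t * P.Pf * P.ellW * P.CN * P.dfm i) ^ (2 / P.alphaN) *
    (Real.pi / (P.alphaN * Real.sin (2 * Real.pi / P.alphaN)))

lemma laplaceFemto_eq (t : ℝ) : P.laplaceFemto t = Real.exp (-P.femtoExponent t) := by
  rw [laplaceFemto, ← Real.exp_sum, femtoExponent]
  simp only [neg_mul, Finset.sum_neg_distrib]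

lemma femtoExponent_summand_nonneg {t : ℝ} (ht : 0 ≤ t) (i : Fin 4) :
    0 ≤ P.Cif i * (t * P.Pf * P.ellW * P.CN * P.dfm i) ^ (2 / P.alphaN) *
      (Real.pi / (P.alphaN * Real.sin (2 * Real.pi / P.alphaN))) := by
  have h1 := P.Pf_pos; have h2 := P.ellW_pos; have h3 := P.CN_pos; have h4 := P.dfm_nonneg i
  have h5 := P.pfm_nonneg i; have h6 := P.lamF'_pos; have h7 := P.alphaN_pos; have h8 := Real.pi_pos
  have h9 : 0 < Real.sin (2 * Real.pi / P.alphaN) := by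
    refine Real.sin_pos_of_pos_of_lt_pi (by positivity) ?_
    rw [div_lt_iff₀ h7]
    nlinarith [P.two_lt_alphaN]
  unfold Cif
  positivity

/-- Averaging over the fading gives `1 / (1 + a)` with `a` proportional to `r^{-α_N}`, so the radial
integral is that of `lintegral_mul_one_sub_inv`. -/
lemma lintegral_one_sub_expNeg_femtoPower {t : ℝ} (ht : 0 ≤ t) :
    ∫⁻ y, (1 - expNeg (ENNReal.ofReal (t * P.femtoPower y))) ∂P.femtoIntensity =
      ENNReal.ofReal (P.femtoExponent t) := by
  have h1 := P.Pf_pos; have h2 := P.ellW_pos; have h3 := P.CN_pos; have h6 := P.lamF'_pos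
  have h := P.lintegral_femtoIntensity (ψ := fun r D g => 1 - expNeg (ENNReal.ofReal
    (t * P.Pf * P.ellW * P.lossN r * D * ‖g‖ ^ 2)))
    (measurable_const.sub (measurable_expNeg.comp (by fun_prop)))
  have h0 : ∀ y, 1 - expNeg (ENNReal.ofReal (t * P.femtoPower y)) = 1 - expNeg (ENNReal.ofReal
      (t * P.Pf * P.ellW * P.lossN ‖y.1‖ * y.2.1 * ‖y.2.2‖ ^ 2)) := by
    intro y
    rw [femtoPower]
    congr 3
    ring
  simp_rw [h0]
  rw [h]
  have hcongr : ∀ r ∈ Ioi (0 : ℝ), ENNReal.ofReal (2 * Real.pi * P.lamF' * r) *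
      ∑ i, ENNReal.ofReal (P.pfm i) * ∫⁻ g, (1 - expNeg (ENNReal.ofReal
        (t * P.Pf * P.ellW * P.lossN r * P.dfm i * ‖g‖ ^ 2))) ∂complexGaussian =
      ∑ i, ENNReal.ofReal (P.Cif i) * ENNReal.ofReal (r *
        (1 - 1 / (1 + (t * P.Pf * P.ellW * P.CN * P.dfm i) * r ^ (-P.alphaN)))) := by
    intro r hr
    have hr' : (0 : ℝ) < r := hr
    rw [Finset.mul_sum]
    refine Finset.sum_congr rfl fun i _ => ?_
    have hd := P.dfm_nonneg i
    have hp := P.pfm_nonneg i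
    have hl := P.lossN_nonneg hr'.le
    have hpi := Real.pi_pos
    have ha : 0 ≤ t * P.Pf * P.ellW * P.lossN r * P.dfm i := by positivity
    have hm : Measurable fun g : ℂ => expNeg (ENNReal.ofReal
        (t * P.Pf * P.ellW * P.lossN r * P.dfm i * ‖g‖ ^ 2)) :=
      measurable_expNeg.comp (by fun_prop)
    have hone : 0 ≤ 1 - 1 / (1 + t * P.Pf * P.ellW * P.lossN r * P.dfm i) := by
      simpa using one_sub_inv_pow_nonneg ha 1
    rw [lintegral_sub hm (by rw [lintegral_expNeg_complexGaussian ha]; exact ENNReal.ofReal_ne_top)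
      (ae_of_all _ fun h => expNeg_le_one _), lintegral_expNeg_complexGaussian ha, lintegral_one,
      measure_univ, ← ENNReal.ofReal_one, ← ENNReal.ofReal_sub _ (by positivity),
      ← ENNReal.ofReal_mul hp, ← ENNReal.ofReal_mul (by positivity),
      ← ENNReal.ofReal_mul (by unfold Cif; positivity)]
    congr 1
    rw [Cif, lossN, show t * P.Pf * P.ellW * (P.CN * r ^ (-P.alphaN)) * P.dfm i =
      t * P.Pf * P.ellW * P.CN * P.dfm i * r ^ (-P.alphaN) by ring]
    ring
  rw [setLIntegral_congr_fun measurableSet_Ioi hcongr, lintegral_finsetSum _ (by fun_prop),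
    femtoExponent, ENNReal.ofReal_sum_of_nonneg fun i _ => P.femtoExponent_summand_nonneg ht i]
  refine Finset.sum_congr rfl fun i _ => ?_
  have hd := P.dfm_nonneg i
  have hp := P.pfm_nonneg i
  have hpi := Real.pi_pos
  rw [lintegral_const_mul _ (by fun_prop), lintegral_mul_one_sub_inv P.two_lt_alphaN (by positivity),
    ← ENNReal.ofReal_mul (by unfold Cif; positivity), ← mul_assoc (P.Cif i)]

lemma expNeg_femtoPower {t : ℝ} (ht : 0 ≤ t) :
    expNeg (∫⁻ y, (1 - expNeg (ENNReal.ofReal (t * P.femtoPower y))) ∂P.femtoIntensity) =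
      ENNReal.ofReal (P.laplaceFemto t) := by
  have h0 : 0 ≤ P.femtoExponent t :=
    Finset.sum_nonneg fun i _ => P.femtoExponent_summand_nonneg ht i
  rw [P.lintegral_one_sub_expNeg_femtoPower ht, expNeg_ofReal h0, laplaceFemto_eq]

end HetNetParams

/-! ### The nearest station of a configuration -/

section Nearest

variable {S : Type*} [MeasurableSpace S] {e : S → ℝ}

/-- The index is `n` iff `n` is a minimiser and no smaller index is. Without a minimiser `sInf ∅ =
0`, which adds an extra piece to the fibre over 0. -/
lemma measurable_nearest (he : Measurable e) :
    Measurable fun z : ℕ → S => sInf {j | ∀ i, e (z j) ≤ e (z i)} := by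
  have hS : ∀ j, MeasurableSet {z : ℕ → S | ∀ i, e (z j) ≤ e (z i)} := fun j => by
    simp only [ofPred_forall]
    exact MeasurableSet.iInter fun i => measurableSet_le (by fun_prop) (by fun_prop)
  refine measurable_to_countable' fun n => ?_
  have h : (fun z : ℕ → S => sInf {j | ∀ i, e (z j) ≤ e (z i)}) ⁻¹' {n} =
      ({z | ∀ i, e (z n) ≤ e (z i)} ∩ ⋂ k ∈ Iio n, {z | ∀ i, e (z k) ≤ e (z i)}ᶜ) ∪
      ((⋂ k, {z | ∀ i, e (z k) ≤ e (z i)}ᶜ) ∩ {_z | n = 0}) := by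
    ext z
    simp only [mem_preimage, mem_singleton_iff, mem_union, mem_inter_iff, mem_iInter, mem_compl_iff,
      mem_Iio, mem_ofPred_eq]
    by_cases hne : {j | ∀ i, e (z j) ≤ e (z i)}.Nonempty
    · have hmem := Nat.sInf_mem hne
      constructor
      · intro h
        left
        rw [h] at hmem
        refine ⟨hmem, fun k hk hk' => ?_⟩
        have hle : sInf {j | ∀ i, e (z j) ≤ e (z i)} ≤ k := Nat.sInf_le hk'
        exact absurd hle (by rw [h]; exact not_le.2 hk)
      · rintro (⟨h1, h2⟩ | ⟨h1, -⟩)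
        · refine le_antisymm (Nat.sInf_le h1) ?_
          by_contra hlt
          exact h2 _ (not_le.1 hlt) hmem
        · exact absurd hmem (h1 _)
    · rw [not_nonempty_iff_eq_empty] at hne
      have hno : ∀ k, ¬ ∀ i, e (z k) ≤ e (z i) := fun k hk => by
        have : k ∈ {j | ∀ i, e (z j) ≤ e (z i)} := hk
        rw [hne] at this
        exact this
      rw [hne, Nat.sInf_empty]
      constructor
      · intro h
        exact Or.inr ⟨hno, h.symm⟩
      · rintro (⟨h1, -⟩ | ⟨-, h2⟩)
        · exact absurd h1 (hno n)
        · exact h2.symm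
  rw [h]
  refine ((hS n).inter ?_).union ((MeasurableSet.iInter fun k => (hS k).compl).inter
    (MeasurableSet.const _))
  exact MeasurableSet.iInter fun k => MeasurableSet.iInter fun _ => (hS k).compl

end Nearest

namespace HetNetParams
open Filter Topology

variable (P : HetNetParams)

lemma laplaceMacro_zero (ρ : ℝ) : P.laplaceMacro ρ 0 = 1 := by
  simp [laplaceMacro, FL, FN]

end HetNetParams

/-! ### The network as a pair of independent marked Poisson processes -/

namespace HetNet
open Filter Topology

variable {P : HetNetParams} {Ω : Type*} [MeasurableSpace Ω] {μ : Measure Ω} (N : HetNet P μ)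

/-- The MBSs with their marks. -/
def macroPoint (ω : Ω) (j : ℕ) : Plane × (ℝ × ℝ × ℝ) := (N.X ω j, (N.U ω j, N.D ω j, N.hpow ω j))

/-- The active FBSs with their marks. -/
def femtoPoint (ω : Ω) (j : ℕ) : Plane × (ℝ × ℂ) := (N.Y ω j, (N.Dfm ω j, N.g ω j))

lemma equivDist_eq (ω : Ω) (j : ℕ) : N.equivDist ω j = P.eqDist (N.macroPoint ω j) := by
  unfold equivDist HetNetParams.eqDist IsLOS macroPoint
  split_ifs <;> rfl

lemma pathLoss_eq (ω : Ω) (j : ℕ) : N.pathLoss ω j = P.loss (N.macroPoint ω j) := by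
  unfold pathLoss HetNetParams.loss IsLOS macroPoint
  split_ifs <;> rfl

lemma macroTerm_eq (ω : Ω) (j : ℕ) :
    N.macroTerm ω j = if j = N.serving ω then 0 else P.power (N.macroPoint ω j) := by
  rw [macroTerm, pathLoss_eq]
  rfl

lemma femtoTerm_eq (ω : Ω) (j : ℕ) : N.femtoTerm ω j = P.femtoPower (N.femtoPoint ω j) := rfl

lemma measurable_macroMarks : Measurable fun ω => fun j => (N.U ω j, N.D ω j, N.hpow ω j) :=
  measurable_pi_lambda _ fun j => ((measurable_pi_apply j).comp N.measurable_U).prodMk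
    (((measurable_pi_apply j).comp N.measurable_D).prodMk
      ((measurable_pi_apply j).comp N.measurable_hpow))

lemma measurable_femtoMarks : Measurable fun ω => fun j => (N.Dfm ω j, N.g ω j) :=
  measurable_pi_lambda _ fun j => ((measurable_pi_apply j).comp N.measurable_Dfm).prodMk
    ((measurable_pi_apply j).comp N.measurable_g)

lemma measurable_macroPair :
    Measurable fun ω => (N.X ω, fun j => (N.U ω j, N.D ω j, N.hpow ω j)) :=
  N.isPoissonPP_X.measurable.prodMk N.measurable_macroMarks

lemma measurable_femtoPair : Measurable fun ω => (N.Y ω, fun j => (N.Dfm ω j, N.g ω j)) :=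
  N.isPoissonPP_Y.measurable.prodMk N.measurable_femtoMarks

lemma measurable_macroPoint (j : ℕ) : Measurable fun ω => N.macroPoint ω j :=
  ((measurable_pi_apply j).comp N.isPoissonPP_X.measurable).prodMk
    ((measurable_pi_apply j).comp N.measurable_macroMarks)

lemma measurable_femtoPoint (j : ℕ) : Measurable fun ω => N.femtoPoint ω j :=
  ((measurable_pi_apply j).comp N.isPoissonPP_Y.measurable).prodMk
    ((measurable_pi_apply j).comp N.measurable_femtoMarks)

lemma measurable_equivDist (j : ℕ) : Measurable fun ω => N.equivDist ω j := by
  simp only [equivDist_eq]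
  exact P.measurable_eqDist.comp (N.measurable_macroPoint j)

lemma measurable_serving : Measurable N.serving := by
  have h : N.serving = (fun z : ℕ → _ => sInf {j | ∀ i, P.eqDist (z j) ≤ P.eqDist (z i)}) ∘
      N.macroPoint := by
    ext ω
    simp only [serving, equivDist_eq, Function.comp_apply]
  rw [h]
  exact (measurable_nearest P.measurable_eqDist).comp
    (measurable_pi_lambda _ N.measurable_macroPoint)

lemma measurable_at_serving {β : Type*} [MeasurableSpace β] {f : Ω → ℕ → β}
    (hf : ∀ j, Measurable fun ω => f ω j) : Measurable fun ω => f ω (N.serving ω) := by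
  have : Measurable fun p : Ω × ℕ => f p.1 p.2 := measurable_from_prod_countable_left hf
  exact this.comp (measurable_id.prodMk N.measurable_serving)

lemma measurable_R : Measurable N.R := N.measurable_at_serving N.measurable_equivDist

/-- The fading power of the serving MBS. -/
def servingFading (ω : Ω) : ℝ := N.hpow ω (N.serving ω)

lemma measurable_servingFading : Measurable N.servingFading :=
  N.measurable_at_serving fun j => (measurable_pi_apply j).comp N.measurable_hpow

/-- The interference of the MBSs, as an extended nonnegative number. -/
def macroSum (ω : Ω) : ℝ≥0∞ := ∑' j, ENNReal.ofReal (N.macroTerm ω j)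

/-- The interference of the FBSs, as an extended nonnegative number. -/
def femtoSum (ω : Ω) : ℝ≥0∞ := ∑' j, ENNReal.ofReal (N.femtoTerm ω j)

lemma measurable_macroTerm (j : ℕ) : Measurable fun ω => N.macroTerm ω j := by
  simp only [macroTerm_eq]
  exact Measurable.ite (measurableSet_eq_fun measurable_const N.measurable_serving) measurable_const
    (P.measurable_power.comp (N.measurable_macroPoint j))

lemma measurable_macroSum : Measurable N.macroSum :=
  Measurable.tsum fun j => (N.measurable_macroTerm j).ennreal_ofReal

lemma measurable_femtoSum : Measurable N.femtoSum := by
  refine Measurable.tsum fun j => ?_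
  simp only [femtoTerm_eq]
  exact (P.measurable_femtoPower.comp (N.measurable_femtoPoint j)).ennreal_ofReal

variable [IsProbabilityMeasure μ]

instance : IsProbabilityMeasure (μ.map N.X) :=
  Measure.isProbabilityMeasure_map N.isPoissonPP_X.measurable.aemeasurable

instance : IsProbabilityMeasure (μ.map N.Y) :=
  Measure.isProbabilityMeasure_map N.isPoissonPP_Y.measurable.aemeasurable

lemma macro_law : μ.map (fun ω => (N.X ω, fun j => (N.U ω j, N.D ω j, N.hpow ω j))) =
    (μ.map N.X).prod (Measure.infinitePi fun _ : ℕ => P.macroMarkLaw) := by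
  have h := congrArg (Measure.map Prod.fst) N.joint_law
  rw [Measure.map_map measurable_fst (N.measurable_macroPair.prodMk N.measurable_femtoPair),
    Measure.map_fst_prod] at h
  simpa [Function.comp_def] using h

lemma femto_law : μ.map (fun ω => (N.Y ω, fun j => (N.Dfm ω j, N.g ω j))) =
    (μ.map N.Y).prod (Measure.infinitePi fun _ : ℕ => P.femtoMarkLaw) := by
  have h := congrArg (Measure.map Prod.snd) N.joint_law
  rw [Measure.map_map measurable_snd (N.measurable_macroPair.prodMk N.measurable_femtoPair),
    Measure.map_snd_prod] at h
  simpa [Function.comp_def] using h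

lemma indepFun_macro_femto : IndepFun (fun ω => (N.X ω, fun j => (N.U ω j, N.D ω j, N.hpow ω j)))
    (fun ω => (N.Y ω, fun j => (N.Dfm ω j, N.g ω j))) μ := by
  rw [indepFun_iff_map_prod_eq_prod_map_map N.measurable_macroPair.aemeasurable
    N.measurable_femtoPair.aemeasurable, N.macro_law, N.femto_law]
  exact N.joint_law

lemma hasPoissonLaplace_macroPoint : HasPoissonLaplace μ N.macroPoint P.macroIntensity :=
  N.isPoissonPP_X.hasPoissonLaplace_marked N.measurable_macroMarks P.macroMarkLaw N.macro_law

lemma hasPoissonLaplace_femtoPoint : HasPoissonLaplace μ N.femtoPoint P.femtoIntensity :=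
  N.isPoissonPP_Y.hasPoissonLaplace_marked N.measurable_femtoMarks P.femtoMarkLaw N.femto_law

/-! ### Almost sure properties -/

lemma ae_power_nonneg : ∀ᵐ ω ∂μ, ∀ j, 0 ≤ P.power (N.macroPoint ω j) :=
  N.hasPoissonLaplace_macroPoint.ae_forall
    (measurableSet_le measurable_const P.measurable_power) P.ae_power_nonneg

lemma ae_femtoTerm_nonneg : ∀ᵐ ω ∂μ, ∀ j, 0 ≤ N.femtoTerm ω j :=
  N.hasPoissonLaplace_femtoPoint.ae_forall
    (measurableSet_le measurable_const P.measurable_femtoPower) P.ae_femtoPower_nonneg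

lemma ae_tsum_power_ne_top : ∀ᵐ ω ∂μ, ∑' j, ENNReal.ofReal (P.power (N.macroPoint ω j)) ≠ ∞ := by
  refine N.hasPoissonLaplace_macroPoint.ae_tsum_ne_top (t := fun z => ENNReal.ofReal (P.power z))
    (by fun_prop) (ae_of_all _ fun z => ENNReal.ofReal_ne_top) ?_
  simpa [HetNetParams.damp] using P.lintegral_one_sub_damp_ne_top zero_le_one

lemma ae_femtoSum_ne_top : ∀ᵐ ω ∂μ, N.femtoSum ω ≠ ∞ := by
  refine N.hasPoissonLaplace_femtoPoint.ae_tsum_ne_top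
    (t := fun z => ENNReal.ofReal (P.femtoPower z))
    (by fun_prop) (ae_of_all _ fun z => ENNReal.ofReal_ne_top) ?_
  have h := P.lintegral_one_sub_expNeg_femtoPower zero_le_one
  simp only [one_mul] at h
  rw [h]
  exact ENNReal.ofReal_ne_top

/-- Almost surely all other MBSs are farther than the serving one. -/
lemma ae_serving_lt : ∀ᵐ ω ∂μ, ∀ i, i ≠ N.serving ω →
    N.equivDist ω (N.serving ω) < N.equivDist ω i := by
  have hZ := N.hasPoissonLaplace_macroPoint
  have hw : Measurable fun _ : Plane × (ℝ × ℝ × ℝ) => (1 : ℝ≥0∞) := measurable_const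
  -- At `t = 0` the damping factor is 1, so `F ω j` is the indicator that station `j` is strictly
  -- nearer than all others.
  set F : Ω → ℕ → ℝ≥0∞ := fun ω j => ∏' i, (if i = j then 1 else
    beyond P.eqDist (P.damp 0) (P.eqDist (N.macroPoint ω j)) (N.macroPoint ω i)) with hF
  have hF1 : ∀ ω j i, (if i = j then 1 else
      beyond P.eqDist (P.damp 0) (P.eqDist (N.macroPoint ω j)) (N.macroPoint ω i)) ≤ 1 := by
    intro ω j i
    split_ifs
    · exact le_rfl
    · exact beyond_le_one (P.damp_le_one 0) _ _
  have hlt : ∀ ω j, F ω j ≠ 0 → ∀ i ≠ j, N.equivDist ω j < N.equivDist ω i := by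
    intro ω j h i hi
    by_contra hn
    rw [equivDist_eq, equivDist_eq] at hn
    refine h (ENNReal.tprod_eq_zero (hF1 ω j) (i := i) ?_)
    rw [if_neg hi, beyond_of_le (not_lt.1 hn)]
  have hsum1 : ∀ ω, ∑' j, F ω j ≤ 1 := by
    intro ω
    by_cases h : ∃ j, F ω j ≠ 0
    · obtain ⟨j, hj⟩ := h
      rw [tsum_eq_single j]
      · exact ENNReal.tprod_le_one (hF1 ω j)
      · intro k hk
        by_contra hk0
        exact lt_asymm (hlt ω j hj k hk) (hlt ω k hk0 j hk.symm)
    · push Not at h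
      simp [h]
  -- The mean number of strictly nearest stations is `∫ f_R = 1`. Since this number is at most 1, it
  -- equals 1 almost surely.
  have hint : ∫⁻ ω, ∑' j, F ω j ∂μ = 1 := by
    have h := hZ.lintegral_tsum_nearest P.measurable_eqDist P.macroIntensity_eqDist_le_ne_top
      (u := fun _ => 1) measurable_const (fun _ => le_rfl) (P.measurable_damp 0) (P.damp_le_one 0)
    simp only [one_mul] at h
    rw [h]
    set k : ℝ → ℝ≥0∞ := fun r =>
      expNeg (∫⁻ z, (1 - beyond P.eqDist (P.damp 0) r z) ∂P.macroIntensity) with hk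
    have hkm : Measurable k := by
      refine Antitone.measurable fun r r' hr => expNeg_antitone
        (lintegral_mono fun z => tsub_le_tsub_left (beyond_antitone _ _ z hr) _)
    have h2 := P.lintegral_eqDist_fading hkm (φ := fun _ => 1) measurable_const
    simp only [mul_one, lintegral_const, measure_univ, one_mul] at h2
    refine h2.trans ?_
    rw [← P.lintegral_fR]
    refine setLIntegral_congr_fun measurableSet_Ioi fun r hr => ?_
    simp only [hk]
    rw [P.expNeg_beyond_damp hr le_rfl, P.laplaceMacro_zero, mul_one,
      ← ENNReal.ofReal_mul (P.distDensity_nonneg hr), P.fR_eq]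
  have hae : (fun ω => ∑' j, F ω j) =ᵐ[μ] fun _ => 1 := by
    refine ae_eq_of_ae_le_of_lintegral_le (ae_of_all _ hsum1) (by simp [hint]) (by fun_prop)
      (by simp [hint])
  filter_upwards [hae] with ω hω
  have hex : ∃ j, F ω j ≠ 0 := by
    by_contra hn
    push Not at hn
    simp [hn] at hω
  obtain ⟨j, hj⟩ := hex
  have hj' := hlt ω j hj
  have hset : {j | ∀ i, N.equivDist ω j ≤ N.equivDist ω i} = {j} := by
    ext k
    simp only [mem_ofPred_eq, mem_singleton_iff]
    constructor
    · intro h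
      by_contra hk
      exact absurd (h j) (not_le.2 (hj' k hk))
    · rintro rfl i
      rcases eq_or_ne i k with rfl | hi
      · exact le_rfl
      · exact (hj' i hi).le
  have hserv : N.serving ω = j := by rw [serving, hset]; simp
  rw [hserv]
  exact hj'

lemma ae_macroTerm_nonneg : ∀ᵐ ω ∂μ, ∀ j, 0 ≤ N.macroTerm ω j := by
  filter_upwards [N.ae_power_nonneg] with ω hω j
  rw [macroTerm_eq]
  split_ifs
  · exact le_rfl
  · exact hω j

lemma ae_macroSum_ne_top : ∀ᵐ ω ∂μ, N.macroSum ω ≠ ∞ := by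
  filter_upwards [N.ae_tsum_power_ne_top] with ω hω
  refine ne_top_of_le_ne_top hω (ENNReal.tsum_le_tsum fun j => ?_)
  rw [macroTerm_eq]
  split_ifs
  · simp
  · exact le_rfl

lemma summable_of_tsum_ofReal_ne_top {f : ℕ → ℝ} (hf : ∀ j, 0 ≤ f j)
    (h : ∑' j, ENNReal.ofReal (f j) ≠ ∞) : Summable f := by
  have := ENNReal.summable_toReal h
  refine this.congr fun j => ?_
  rw [ENNReal.toReal_ofReal (hf j)]

lemma ae_summable_macroTerm : ∀ᵐ ω ∂μ, Summable (N.macroTerm ω) := by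
  filter_upwards [N.ae_macroTerm_nonneg, N.ae_macroSum_ne_top] with ω h1 h2
  exact summable_of_tsum_ofReal_ne_top h1 h2

lemma ae_summable_femtoTerm : ∀ᵐ ω ∂μ, Summable (N.femtoTerm ω) := by
  filter_upwards [N.ae_femtoTerm_nonneg, N.ae_femtoSum_ne_top] with ω h1 h2
  exact summable_of_tsum_ofReal_ne_top h1 h2

lemma ae_macroSum_eq : ∀ᵐ ω ∂μ, 0 ≤ N.macroInterference ω ∧
    N.macroSum ω = ENNReal.ofReal (N.macroInterference ω) := by
  filter_upwards [N.ae_macroTerm_nonneg, N.ae_summable_macroTerm] with ω h1 h2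
  exact ⟨tsum_nonneg h1, (ENNReal.ofReal_tsum_of_nonneg h1 h2).symm⟩

lemma ae_femtoSum_eq : ∀ᵐ ω ∂μ, 0 ≤ N.femtoInterference ω ∧
    N.femtoSum ω = ENNReal.ofReal (N.femtoInterference ω) := by
  filter_upwards [N.ae_femtoTerm_nonneg, N.ae_summable_femtoTerm] with ω h1 h2
  exact ⟨tsum_nonneg h1, (ENNReal.ofReal_tsum_of_nonneg h1 h2).symm⟩

/-! ### Laplace transforms of the interferences -/

/-- The joint law of the serving distance, the serving fading and the interference of the other
MBSs, in terms of its Laplace transform. -/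
lemma lintegral_R_fading_macroSum {g ψ : ℝ → ℝ≥0∞} (hg : Measurable g) (hg1 : ∀ r, g r ≤ 1)
    (hψ : Measurable ψ) (hψ1 : ∀ h, ψ h ≤ 1) {t : ℝ} (ht : 0 ≤ t) :
    ∫⁻ ω, g (N.R ω) * ψ (N.servingFading ω) * expNeg (ENNReal.ofReal t * N.macroSum ω) ∂μ =
      (∫⁻ h, ψ h ∂(gammaMeasure P.m P.m)) * ∫⁻ r in Ioi (0 : ℝ),
        ENNReal.ofReal (P.fR r) * (g r * ENNReal.ofReal (P.laplaceMacro r t)) := by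
  have hZ := N.hasPoissonLaplace_macroPoint
  have hu : Measurable fun z : Plane × (ℝ × ℝ × ℝ) => g (P.eqDist z) * ψ z.2.2.2 := by fun_prop
  have h := hZ.lintegral_tsum_nearest P.measurable_eqDist P.macroIntensity_eqDist_le_ne_top hu
    (fun z => mul_le_one' (hg1 _) (hψ1 _)) (P.measurable_damp t) (P.damp_le_one t)
  set k : ℝ → ℝ≥0∞ := fun r =>
    expNeg (∫⁻ z, (1 - beyond P.eqDist (P.damp t) r z) ∂P.macroIntensity) with hk
  have hkm : Measurable k := Antitone.measurable fun r r' hr => expNeg_antitone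
    (lintegral_mono fun z => tsub_le_tsub_left (beyond_antitone _ _ z hr) _)
  have hR : ∫⁻ z, g (P.eqDist z) * ψ z.2.2.2 * k (P.eqDist z) ∂P.macroIntensity =
      (∫⁻ h, ψ h ∂(gammaMeasure P.m P.m)) * ∫⁻ r in Ioi (0 : ℝ),
        ENNReal.ofReal (P.fR r) * (g r * ENNReal.ofReal (P.laplaceMacro r t)) := by
    have h1 : ∀ z : Plane × (ℝ × ℝ × ℝ), g (P.eqDist z) * ψ z.2.2.2 * k (P.eqDist z) =
        (fun r => g r * k r) (P.eqDist z) * ψ z.2.2.2 := fun z => by simp only; ring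
    simp_rw [h1]
    rw [P.lintegral_eqDist_fading (g := fun r => g r * k r) (hg.mul hkm) hψ]
    congr 1
    refine setLIntegral_congr_fun measurableSet_Ioi fun r hr => ?_
    simp only [hk]
    rw [P.expNeg_beyond_damp hr ht, P.fR_eq, ENNReal.ofReal_mul (P.distDensity_nonneg hr),
      ENNReal.ofReal_mul (Real.exp_pos _).le]
    ring
  rw [← hR, ← h]
  refine lintegral_congr_ae ?_
  filter_upwards [N.ae_serving_lt] with ω hlt
  simp only [equivDist_eq] at hlt
  -- Only the serving index survives in the sum: for any other `j` the factor of the serving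
  -- station, which is nearer, is 0.
  rw [tsum_eq_single (N.serving ω)]
  · have hRω : N.R ω = P.eqDist (N.macroPoint ω (N.serving ω)) := N.equivDist_eq ω _
    rw [hRω]
    congr 1
    rw [macroSum, ← ENNReal.tsum_mul_left, ← ENNReal.tprod_expNeg]
    refine tprod_congr fun i => ?_
    rw [macroTerm_eq]
    by_cases hi : i = N.serving ω
    · simp [hi]
    · rw [if_neg hi, if_neg hi, beyond_of_lt (hlt i hi), HetNetParams.damp, ENNReal.ofReal_mul ht]
  · intro j hj
    rw [ENNReal.tprod_eq_zero (i := N.serving ω), mul_zero]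
    · intro i
      split_ifs
      · exact le_rfl
      · exact beyond_le_one (P.damp_le_one t) _ _
    · rw [if_neg hj.symm, beyond_of_le (hlt j hj).le]

/-- The joint transform at `t = 0`, with `ψ = 1` and `g` an indicator. -/
theorem map_R : μ.map N.R =
    (volume.restrict (Ioi 0)).withDensity (fun r => ENNReal.ofReal (P.fR r)) := by
  ext A hA
  have hm : Measurable (A.indicator fun _ => (1 : ℝ≥0∞)) := measurable_const.indicator hA
  have h := N.lintegral_R_fading_macroSum hm (fun r => indicator_le_self' (by simp) r)
    (ψ := fun _ => 1) measurable_const (fun _ => le_rfl) le_rfl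
  simp only [mul_one, ENNReal.ofReal_zero, zero_mul, expNeg_zero, P.laplaceMacro_zero,
    ENNReal.ofReal_one, lintegral_const, measure_univ, one_mul] at h
  have h1 : μ.map N.R A = ∫⁻ ω, A.indicator (fun _ => (1 : ℝ≥0∞)) (N.R ω) ∂μ := by
    rw [← lintegral_map hm N.measurable_R, lintegral_indicator_const hA, one_mul]
  rw [withDensity_apply _ hA, ← lintegral_indicator hA, h1]
  refine Eq.trans h (lintegral_congr fun r => ?_)
  by_cases hr : r ∈ A <;> simp [hr]

lemma ae_R_pos : ∀ᵐ ω ∂μ, 0 < N.R ω := by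
  have h : ∀ᵐ r ∂(μ.map N.R), 0 < r := by
    rw [N.map_R]
    exact (withDensity_absolutelyContinuous _ _).ae_le (ae_restrict_mem measurableSet_Ioi)
  exact ae_of_ae_map N.measurable_R.aemeasurable h

lemma aestronglyMeasurable_exp_macroInterference (t : ℝ) :
    AEStronglyMeasurable (fun ω => Real.exp (-t * N.macroInterference ω)) μ := by
  have h : Measurable fun ω => Real.exp (-t * (N.macroSum ω).toReal) := by
    have := N.measurable_macroSum
    fun_prop
  refine h.aestronglyMeasurable.congr ?_
  filter_upwards [N.ae_macroSum_eq] with ω hω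
  rw [hω.2, ENNReal.toReal_ofReal hω.1]

lemma integrable_exp_macroInterference {t : ℝ} (ht : 0 ≤ t) :
    Integrable (fun ω => Real.exp (-t * N.macroInterference ω)) μ := by
  refine Integrable.of_bound (N.aestronglyMeasurable_exp_macroInterference t) 1 ?_
  filter_upwards [N.ae_macroSum_eq] with ω hω
  rw [Real.norm_of_nonneg (Real.exp_pos _).le, Real.exp_le_one_iff]
  nlinarith [mul_nonneg ht hω.1]

lemma expNeg_macroSum_eq {t : ℝ} (ht : 0 ≤ t) : ∀ᵐ ω ∂μ,
    expNeg (ENNReal.ofReal t * N.macroSum ω) =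
      ENNReal.ofReal (Real.exp (-t * N.macroInterference ω)) := by
  filter_upwards [N.ae_macroSum_eq] with ω hω
  rw [hω.2, ← ENNReal.ofReal_mul ht, expNeg_ofReal (mul_nonneg ht hω.1), neg_mul]

/-- The sets of the σ-algebra generated by `R` are the events `R ∈ A`; on these the joint transform
with `g` the indicator of `A` gives the required equality of integrals. -/
theorem condExp_exp_macroInterference {t : ℝ} (ht : 0 ≤ t) :
    μ[fun ω => Real.exp (-t * N.macroInterference ω) |
        MeasurableSpace.comap N.R inferInstance]
      =ᵐ[μ] fun ω => P.laplaceMacro (N.R ω) t := by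
  have hm : MeasurableSpace.comap N.R inferInstance ≤ ‹MeasurableSpace Ω› := N.measurable_R.comap_le
  set k : ℝ → ℝ≥0∞ := fun r =>
    expNeg (∫⁻ z, (1 - beyond P.eqDist (P.damp t) r z) ∂P.macroIntensity) with hk
  have hkm : Measurable k := Antitone.measurable fun r r' hr => expNeg_antitone
    (lintegral_mono fun z => tsub_le_tsub_left (beyond_antitone _ _ z hr) _)
  -- A measurable version of `laplaceMacro · t`: `k` is measurable because it is antitone, so the
  -- measurability of the parametric integrals in `ρ` need not be examined. The two agree for
  -- positive arguments, and `R > 0` almost surely.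
  set L : ℝ → ℝ := fun r => Real.exp (P.meanUpTo r) * (k r).toReal with hL
  have hVm : Measurable P.meanUpTo := P.continuous_meanUpTo.measurable
  have hLm : Measurable L := by fun_prop
  have hLeq : ∀ r, 0 < r → L r = P.laplaceMacro r t := by
    intro r hr
    simp only [hL, hk]
    rw [P.expNeg_beyond_damp hr ht, ENNReal.toReal_ofReal (by
      rw [P.laplaceMacro_eq]; positivity), ← mul_assoc, ← Real.exp_add]
    simp
  have hL01 : ∀ r, 0 < r → 0 ≤ L r ∧ L r ≤ 1 := by
    intro r hr
    rw [hLeq r hr, P.laplaceMacro_eq]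
    exact ⟨(Real.exp_pos _).le, Real.exp_le_one_iff.2
      (neg_nonpos.2 (P.macroExponent_nonneg hr ht))⟩
  have hae : (fun ω => L (N.R ω)) =ᵐ[μ] fun ω => P.laplaceMacro (N.R ω) t := by
    filter_upwards [N.ae_R_pos] with ω hω using hLeq _ hω
  have hLint : Integrable (fun ω => L (N.R ω)) μ := by
    refine Integrable.of_bound (hLm.comp N.measurable_R).aestronglyMeasurable 1 ?_
    filter_upwards [N.ae_R_pos] with ω hω
    rw [Real.norm_of_nonneg (hL01 _ hω).1]
    exact (hL01 _ hω).2
  refine ((ae_eq_condExp_of_forall_setIntegral_eq hm (N.integrable_exp_macroInterference ht)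
    (g := fun ω => L (N.R ω)) (fun s _ _ => hLint.integrableOn) ?_ ?_).symm).trans hae
  · rintro s ⟨A, hA, rfl⟩ -
    have hmA : Measurable (A.indicator fun _ => (1 : ℝ≥0∞)) := measurable_const.indicator hA
    have h := N.lintegral_R_fading_macroSum hmA (fun r => indicator_le_self' (by simp) r)
      (ψ := fun _ => 1) measurable_const (fun _ => le_rfl) ht
    simp only [mul_one, lintegral_const, measure_univ, one_mul] at h
    have hRA : MeasurableSet (N.R ⁻¹' A) := N.measurable_R hA
    have h1 : ∫⁻ ω in N.R ⁻¹' A, ENNReal.ofReal (L (N.R ω)) ∂μ = ∫⁻ r in Ioi (0 : ℝ),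
        ENNReal.ofReal (P.fR r) * (A.indicator (fun _ => (1 : ℝ≥0∞)) r *
          ENNReal.ofReal (P.laplaceMacro r t)) := by
      rw [← lintegral_indicator hRA]
      have h2 : ∀ ω, (N.R ⁻¹' A).indicator (fun ω => ENNReal.ofReal (L (N.R ω))) ω =
          (fun r => A.indicator (fun _ => (1 : ℝ≥0∞)) r * ENNReal.ofReal (L r)) (N.R ω) := by
        intro ω
        by_cases hω : N.R ω ∈ A <;> simp [indicator, hω]
      simp_rw [h2]
      rw [← lintegral_map (f := fun r => A.indicator (fun _ => (1 : ℝ≥0∞)) r * ENNReal.ofReal (L r))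
        (hmA.mul hLm.ennreal_ofReal) N.measurable_R, N.map_R,
        lintegral_withDensity_eq_lintegral_mul (volume.restrict (Ioi 0))
          (f := fun r => ENNReal.ofReal (P.fR r)) (by fun_prop)
          (g := fun r => A.indicator (fun _ => (1 : ℝ≥0∞)) r * ENNReal.ofReal (L r))
          (hmA.mul hLm.ennreal_ofReal)]
      refine setLIntegral_congr_fun measurableSet_Ioi fun r hr => ?_
      simp only [Pi.mul_apply]
      rw [hLeq r hr]
    have h3 : ∫⁻ ω in N.R ⁻¹' A, ENNReal.ofReal (Real.exp (-t * N.macroInterference ω)) ∂μ =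
        ∫⁻ ω, A.indicator (fun _ => (1 : ℝ≥0∞)) (N.R ω) *
          expNeg (ENNReal.ofReal t * N.macroSum ω) ∂μ := by
      rw [← lintegral_indicator hRA]
      refine lintegral_congr_ae ?_
      filter_upwards [N.expNeg_macroSum_eq ht] with ω hω
      by_cases hA' : N.R ω ∈ A <;> simp [indicator, hA', hω]
    rw [integral_eq_lintegral_of_nonneg_ae, integral_eq_lintegral_of_nonneg_ae, h1, h3, h]
    · exact ae_of_all _ fun ω => (Real.exp_pos _).le
    · exact (N.aestronglyMeasurable_exp_macroInterference t).restrict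
    · refine ae_restrict_of_ae ?_
      filter_upwards [N.ae_R_pos] with ω hω using (hL01 _ hω).1
    · exact (hLm.comp N.measurable_R).aestronglyMeasurable
  · exact (hLm.comp (comap_measurable N.R)).aestronglyMeasurable

lemma lintegral_expNeg_femtoSum {t : ℝ} (ht : 0 ≤ t) :
    ∫⁻ ω, expNeg (ENNReal.ofReal t * N.femtoSum ω) ∂μ = ENNReal.ofReal (P.laplaceFemto t) := by
  rw [← P.expNeg_femtoPower ht, ← N.hasPoissonLaplace_femtoPoint.laplace
    (fun y => expNeg (ENNReal.ofReal (t * P.femtoPower y))) (measurable_expNeg.comp (by fun_prop))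
    fun y => expNeg_le_one _]
  refine lintegral_congr fun ω => ?_
  rw [ENNReal.tprod_expNeg, femtoSum, ← ENNReal.tsum_mul_left]
  simp only [ENNReal.ofReal_mul ht]
  rfl

theorem integral_exp_femtoInterference {t : ℝ} (ht : 0 ≤ t) :
    ∫ ω, Real.exp (-t * N.femtoInterference ω) ∂μ = P.laplaceFemto t := by
  have hae : ∀ᵐ ω ∂μ, ENNReal.ofReal (Real.exp (-t * N.femtoInterference ω)) =
      expNeg (ENNReal.ofReal t * N.femtoSum ω) := by
    filter_upwards [N.ae_femtoSum_eq] with ω hω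
    rw [hω.2, ← ENNReal.ofReal_mul ht, expNeg_ofReal (mul_nonneg ht hω.1), neg_mul]
  rw [integral_eq_lintegral_of_nonneg_ae (ae_of_all _ fun ω => (Real.exp_pos _).le),
    lintegral_congr_ae hae, N.lintegral_expNeg_femtoSum ht, ENNReal.toReal_ofReal]
  · rw [P.laplaceFemto_eq]; positivity
  · have h : Measurable fun ω => Real.exp (-t * (N.femtoSum ω).toReal) := by
      have := N.measurable_femtoSum
      fun_prop
    refine h.aestronglyMeasurable.congr ?_
    filter_upwards [N.ae_femtoSum_eq] with ω hω
    rw [hω.2, ENNReal.toReal_ofReal hω.1]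

lemma ae_existsUnique_serving : ∀ᵐ ω ∂μ, ∃! j, ∀ i, N.equivDist ω j ≤ N.equivDist ω i := by
  filter_upwards [N.ae_serving_lt] with ω hω
  refine ⟨N.serving ω, fun i => ?_, fun j hj => ?_⟩
  · rcases eq_or_ne i (N.serving ω) with h | h
    · rw [h]
    · exact (hω i h).le
  · by_contra h
    exact absurd (hj (N.serving ω)) (not_le.2 (hω j h))

end HetNet

/-! ### Measures on `[0, ∞]` are determined by their Laplace transforms -/

lemma expNeg_injective : Function.Injective expNeg := fun x y h => by
  have h1 : (-(x : EReal)) = -(y : EReal) := EReal.exp_strictMono.injective h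
  simpa using h1

/-- `x ↦ e^{-x}` as a bounded continuous real-valued function on `[0, ∞]`. -/
def expNegBCF : BoundedContinuousFunction ℝ≥0∞ ℝ :=
  BoundedContinuousFunction.mkOfCompact ⟨fun y => (expNeg y).toReal,
    ENNReal.continuousOn_toReal.comp_continuous continuous_expNeg expNeg_ne_top⟩

@[simp] lemma expNegBCF_apply (y : ℝ≥0∞) : expNegBCF y = (expNeg y).toReal := rfl

/-- The polynomials in `e^{-y}` form an algebra of bounded continuous functions on `[0, ∞]` that
separates points, and their integrals are combinations of the given ones. -/
theorem ext_of_lintegral_expNeg {ν₁ ν₂ : Measure ℝ≥0∞} [IsFiniteMeasure ν₁] [IsFiniteMeasure ν₂]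
    (h : ∀ n : ℕ, ∫⁻ y, expNeg (n * y) ∂ν₁ = ∫⁻ y, expNeg (n * y) ∂ν₂) : ν₁ = ν₂ := by
  let A : StarSubalgebra ℝ (BoundedContinuousFunction ℝ≥0∞ ℝ) :=
    { (Polynomial.aeval (R := ℝ) expNegBCF).range with
      star_mem' := by
        intro a ha
        have : star a = a := by ext y; simp
        rw [this]
        exact ha }
  refine ext_of_forall_mem_subalgebra_integral_eq_of_polish (𝕜 := ℝ) (A := A) ?_ ?_
  · intro x y hxy
    refine ⟨expNegBCF, ⟨expNegBCF.toContinuousMap, ⟨expNegBCF, ⟨Polynomial.X, by simp⟩, rfl⟩, rfl⟩,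
      fun he => hxy (expNeg_injective ?_)⟩
    exact (ENNReal.toReal_eq_toReal_iff' (expNeg_ne_top _) (expNeg_ne_top _)).1 he
  · rintro _ ⟨p, rfl⟩
    have key : ∀ p : Polynomial ℝ, ∫ x, (Polynomial.aeval (R := ℝ) expNegBCF p) x ∂ν₁ =
        ∫ x, (Polynomial.aeval (R := ℝ) expNegBCF p) x ∂ν₂ := by
      intro p
      induction p using Polynomial.induction_on' with
      | add p q hp hq =>
        simp only [map_add, BoundedContinuousFunction.coe_add, Pi.add_apply]
        rw [integral_add (BoundedContinuousFunction.integrable _ _)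
          (BoundedContinuousFunction.integrable _ _),
          integral_add (BoundedContinuousFunction.integrable _ _)
          (BoundedContinuousFunction.integrable _ _), hp, hq]
      | monomial n a =>
        have h1 : ∀ x, (Polynomial.aeval (R := ℝ) expNegBCF (Polynomial.monomial n a)) x =
            a * (expNeg (n * x)).toReal := by
          intro x
          rw [Polynomial.aeval_monomial]
          simp [expNeg_nsmul, Algebra.algebraMap_eq_smul_one]
        have hm : Measurable fun x : ℝ≥0∞ => expNeg (n * x) :=
          measurable_expNeg.comp (by fun_prop)
        simp_rw [h1, integral_const_mul]
        rw [integral_toReal hm.aemeasurable (ae_of_all _ fun x => (expNeg_ne_top _).lt_top),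
          integral_toReal hm.aemeasurable (ae_of_all _ fun x => (expNeg_ne_top _).lt_top), h n]
    exact key p

/-- For fixed `A` and `B` the uniqueness theorem is applied to the law of `T` under the measure
restricted to `V ∈ A`, `W ∈ B`; boxes then determine the joint law. -/
theorem map_eq_of_lintegral_expNeg {Ω₁ Ω₂ α β : Type*} [MeasurableSpace Ω₁] [MeasurableSpace Ω₂]
    [MeasurableSpace α] [MeasurableSpace β] {μ₁ : Measure Ω₁} {μ₂ : Measure Ω₂}
    [IsFiniteMeasure μ₁] [IsFiniteMeasure μ₂] {V₁ : Ω₁ → α} {V₂ : Ω₂ → α} {W₁ : Ω₁ → β}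
    {W₂ : Ω₂ → β} {T₁ : Ω₁ → ℝ≥0∞} {T₂ : Ω₂ → ℝ≥0∞} (hV₁ : Measurable V₁) (hV₂ : Measurable V₂)
    (hW₁ : Measurable W₁) (hW₂ : Measurable W₂) (hT₁ : Measurable T₁) (hT₂ : Measurable T₂)
    (h : ∀ (A : Set α) (B : Set β) (n : ℕ), MeasurableSet A → MeasurableSet B →
      ∫⁻ ω, A.indicator (fun _ => 1) (V₁ ω) * B.indicator (fun _ => 1) (W₁ ω) *
          expNeg (n * T₁ ω) ∂μ₁ =
        ∫⁻ ω, A.indicator (fun _ => 1) (V₂ ω) * B.indicator (fun _ => 1) (W₂ ω) *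
          expNeg (n * T₂ ω) ∂μ₂) :
    μ₁.map (fun ω => (V₁ ω, W₁ ω, T₁ ω)) = μ₂.map (fun ω => (V₂ ω, W₂ ω, T₂ ω)) := by
  have hm₁ : Measurable fun ω => (V₁ ω, W₁ ω, T₁ ω) := hV₁.prodMk (hW₁.prodMk hT₁)
  have hm₂ : Measurable fun ω => (V₂ ω, W₂ ω, T₂ ω) := hV₂.prodMk (hW₂.prodMk hT₂)
  refine Measure.ext_prod₃ fun {A B C} hA hB hC => ?_
  have hS₁ : MeasurableSet (V₁ ⁻¹' A ∩ W₁ ⁻¹' B) := (hV₁ hA).inter (hW₁ hB)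
  have hS₂ : MeasurableSet (V₂ ⁻¹' A ∩ W₂ ⁻¹' B) := (hV₂ hA).inter (hW₂ hB)
  have hkey : (μ₁.restrict (V₁ ⁻¹' A ∩ W₁ ⁻¹' B)).map T₁ =
      (μ₂.restrict (V₂ ⁻¹' A ∩ W₂ ⁻¹' B)).map T₂ := by
    refine ext_of_lintegral_expNeg fun n => ?_
    have hE : Measurable fun x : ℝ≥0∞ => expNeg (n * x) := measurable_expNeg.comp (by fun_prop)
    rw [lintegral_map hE hT₁, lintegral_map hE hT₂, ← lintegral_indicator hS₁,
      ← lintegral_indicator hS₂]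
    convert! h A B n hA hB using 3 with ω ω
    · by_cases h1 : V₁ ω ∈ A <;> by_cases h2 : W₁ ω ∈ B <;> simp [indicator, h1, h2]
    · by_cases h1 : V₂ ω ∈ A <;> by_cases h2 : W₂ ω ∈ B <;> simp [indicator, h1, h2]
  have h3 := congrArg (fun ν => ν C) hkey
  simp only [Measure.map_apply hT₁ hC, Measure.map_apply hT₂ hC, Measure.restrict_apply (hT₁ hC),
    Measure.restrict_apply (hT₂ hC)] at h3
  rw [Measure.map_apply hm₁ (hA.prod (hB.prod hC)), Measure.map_apply hm₂ (hA.prod (hB.prod hC))]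
  convert h3 using 2 <;>
  · ext ω
    simp only [mem_preimage, mem_prod, mem_inter_iff]
    tauto

lemma lintegral_mul_mul_prod {α β γ : Type*} [MeasurableSpace α] [MeasurableSpace β]
    [MeasurableSpace γ] {κ : Measure α} {ν : Measure β} {μ : Measure γ} [SFinite ν] [SFinite μ]
    {a : α → ℝ≥0∞} {b : β → ℝ≥0∞} {E : α × γ → ℝ≥0∞} (ha : Measurable a) (hb : Measurable b)
    (hE : Measurable E) :
    ∫⁻ p, a p.1 * b p.2.1 * E (p.1, p.2.2) ∂(κ.prod (ν.prod μ)) =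
      ∫⁻ x, a x * ((∫⁻ y, b y ∂ν) * ∫⁻ z, E (x, z) ∂μ) ∂κ := by
  rw [lintegral_prod _ (by fun_prop)]
  refine lintegral_congr fun x => ?_
  rw [← lintegral_prod_mul (by fun_prop) (by fun_prop), ← lintegral_const_mul _ (by fun_prop)]
  simp only [mul_assoc]

/-! ### Interference from beyond a fixed distance, and the fading tail -/

namespace HetNetParams
open Filter Topology

variable (P : HetNetParams)

/-- The power of a marked MBS if its equivalent distance exceeds `ρ`, and `0` otherwise. -/
def powerBeyond (ρ : ℝ) (z : Plane × (ℝ × ℝ × ℝ)) : ℝ≥0∞ :=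
  beyond P.eqDist (fun z => ENNReal.ofReal (P.power z)) ρ z

lemma measurable_powerBeyond : Measurable fun p : ℝ × (Plane × (ℝ × ℝ × ℝ)) =>
    P.powerBeyond p.1 p.2 :=
  measurable_beyond_uncurry P.measurable_eqDist (by fun_prop)

lemma powerBeyond_le (ρ : ℝ) (z : Plane × (ℝ × ℝ × ℝ)) :
    P.powerBeyond ρ z ≤ ENNReal.ofReal (P.power z) := by
  unfold powerBeyond beyond
  exact indicator_le_self' (fun _ _ => zero_le) z

lemma macroExponent_zero (ρ : ℝ) : P.macroExponent ρ 0 = 0 := by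
  simp [macroExponent, FL, FN]

/-- The case `t = 0` of `lintegral_one_sub_beyond_damp` is the void part `meanUpTo ρ`; cancelling
it, which is allowed as it is finite, leaves the interference part. -/
lemma lintegral_one_sub_expNeg_powerBeyond {ρ t : ℝ} (hρ : 0 < ρ) (ht : 0 ≤ t) :
    ∫⁻ z, (1 - expNeg (ENNReal.ofReal t * P.powerBeyond ρ z)) ∂P.macroIntensity =
      ENNReal.ofReal (P.macroExponent ρ t) := by
  have h0 := P.lintegral_one_sub_beyond_damp hρ le_rfl
  rw [P.macroExponent_zero, add_zero] at h0
  have h1 := P.lintegral_one_sub_beyond_damp hρ ht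
  have hsplit : ∀ z, 1 - beyond P.eqDist (P.damp t) ρ z =
      (1 - beyond P.eqDist (P.damp 0) ρ z) +
        (1 - expNeg (ENNReal.ofReal t * P.powerBeyond ρ z)) := by
    intro z
    by_cases h : ρ < P.eqDist z
    · rw [beyond_of_lt h, beyond_of_lt h, powerBeyond, beyond_of_lt h, ← ENNReal.ofReal_mul ht]
      simp [damp]
    · rw [beyond_of_le (not_lt.1 h), beyond_of_le (not_lt.1 h), powerBeyond,
        beyond_of_le (not_lt.1 h)]
      simp
  simp_rw [hsplit] at h1
  have hm : Measurable fun z => 1 - beyond P.eqDist (P.damp 0) ρ z :=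
    measurable_const.sub (measurable_beyond P.measurable_eqDist (P.measurable_damp 0) ρ)
  rw [lintegral_add_left hm, h0,
    ENNReal.ofReal_add (P.meanUpTo_nonneg hρ.le) (P.macroExponent_nonneg hρ ht)] at h1
  exact (ENNReal.add_right_inj ENNReal.ofReal_ne_top).1 h1

lemma D0_pos : 0 < P.D0 := mul_pos P.Mt_pos P.Mr_pos

lemma s_pos {ρ : ℝ} (hρ : 0 < ρ) : 0 < P.s ρ :=
  div_pos (mul_pos P.gammaM_pos (Real.rpow_pos_of_pos hρ _))
    (mul_pos (mul_pos (mul_pos P.Pm_pos P.CL_pos) P.D0_pos) (P.G_pos ρ))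

@[fun_prop] lemma measurable_s : Measurable P.s := by unfold s; fun_prop

lemma lossL_Req {r : ℝ} (hr : 0 < r) : P.lossL (P.Req r) = P.lossN r := by
  have h1 := P.CL_pos
  have h2 := P.CN_pos
  have h3 := P.alphaL_pos
  rw [lossL, lossN, Req, Real.mul_rpow (by positivity) (by positivity), ← Real.rpow_mul (by positivity),
    ← Real.rpow_mul hr.le, ← mul_assoc]
  have e1 : 1 / P.alphaL * -P.alphaL = -1 := by field_simp
  have e2 : P.alphaN / P.alphaL * -P.alphaL = -P.alphaN := by field_simp
  rw [e1, e2, Real.rpow_neg_one]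
  congr 1
  field_simp

/-- `Req` is made so that the two path losses agree. Positivity of the equivalent distance puts an
NLOS station off the origin, as `lossL_Req` requires. -/
lemma loss_eq {z : Plane × (ℝ × ℝ × ℝ)} (hz : 0 < P.eqDist z) :
    P.loss z = P.lossL (P.eqDist z) := by
  unfold loss
  unfold eqDist at hz ⊢
  split_ifs with h
  · rfl
  · rw [if_neg h] at hz
    rw [P.lossL_Req]
    rcases (norm_nonneg z.1).eq_or_lt with h0 | h0
    · rw [← h0, Req, Real.zero_rpow (div_pos P.alphaN_pos P.alphaL_pos).ne', mul_zero] at hz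
      exact absurd hz (lt_irrefl _)
    · exact h0

/-- The tail of the fading power at `x`. -/
def fadingTail (x : ℝ) : ℝ :=
  Real.exp (-(P.m * x)) * ∑ k ∈ Finset.range P.m, (P.m * x) ^ k / (k.factorial : ℝ)

lemma gammaMeasure_Ioi_eq {x : ℝ} (hx : 0 ≤ x) :
    gammaMeasure P.m P.m (Ioi x) = ENNReal.ofReal (P.fadingTail x) :=
  gammaMeasure_Ioi P.m_pos P.m_cast_pos hx

@[fun_prop] lemma measurable_fadingTail : Measurable P.fadingTail := by unfold fadingTail; fun_prop

lemma fadingTail_nonneg {x : ℝ} (hx : 0 ≤ x) : 0 ≤ P.fadingTail x :=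
  mul_nonneg (Real.exp_pos _).le (Finset.sum_nonneg fun k _ => by positivity)

lemma fadingTail_le_one {x : ℝ} (hx : 0 ≤ x) : P.fadingTail x ≤ 1 := by
  have h := prob_le_one (μ := gammaMeasure P.m P.m) (s := Ioi x)
  rwa [P.gammaMeasure_Ioi_eq hx, ENNReal.ofReal_le_one] at h

end HetNetParams

/-! ### The joint law of serving distance, serving fading and total interference -/

namespace HetNet
open Filter Topology

variable {P : HetNetParams} {Ω : Type*} [MeasurableSpace Ω] {μ : Measure Ω} (N : HetNet P μ)

/-- The interference of the MBSs whose equivalent distance exceeds `ρ`. -/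
def macroSumBeyond (ρ : ℝ) (ω : Ω) : ℝ≥0∞ := ∑' j, P.powerBeyond ρ (N.macroPoint ω j)

lemma measurable_macroSumBeyond : Measurable fun p : ℝ × Ω => N.macroSumBeyond p.1 p.2 :=
  Measurable.tsum fun j => P.measurable_powerBeyond.comp
    (measurable_fst.prodMk ((N.measurable_macroPoint j).comp measurable_snd))

/-- The total interference when the serving MBS is at equivalent distance `ρ`. -/
def totalBeyond (ρ : ℝ) (ω : Ω) : ℝ≥0∞ := N.macroSumBeyond ρ ω + N.femtoSum ω

lemma measurable_totalBeyond : Measurable fun p : ℝ × Ω => N.totalBeyond p.1 p.2 :=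
  N.measurable_macroSumBeyond.add (N.measurable_femtoSum.comp measurable_snd)

lemma measurable_totalBeyond_right (ρ : ℝ) : Measurable fun ω => N.totalBeyond ρ ω :=
  N.measurable_totalBeyond.comp measurable_prodMk_left

variable [IsProbabilityMeasure μ]

lemma lintegral_macro_mul_femto {Φ : (ℕ → Plane × (ℝ × ℝ × ℝ)) → ℝ≥0∞}
    {Ψ : (ℕ → Plane × (ℝ × ℂ)) → ℝ≥0∞} (hΦ : Measurable Φ) (hΨ : Measurable Ψ) :
    ∫⁻ ω, Φ (N.macroPoint ω) * Ψ (N.femtoPoint ω) ∂μ =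
      (∫⁻ ω, Φ (N.macroPoint ω) ∂μ) * ∫⁻ ω, Ψ (N.femtoPoint ω) ∂μ := by
  have hz₁ : Measurable fun p : (ℕ → Plane) × (ℕ → ℝ × ℝ × ℝ) => fun j => (p.1 j, p.2 j) := by
    fun_prop
  have hz₂ : Measurable fun p : (ℕ → Plane) × (ℕ → ℝ × ℂ) => fun j => (p.1 j, p.2 j) := by
    fun_prop
  have hi := N.indepFun_macro_femto.comp (hΦ.comp hz₁) (hΨ.comp hz₂)
  exact lintegral_mul_eq_lintegral_mul_lintegral_of_indepFun''
    ((hΦ.comp hz₁).comp N.measurable_macroPair).aemeasurable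
    ((hΨ.comp hz₂).comp N.measurable_femtoPair).aemeasurable hi

lemma measurable_expNeg_tsum_femtoPower (t : ℝ) :
    Measurable fun y : ℕ → Plane × (ℝ × ℂ) =>
      expNeg (ENNReal.ofReal t * ∑' j, ENNReal.ofReal (P.femtoPower (y j))) :=
  measurable_expNeg.comp (measurable_const.mul (Measurable.tsum fun j => by fun_prop))

lemma lintegral_expNeg_macroSumBeyond {ρ t : ℝ} (hρ : 0 < ρ) (ht : 0 ≤ t) :
    ∫⁻ ω, expNeg (ENNReal.ofReal t * N.macroSumBeyond ρ ω) ∂μ =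
      ENNReal.ofReal (P.laplaceMacro ρ t) := by
  have h := N.hasPoissonLaplace_macroPoint.laplace
    (fun z => expNeg (ENNReal.ofReal t * P.powerBeyond ρ z))
    (measurable_expNeg.comp (measurable_const.mul
      (P.measurable_powerBeyond.comp measurable_prodMk_left))) fun z => expNeg_le_one _
  rw [P.lintegral_one_sub_expNeg_powerBeyond hρ ht, expNeg_ofReal (P.macroExponent_nonneg hρ ht),
    ← P.laplaceMacro_eq] at h
  rw [← h]
  refine lintegral_congr fun ω => ?_
  rw [ENNReal.tprod_expNeg, macroSumBeyond, ENNReal.tsum_mul_left]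

lemma lintegral_expNeg_totalBeyond {ρ t : ℝ} (hρ : 0 < ρ) (ht : 0 ≤ t) :
    ∫⁻ ω, expNeg (ENNReal.ofReal t * N.totalBeyond ρ ω) ∂μ =
      ENNReal.ofReal (P.laplaceTotal ρ t) := by
  have h := N.lintegral_macro_mul_femto
    (Φ := fun z => expNeg (ENNReal.ofReal t * ∑' j, P.powerBeyond ρ (z j)))
    (measurable_expNeg.comp (measurable_const.mul (Measurable.tsum fun j =>
      (P.measurable_powerBeyond.comp measurable_prodMk_left).comp (measurable_pi_apply j))))
    (measurable_expNeg_tsum_femtoPower (P := P) t)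
  have h2 := h.trans (congrArg₂ (· * ·) (N.lintegral_expNeg_macroSumBeyond hρ ht)
    (N.lintegral_expNeg_femtoSum ht))
  rw [← ENNReal.ofReal_mul (by rw [P.laplaceMacro_eq]; positivity)] at h2
  refine Eq.trans (lintegral_congr fun ω => ?_) h2
  rw [totalBeyond, mul_add, expNeg_add]
  rfl

lemma lintegral_R_fading_total {g ψ : ℝ → ℝ≥0∞} (hg : Measurable g) (hg1 : ∀ r, g r ≤ 1)
    (hψ : Measurable ψ) (hψ1 : ∀ h, ψ h ≤ 1) {t : ℝ} (ht : 0 ≤ t) :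
    ∫⁻ ω, g (N.R ω) * ψ (N.servingFading ω) *
        expNeg (ENNReal.ofReal t * (N.macroSum ω + N.femtoSum ω)) ∂μ =
      (∫⁻ h, ψ h ∂(gammaMeasure P.m P.m)) * ∫⁻ r in Ioi (0 : ℝ),
        ENNReal.ofReal (P.fR r) * (g r * ENNReal.ofReal (P.laplaceTotal r t)) := by
  -- The serving index is recomputed from the marked configuration alone. This exhibits the macro
  -- factor as a functional of that configuration, so that independence of the tiers applies.
  set σ : (ℕ → Plane × (ℝ × ℝ × ℝ)) → ℕ :=
    fun z => sInf {j | ∀ i, P.eqDist (z j) ≤ P.eqDist (z i)} with hσ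
  have hσm : Measurable σ := measurable_nearest P.measurable_eqDist
  have hev : Measurable fun z : ℕ → Plane × (ℝ × ℝ × ℝ) => z (σ z) := by
    have h1 : Measurable fun p : (ℕ → Plane × (ℝ × ℝ × ℝ)) × ℕ => p.1 p.2 :=
      measurable_from_prod_countable_left fun j => measurable_pi_apply j
    exact h1.comp (measurable_id.prodMk hσm)
  have hserv : ∀ ω, N.serving ω = σ (N.macroPoint ω) := fun ω => by
    simp only [hσ, serving, equivDist_eq]
  have hΦ : Measurable fun z : ℕ → Plane × (ℝ × ℝ × ℝ) =>
      g (P.eqDist (z (σ z))) * ψ (z (σ z)).2.2.2 * expNeg (ENNReal.ofReal t *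
        ∑' j, ENNReal.ofReal (if j = σ z then 0 else P.power (z j))) := by
    refine ((hg.comp (P.measurable_eqDist.comp hev)).mul (hψ.comp
      (measurable_snd.comp (measurable_snd.comp (measurable_snd.comp hev))))).mul
      (measurable_expNeg.comp (measurable_const.mul (Measurable.tsum fun j =>
        Measurable.ennreal_ofReal ?_)))
    exact Measurable.ite (measurableSet_eq_fun measurable_const hσm) measurable_const
      (by fun_prop)
  have hΦeq : ∀ ω, g (N.R ω) * ψ (N.servingFading ω) * expNeg (ENNReal.ofReal t * N.macroSum ω) =
      (fun z : ℕ → Plane × (ℝ × ℝ × ℝ) =>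
        g (P.eqDist (z (σ z))) * ψ (z (σ z)).2.2.2 * expNeg (ENNReal.ofReal t *
        ∑' j, ENNReal.ofReal (if j = σ z then 0 else P.power (z j)))) (N.macroPoint ω) := by
    intro ω
    simp only [R, servingFading, macroSum, macroTerm_eq, equivDist_eq, ← hserv]
    rfl
  have h := N.lintegral_macro_mul_femto hΦ (measurable_expNeg_tsum_femtoPower (P := P) t)
  simp_rw [← hΦeq] at h
  rw [N.lintegral_R_fading_macroSum hg hg1 hψ hψ1 ht] at h
  have h2 := h.trans (congrArg (_ * ·) (N.lintegral_expNeg_femtoSum ht))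
  refine Eq.trans (lintegral_congr fun ω => ?_) (h2.trans ?_)
  · rw [mul_add, expNeg_add, ← mul_assoc]
    rfl
  · rw [mul_assoc, ← lintegral_mul_const' _ _ ENNReal.ofReal_ne_top]
    congr 1
    refine lintegral_congr fun r => ?_
    rw [HetNetParams.laplaceTotal, ENNReal.ofReal_mul (by rw [P.laplaceMacro_eq]; positivity)]
    ring

lemma lintegral_map_R {F : ℝ → ℝ≥0∞} (hF : Measurable F) :
    ∫⁻ r, F r ∂(μ.map N.R) = ∫⁻ r in Ioi (0 : ℝ), ENNReal.ofReal (P.fR r) * F r := by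
  rw [N.map_R, lintegral_withDensity_eq_lintegral_mul (volume.restrict (Ioi 0))
    (f := fun r => ENNReal.ofReal (P.fR r)) (by fun_prop) hF]
  rfl

/-- Given the serving distance `R`, the serving fading has its original law and is independent of
the interference, which has the law of the interference from beyond the distance `R`. -/
theorem map_R_fading_total :
    μ.map (fun ω => (N.R ω, N.servingFading ω, N.macroSum ω + N.femtoSum ω)) =
      ((μ.map N.R).prod ((gammaMeasure P.m P.m).prod μ)).map
        (fun p => (p.1, p.2.1, N.totalBeyond p.1 p.2.2)) := by
  have hT : Measurable fun p : ℝ × ℝ × Ω => N.totalBeyond p.1 p.2.2 :=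
    N.measurable_totalBeyond.comp (measurable_fst.prodMk (measurable_snd.comp measurable_snd))
  refine map_eq_of_lintegral_expNeg N.measurable_R measurable_fst N.measurable_servingFading
    (measurable_fst.comp measurable_snd) (N.measurable_macroSum.add N.measurable_femtoSum) hT
    fun A B n hA hB => ?_
  have hmA : Measurable (A.indicator fun _ => (1 : ℝ≥0∞)) := measurable_const.indicator hA
  have hmB : Measurable (B.indicator fun _ => (1 : ℝ≥0∞)) := measurable_const.indicator hB
  have hn : (n : ℝ≥0∞) = ENNReal.ofReal n := by simp
  have hE : Measurable fun p : ℝ × Ω => expNeg (n * N.totalBeyond p.1 p.2) :=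
    measurable_expNeg.comp (measurable_const.mul N.measurable_totalBeyond)
  have hK : Measurable fun r : ℝ => ∫⁻ ω, expNeg (n * N.totalBeyond r ω) ∂μ :=
    hE.lintegral_prod_right'
  have hR : ∫⁻ p, A.indicator (fun _ => (1 : ℝ≥0∞)) p.1 * B.indicator (fun _ => 1) p.2.1 *
      expNeg (n * N.totalBeyond p.1 p.2.2) ∂((μ.map N.R).prod ((gammaMeasure P.m P.m).prod μ)) =
      ∫⁻ r, A.indicator (fun _ => (1 : ℝ≥0∞)) r *
        ((∫⁻ h, B.indicator (fun _ => 1) h ∂(gammaMeasure P.m P.m)) *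
          ∫⁻ ω, expNeg (n * N.totalBeyond r ω) ∂μ) ∂(μ.map N.R) :=
    lintegral_mul_mul_prod hmA hmB hE
  refine Eq.trans ?_ hR.symm
  rw [hn, N.lintegral_R_fading_total hmA (fun r => indicator_le_self' (by simp) r) hmB
    (fun r => indicator_le_self' (by simp) r) n.cast_nonneg,
    N.lintegral_map_R (F := fun r => A.indicator (fun _ => (1 : ℝ≥0∞)) r *
      ((∫⁻ h, B.indicator (fun _ => 1) h ∂(gammaMeasure P.m P.m)) *
        ∫⁻ ω, expNeg (ENNReal.ofReal n * N.totalBeyond r ω) ∂μ))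
      (hmA.mul (measurable_const.mul (hn ▸ hK))),
    ← lintegral_const_mul' _ _ (ne_top_of_le_ne_top ENNReal.one_ne_top ?_)]
  · refine setLIntegral_congr_fun measurableSet_Ioi fun r hr => ?_
    rw [N.lintegral_expNeg_totalBeyond hr n.cast_nonneg]
    ring
  · refine (lintegral_mono fun r => indicator_le_self' (f := fun _ => (1 : ℝ≥0∞)) (by simp) r).trans
      (by simp)

end HetNet

/-! ### The coverage probability -/

namespace HetNet
open Filter Topology

variable {P : HetNetParams} {Ω : Type*} [MeasurableSpace Ω] {μ : Measure Ω} (N : HetNet P μ)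

/-- The coverage probability given that the serving MBS is at equivalent distance `ρ`. -/
def coverageAt (ρ : ℝ) : ℝ :=
  ∫ ω, P.fadingTail (P.s ρ * ((N.totalBeyond ρ ω).toReal + P.sigma ^ 2)) ∂μ

lemma measurable_threshold :
    Measurable fun p : ℝ × Ω => P.s p.1 * ((N.totalBeyond p.1 p.2).toReal + P.sigma ^ 2) := by
  have := N.measurable_totalBeyond
  fun_prop

lemma threshold_nonneg {ρ : ℝ} (hρ : 0 < ρ) (y : ℝ≥0∞) :
    0 ≤ P.s ρ * (y.toReal + P.sigma ^ 2) :=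
  mul_nonneg (P.s_pos hρ).le (add_nonneg ENNReal.toReal_nonneg (sq_nonneg _))

lemma coverageAt_nonneg {ρ : ℝ} (hρ : 0 < ρ) : 0 ≤ N.coverageAt ρ :=
  integral_nonneg fun _ => P.fadingTail_nonneg (threshold_nonneg hρ _)

lemma measurable_toReal_totalBeyond (ρ : ℝ) : Measurable fun ω => (N.totalBeyond ρ ω).toReal :=
  (N.measurable_totalBeyond_right ρ).ennreal_toReal

variable [IsProbabilityMeasure μ]

lemma measurable_coverageAt : Measurable N.coverageAt :=
  (StronglyMeasurable.integral_prod_right' (f := fun p : ℝ × Ω =>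
    P.fadingTail (P.s p.1 * ((N.totalBeyond p.1 p.2).toReal + P.sigma ^ 2)))
    (P.measurable_fadingTail.comp N.measurable_threshold).stronglyMeasurable).measurable

lemma lintegral_fadingTail {ρ : ℝ} (hρ : 0 < ρ) :
    ∫⁻ ω, gammaMeasure P.m P.m (Ioi (P.s ρ * ((N.totalBeyond ρ ω).toReal + P.sigma ^ 2))) ∂μ =
      ENNReal.ofReal (N.coverageAt ρ) := by
  have hm : Measurable fun ω => P.fadingTail (P.s ρ * ((N.totalBeyond ρ ω).toReal + P.sigma ^ 2)) :=
    P.measurable_fadingTail.comp (N.measurable_threshold.comp measurable_prodMk_left)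
  simp_rw [P.gammaMeasure_Ioi_eq (threshold_nonneg hρ _)]
  rw [coverageAt, ofReal_integral_eq_lintegral_ofReal]
  · refine Integrable.of_bound hm.aestronglyMeasurable 1 (ae_of_all _ fun ω => ?_)
    rw [Real.norm_of_nonneg (P.fadingTail_nonneg (threshold_nonneg hρ _))]
    exact P.fadingTail_le_one (threshold_nonneg hρ _)
  · exact ae_of_all _ fun ω => P.fadingTail_nonneg (threshold_nonneg hρ _)

lemma coverageAt_le_one {ρ : ℝ} (hρ : 0 < ρ) : N.coverageAt ρ ≤ 1 := by
  have h : ENNReal.ofReal (N.coverageAt ρ) ≤ 1 := by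
    rw [← N.lintegral_fadingTail hρ]
    exact (lintegral_mono fun ω => prob_le_one).trans (by simp)
  rwa [ENNReal.ofReal_le_one] at h

/-- The inequality is solved for the serving fading. The noise power keeps the denominator positive,
and `s` collects all factors that depend on `R`. -/
lemma ae_gamma_lt_sinr_iff : ∀ᵐ ω ∂μ, P.gammaM < N.sinr ω ↔
    P.s (N.R ω) * ((N.macroSum ω + N.femtoSum ω).toReal + P.sigma ^ 2) < N.servingFading ω := by
  filter_upwards [N.ae_R_pos, N.ae_macroSum_eq, N.ae_femtoSum_eq] with ω hR h1 h2
  have hσ : 0 < P.sigma ^ 2 := pow_pos P.sigma_pos 2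
  have hG := P.G_pos (N.R ω)
  have hD := P.D0_pos
  have hC := P.CL_pos
  have hP := P.Pm_pos
  have hpl : N.pathLoss ω (N.serving ω) = P.CL * (N.R ω ^ P.alphaL)⁻¹ := by
    rw [← Real.rpow_neg hR.le, pathLoss_eq, P.loss_eq (by rw [← equivDist_eq]; exact hR),
      ← equivDist_eq]
    rfl
  rw [h1.2, h2.2, ← ENNReal.ofReal_add h1.1 h2.1, ENNReal.toReal_ofReal (add_nonneg h1.1 h2.1),
    sinr, hpl, lt_div_iff₀ (by linarith [h1.1, h2.1]), HetNetParams.s, div_mul_eq_mul_div,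
    div_lt_iff₀ (by positivity)]
  have hr : 0 < N.R ω ^ P.alphaL := Real.rpow_pos_of_pos hR _
  have e : P.Pm * (P.CL * (N.R ω ^ P.alphaL)⁻¹) * P.D0 * P.G (N.R ω) * N.hpow ω (N.serving ω) =
      N.servingFading ω * (P.Pm * P.CL * P.D0 * P.G (N.R ω)) / N.R ω ^ P.alphaL := by
    rw [servingFading]
    field_simp
  rw [e, lt_div_iff₀ hr]
  constructor <;> intro h <;> linarith

/-- Under the product law of `map_R_fading_total` the fading can be integrated out first, which
produces its tail at the threshold. -/
lemma measure_gamma_lt_sinr : μ {ω | P.gammaM < N.sinr ω} =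
    ∫⁻ ρ in Ioi (0 : ℝ), ENNReal.ofReal (P.fR ρ * N.coverageAt ρ) := by
  have hB : MeasurableSet {p : ℝ × ℝ × ℝ≥0∞ | P.s p.1 * (p.2.2.toReal + P.sigma ^ 2) < p.2.1} :=
    measurableSet_lt (by fun_prop) (by fun_prop)
  have hm₁ : Measurable fun ω => (N.R ω, N.servingFading ω, N.macroSum ω + N.femtoSum ω) :=
    N.measurable_R.prodMk (N.measurable_servingFading.prodMk
      (N.measurable_macroSum.add N.measurable_femtoSum))
  have hm₂ : Measurable fun p : ℝ × ℝ × Ω => (p.1, p.2.1, N.totalBeyond p.1 p.2.2) := by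
    have := N.measurable_totalBeyond.comp
      (measurable_fst.prodMk (measurable_snd.comp measurable_snd) :
        Measurable fun p : ℝ × ℝ × Ω => (p.1, p.2.2))
    exact measurable_fst.prodMk ((measurable_fst.comp measurable_snd).prodMk this)
  have h1 : μ {ω | P.gammaM < N.sinr ω} =
      μ.map (fun ω => (N.R ω, N.servingFading ω, N.macroSum ω + N.femtoSum ω))
        {p | P.s p.1 * (p.2.2.toReal + P.sigma ^ 2) < p.2.1} := by
    rw [Measure.map_apply hm₁ hB]
    refine measure_congr ?_
    filter_upwards [N.ae_gamma_lt_sinr_iff] with ω hω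
    exact propext hω
  have hK : Measurable fun ρ : ℝ => ∫⁻ ω, gammaMeasure P.m P.m
      (Ioi (P.s ρ * ((N.totalBeyond ρ ω).toReal + P.sigma ^ 2))) ∂μ := by
    refine Measurable.lintegral_prod_right' (f := fun p : ℝ × Ω => gammaMeasure P.m P.m
      (Ioi (P.s p.1 * ((N.totalBeyond p.1 p.2).toReal + P.sigma ^ 2)))) ?_
    have : Antitone fun x : ℝ => gammaMeasure P.m P.m (Ioi x) := fun x y h =>
      measure_mono (Ioi_subset_Ioi h)
    exact this.measurable.comp N.measurable_threshold
  rw [h1, N.map_R_fading_total, Measure.map_apply hm₂ hB, Measure.prod_apply (hm₂ hB)]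
  have h2 : ∀ ρ, ((gammaMeasure P.m P.m).prod μ) (Prod.mk ρ ⁻¹'
      ((fun p : ℝ × ℝ × Ω => (p.1, p.2.1, N.totalBeyond p.1 p.2.2)) ⁻¹'
        {p | P.s p.1 * (p.2.2.toReal + P.sigma ^ 2) < p.2.1})) =
      ∫⁻ ω, gammaMeasure P.m P.m
        (Ioi (P.s ρ * ((N.totalBeyond ρ ω).toReal + P.sigma ^ 2))) ∂μ := fun ρ => by
    rw [Measure.prod_apply_symm (measurable_prodMk_left (hm₂ hB))]
    rfl
  simp_rw [h2]
  rw [N.lintegral_map_R hK]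
  refine setLIntegral_congr_fun measurableSet_Ioi fun ρ hρ => ?_
  rw [N.lintegral_fadingTail hρ, ENNReal.ofReal_mul (P.fR_nonneg hρ)]

lemma integrableOn_fR : IntegrableOn P.fR (Ioi 0) := by
  refine ⟨P.measurable_fR.aestronglyMeasurable, ?_⟩
  rw [hasFiniteIntegral_iff_ofReal ((ae_restrict_iff' measurableSet_Ioi).2
    (ae_of_all _ fun r hr => P.fR_nonneg hr)), P.lintegral_fR]
  exact ENNReal.one_lt_top

lemma integrableOn_fR_mul_coverageAt :
    IntegrableOn (fun ρ => P.fR ρ * N.coverageAt ρ) (Ioi 0) := by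
  refine Integrable.mono' (integrableOn_fR (P := P))
    (P.measurable_fR.mul N.measurable_coverageAt).aestronglyMeasurable
    ((ae_restrict_iff' measurableSet_Ioi).2 (ae_of_all _ fun r hr => ?_))
  have h := P.fR_nonneg hr
  rw [Real.norm_of_nonneg (mul_nonneg h (N.coverageAt_nonneg hr))]
  exact mul_le_of_le_one_right h (N.coverageAt_le_one hr)

/-! ### The derivatives of the Laplace transform -/

lemma ae_totalBeyond_ne_top (ρ : ℝ) : ∀ᵐ ω ∂μ, N.totalBeyond ρ ω ≠ ∞ := by
  filter_upwards [N.ae_tsum_power_ne_top, N.ae_femtoSum_ne_top] with ω h1 h2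
  exact ENNReal.add_ne_top.2
    ⟨ne_top_of_le_ne_top h1 (ENNReal.tsum_le_tsum fun j => P.powerBeyond_le ρ _), h2⟩

/-- The interference is nonnegative, so `e^{-zT} ≤ 1` for `z ≥ 0`. Hence the moment generating
function of `-T` is analytic on `(0, ∞)`. -/
lemma Ici_subset_integrableExpSet (ρ : ℝ) :
    Ici 0 ⊆ integrableExpSet (fun ω => -(N.totalBeyond ρ ω).toReal) μ := by
  intro z hz
  have hm := N.measurable_toReal_totalBeyond ρ
  refine Integrable.of_bound (Measurable.aestronglyMeasurable (by fun_prop)) 1 (ae_of_all _ fun ω => ?_)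
  rw [Real.norm_of_nonneg (Real.exp_pos _).le, Real.exp_le_one_iff]
  exact mul_nonpos_of_nonneg_of_nonpos hz (neg_nonpos.2 ENNReal.toReal_nonneg)

lemma Ioi_subset_interior_integrableExpSet (ρ : ℝ) :
    Ioi 0 ⊆ interior (integrableExpSet (fun ω => -(N.totalBeyond ρ ω).toReal) μ) :=
  interior_maximal (Ioi_subset_Ici_self.trans (N.Ici_subset_integrableExpSet ρ)) isOpen_Ioi

lemma mgf_neg_totalBeyond {ρ z : ℝ} (hρ : 0 < ρ) (hz : 0 ≤ z) :
    mgf (fun ω => -(N.totalBeyond ρ ω).toReal) μ z = P.laplaceTotal ρ z := by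
  have hm := N.measurable_toReal_totalBeyond ρ
  have hnn : 0 ≤ P.laplaceTotal ρ z := by
    rw [HetNetParams.laplaceTotal, P.laplaceMacro_eq, P.laplaceFemto_eq]
    positivity
  rw [mgf, integral_eq_lintegral_of_nonneg_ae (ae_of_all _ fun ω => (Real.exp_pos _).le)
    (Measurable.aestronglyMeasurable (by fun_prop)), ← ENNReal.toReal_ofReal hnn, ← N.lintegral_expNeg_totalBeyond hρ hz]
  congr 1
  refine lintegral_congr_ae ?_
  filter_upwards [N.ae_totalBeyond_ne_top ρ] with ω hω
  conv_rhs => rw [← ENNReal.ofReal_toReal hω, ← ENNReal.ofReal_mul hz,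
    expNeg_ofReal (mul_nonneg hz ENNReal.toReal_nonneg)]
  rw [mul_neg]

/-- Smoothness is inherited from the moment generating function of a random variable on the given
network; the integrals of `F_L` and `F_N` are never differentiated. -/
lemma contDiffOn_laplaceTotal (N : HetNet P μ) {ρ : ℝ} (hρ : 0 < ρ) (n : ℕ) :
    ContDiffOn ℝ n (fun z => P.laplaceTotal ρ z) (Ioi 0) := by
  have h := (analyticOn_mgf (X := fun ω => -(N.totalBeyond ρ ω).toReal) (μ := μ)).mono
    (N.Ioi_subset_interior_integrableExpSet ρ)
  exact (h.contDiffOn (uniqueDiffOn_Ioi 0)).congr fun z hz =>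
    (N.mgf_neg_totalBeyond hρ (le_of_lt hz)).symm

lemma iteratedDeriv_laplaceTotal {ρ z : ℝ} (hρ : 0 < ρ) (hz : 0 < z) (l : ℕ) :
    iteratedDeriv l (fun z => P.laplaceTotal ρ z) z =
      ∫ ω, (-(N.totalBeyond ρ ω).toReal) ^ l * Real.exp (z * -(N.totalBeyond ρ ω).toReal) ∂μ := by
  rw [← iteratedDeriv_mgf (N.Ioi_subset_interior_integrableExpSet ρ hz) l]
  refine Filter.EventuallyEq.iteratedDeriv_eq l ?_
  filter_upwards [Ioi_mem_nhds hz] with y hy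
  exact (N.mgf_neg_totalBeyond hρ (le_of_lt hy)).symm

/-- The binomial expansion of the tail of the fading power. -/
lemma fadingTail_eq_sum (ρ y : ℝ) :
    P.fadingTail (P.s ρ * (y + P.sigma ^ 2)) =
      Real.exp (-(P.m * P.s ρ * P.sigma ^ 2)) *
        ∑ k ∈ Finset.range P.m, ∑ l ∈ Finset.range (k + 1),
          P.Ckl ρ k l * ((-y) ^ l * Real.exp (P.m * P.s ρ * -y)) := by
  have he : Real.exp (-(P.m * (P.s ρ * (y + P.sigma ^ 2)))) =
      Real.exp (-(P.m * P.s ρ * P.sigma ^ 2)) * Real.exp (P.m * P.s ρ * -y) := by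
    rw [← Real.exp_add]
    congr 1
    ring
  rw [HetNetParams.fadingTail, he, mul_assoc, Finset.mul_sum]
  congr 1
  refine Finset.sum_congr rfl fun k _ => ?_
  have hb : P.m * (P.s ρ * (y + P.sigma ^ 2)) =
      P.m * P.s ρ * y + P.m * P.s ρ * P.sigma ^ 2 := by ring
  rw [hb, add_pow, Finset.sum_div, Finset.mul_sum]
  refine Finset.sum_congr rfl fun l _ => ?_
  rw [HetNetParams.Ckl, neg_pow y l, mul_pow _ y l]
  -- The sign in `Ckl` cancels that of `(-y)^l`, which is kept there to match the derivatives of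
  -- `e^{-zy}`.
  have h1 : ((-1 : ℝ) ^ l) * (-1) ^ l = 1 := by rw [← mul_pow]; simp
  linear_combination (-(Real.exp (P.m * P.s ρ * -y) * ((P.m * P.s ρ) ^ l * y ^ l *
    (P.m * P.s ρ * P.sigma ^ 2) ^ (k - l) * (k.choose l) / k.factorial))) * h1

/-- Taking the mean of the binomial expansion term by term gives the moments of `(-T)^l e^{-zT}` at
`z = m s`, which are the derivatives of `laplaceTotal` there. -/
lemma coverageIntegrand_eq {ρ : ℝ} (hρ : 0 < ρ) :
    P.coverageIntegrand ρ = P.fR ρ * N.coverageAt ρ := by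
  have hz : 0 < P.m * P.s ρ := mul_pos P.m_cast_pos (P.s_pos hρ)
  have hint : ∀ l : ℕ, Integrable (fun ω => (-(N.totalBeyond ρ ω).toReal) ^ l *
      Real.exp (P.m * P.s ρ * -(N.totalBeyond ρ ω).toReal)) μ := fun l =>
    integrable_pow_mul_exp_of_mem_interior_integrableExpSet
      (N.Ioi_subset_interior_integrableExpSet ρ hz) l
  have h : N.coverageAt ρ = Real.exp (-(P.m * P.s ρ * P.sigma ^ 2)) *
      ∑ k ∈ Finset.range P.m, ∑ l ∈ Finset.range (k + 1),
        P.Ckl ρ k l * iteratedDeriv l (fun z => P.laplaceTotal ρ z) (P.m * P.s ρ) := by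
    simp_rw [coverageAt, fadingTail_eq_sum, N.iteratedDeriv_laplaceTotal hρ hz]
    rw [integral_const_mul, integral_finsetSum]
    · congr 1
      refine Finset.sum_congr rfl fun k _ => ?_
      rw [integral_finsetSum _ fun l _ => (hint l).const_mul _]
      exact Finset.sum_congr rfl fun l _ => integral_const_mul _ _
    · exact fun k _ => integrable_finsetSum _ fun l _ => (hint l).const_mul _
  rw [HetNetParams.coverageIntegrand, h, mul_comm]

lemma integrableOn_coverageIntegrand (N : HetNet P μ) : IntegrableOn P.coverageIntegrand (Ioi 0) :=
  N.integrableOn_fR_mul_coverageAt.congr_fun (fun _ hρ => (N.coverageIntegrand_eq hρ).symm)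
    measurableSet_Ioi

theorem measureReal_gamma_lt_sinr :
    μ.real {ω | P.gammaM < N.sinr ω} = ∫ ρ in Ioi 0, P.coverageIntegrand ρ := by
  rw [setIntegral_congr_fun measurableSet_Ioi fun ρ hρ => N.coverageIntegrand_eq hρ,
    integral_eq_lintegral_of_nonneg_ae ((ae_restrict_iff' measurableSet_Ioi).2
      (ae_of_all _ fun r hr => mul_nonneg (P.fR_nonneg hr) (N.coverageAt_nonneg hr)))
      (P.measurable_fR.mul N.measurable_coverageAt).aestronglyMeasurable,
    measureReal_def, N.measure_gamma_lt_sinr]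

end HetNet

end

theorem theorem2 (P : HetNetParams) {Ω : Type*} [MeasurableSpace Ω] (μ : Measure Ω)
    [IsProbabilityMeasure μ] (N : HetNet P μ) :
    -- almost surely there is exactly one serving MBS, and both interferences are finite
    (∀ᵐ ω ∂μ, (∃! j, ∀ i, N.equivDist ω j ≤ N.equivDist ω i) ∧
      Summable (N.macroTerm ω) ∧ Summable (N.femtoTerm ω)) ∧
    -- the distance of the serving MBS has the density `f_R`
    (μ.map N.R = (volume.restrict (Ioi 0)).withDensity (fun r => ENNReal.ofReal (P.fR r))) ∧
    -- the Laplace transform of the MBS interference, given the distance of the serving MBS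
    (∀ z : ℝ, 0 ≤ z →
      μ[fun ω => Real.exp (-z * N.macroInterference ω) |
          MeasurableSpace.comap N.R inferInstance]
        =ᵐ[μ] fun ω => P.laplaceMacro (N.R ω) z) ∧
    -- the Laplace transform of the FBS interference
    (∀ z : ℝ, 0 ≤ z →
      ∫ ω, Real.exp (-z * N.femtoInterference ω) ∂μ = P.laplaceFemto z) ∧
    -- the product of the Laplace transforms is smooth, and the coverage integral converges
    (∀ ρ : ℝ, 0 < ρ → ∀ n : ℕ, ContDiffOn ℝ n (fun z => P.laplaceTotal ρ z) (Ioi 0)) ∧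
    IntegrableOn P.coverageIntegrand (Ioi 0) ∧
    -- the coverage probability
    μ.real {ω | P.gammaM < N.sinr ω} = ∫ ρ in Ioi 0, P.coverageIntegrand ρ := by
  refine ⟨?_, N.map_R, fun z hz => N.condExp_exp_macroInterference hz, fun z hz => N.integral_exp_femtoInterference hz,
    fun ρ hρ n => N.contDiffOn_laplaceTotal hρ n, N.integrableOn_coverageIntegrand,
    N.measureReal_gamma_lt_sinr⟩
  filter_upwards [N.ae_existsUnique_serving, N.ae_summable_macroTerm, N.ae_summable_femtoTerm]
    with ω h1 h2 h3 using ⟨h1, h2, h3⟩
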